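/- Let $s,m\ge 1$, let $A\in\mathbb C^{n\times n}$ be unitary and $\mathbf B\in\mathbb C^{n\times s}$. For block vectors put $\mathrm{blockspan}\{X_1,\dots,X_m\}=\{\sum_k X_kC_k: C_k\in\mathbb C^{s\times s}\}$, and let $\mathcal{EK}_m(A,\mathbf B)$ be the block span of the first $m$ terms of $\mathbf B, A\mathbf B, A^{-1}\mathbf B, A^2\mathbf B, A^{-2}\mathbf B,\dots$. Assume that it has full dimension, $\dim_{\mathbb C}\mathcal{EK}_m(A,\mathbf B)=s^2m$. For a Laurent matrix polynomial $R(z)=\sum_k z^kC_k$, $C_k\in\mathbb C^{s\times s}$, let $R(A)\circ\mathbf B=\sum_k A^k\mathbf B C_k$, and let $\langle\!\langle R,S\rangle\!\rangle=(R(A)\circ\mathbf B)^*(S(A)\circ\mathbf B)$. Let $\mu=\sum_{\lambda\in\sigma(A)}\mathbf B^*\Pi_\lambda\mathbf B\,\delta_\lambda$ be the spectral measure of $(A,\mathbf B)$, where $\Pi_\lambda$ is the orthogonal projection onto the $\lambda$-eigenspace of $A$, and let $\langle\!\langle P,Q\rangle\!\rangle^L=\int P\,d\mu\,Q^*$. Consider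 right and left orthonormal matrix polynomials $\varphi^R_0,\dots,\varphi^R_{m-1}$ and $\varphi^L_0,\dots,\varphi^L_{m-1}$: $\deg\varphi^R_k=\deg\varphi^L_k=k$ and $\langle\!\langle\varphi^R_i,\varphi^R_j\rangle\!\rangle=\delta_{ij}I_s=\langle\!\langle\varphi^L_i,\varphi^L_j\rangle\!\rangle^L$, normalized by $\varphi^L_0=(\varphi^R_0)^*$ and by the requirement that, with $\kappa^R_k,\kappa^L_k$ the leading coefficients, $(\kappa^R_{k+1})^{-1}\kappa^R_k$ and $\kappa^L_k(\kappa^L_{k+1})^{-1}$ are Hermitian positive definite for $0\le k<m-1$. For $P=\sum_{j\le k}z^jP_j$ of degree $k$ let $P^{\#}=\sum_{j\le k} z^{k-j}P_j^*$. Define, for $1\le k\le m$, the Verblunsky coefficients $\alpha_k=\langle\!\langle z\varphi^R_{k-1},\varphi^{L,\#}_{k-1}\rangle\!\rangle$ and $\rho^R_k=(I-\alpha_k\alpha_k^*)^{1/2}$, $\rho^L_k=(I-\alpha_k^*\alpha_k)^{1/2}$; the CMV basis $\chi_{2k}=z^{-k}\varphi^{L,\#}_{2k}$, $\chi_{2k+1}=z^{-k}\varphi^R_{2k+1}$;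 the block vectors $W_k=\chi_{k-1}(A)\circ\mathbf B$; and the CMV blocks $\mathcal C_{i,j}=\langle\!\langle\chi_{i-1},z\chi_{j-1}\rangle\!\rangle$, $1\le i,j\le m$. Then: 1. There is $K\in\mathbb C^{s\times s}$ with $K^*\mathbf B^*\mathbf BK=I_s$, and for each such $K$ normalized polynomials as above exist with $\varphi^R_0=K$. The statements 2-6 hold for every choice of them. 2. $W_i^*W_j=\delta_{ij}I_s$ for $1\le i,j\le m$, and $\mathrm{blockspan}\{W_1,\dots,W_m\}=\mathcal{EK}_m(A,\mathbf B)$. 3. $\mathcal C_{i,j}=W_i^*AW_j$, that is, $[W_1,\dots,W_m]^*A[W_1,\dots,W_m]=\mathcal C_m:=(\mathcal C_{i,j})_{i,j=1}^m$ (cutoff block CMV matrix). 4. $\|\alpha_k\|_2<1$ for $1\le k\le m-1$, and $\mathcal C_m=\mathcal L_m\mathcal M_m$, where $\mathcal L_m,\mathcal M_m$ are the leading $m\times m$ block parts of $\mathcal L=\mathrm{diag}(\Theta_1,\Theta_3,\dots)$ and $\mathcal M=\mathrm{diag}(I_s,\Theta_2,\Theta_4,\dots)$ with $\Theta_k=\begin{bmatrix}\alpha_k^*&\rho^L_k\\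 \rho^R_k&-\alpha_k\end{bmatrix}$ (these parts involve only $\alpha_1,\dots,\alpha_m$ and $\rho^{R}_k,\rho^L_k$ for $k<m$). Explicitly, for all indices in $\{1,\dots,m\}$ and $k\ge1$: $\mathcal C_{1,1}=\alpha_1^*$, $\mathcal C_{2,1}=\rho^R_1$, $$\begin{bmatrix}\mathcal C_{2k-1,2k}&\mathcal C_{2k-1,2k+1}\\ \mathcal C_{2k,2k}&\mathcal C_{2k,2k+1}\end{bmatrix}=\begin{bmatrix}\rho^L_{2k-1}\alpha_{2k}^*&\rho^L_{2k-1}\rho^L_{2k}\\-\alpha_{2k-1}\alpha_{2k}^*&-\alpha_{2k-1}\rho^L_{2k}\end{bmatrix},$$ $$\begin{bmatrix}\mathcal C_{2k+1,2k}&\mathcal C_{2k+1,2k+1}\\ \mathcal C_{2k+2,2k}&\mathcal C_{2k+2,2k+1}\end{bmatrix}=\begin{bmatrix}\alpha_{2k+1}^*\rho^R_{2k}&-\alpha_{2k+1}^*\alpha_{2k}\\ \rho^R_{2k+1}\rho^R_{2k}&-\rho^R_{2k+1}\alpha_{2k}\end{bmatrix},$$ and $\mathcal C_{i,j}=0$ if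 $i\in\{2k-1,2k\}$ and $j\notin\{2k-2,\dots,2k+1\}$. 5. Whenever all occurring indices lie in $\{1,\dots,m\}$: $AW_1=W_1\mathcal C_{1,1}+W_2\mathcal C_{2,1}$; $A^*W_i=W_1\mathcal C_{i,1}^*+W_2\mathcal C_{i,2}^*+W_3\mathcal C_{i,3}^*$ for $i=1,2$; $A^*W_i=\sum_{h=2k-2}^{2k+1}W_h\mathcal C_{i,h}^*$ for $i\in\{2k-1,2k\}$, $k\ge2$; and $AW_i=\sum_{h=2k-1}^{2k+2}W_h\mathcal C_{h,i}$ for $i\in\{2k,2k+1\}$, $k\ge1$. 6. One has $W_1=\mathbf B\varphi^R_0$, and $\rho^R_k,\rho^L_k$ are nonsingular for $1\le k\le m-1$. The following procedure, started from $W_1$ (from $\mathbf B$ itself if $\mathbf B^*\mathbf B=I_s$ and $\varphi^R_0=I_s$), computes $W_1,\dots,W_m$, $\alpha_1,\dots,\alpha_{m-1}$ and all blocks of $\mathcal C_m$ (blocks never assigned being zero) except $\mathcal C_{m,m}$ and, if $m$ is odd, $\mathcal C_{m,m-1}$, if $m$ is even, $\mathcal C_{m-1,m}$. Initialization: $W_0=0$,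 $\mathcal C_{1,0}=0$, $X=AW_1$, $\mathcal C_{1,1}=W_1^*X$, $\alpha_1=\mathcal C_{1,1}^*$, $\mathcal C_{2,1}=\rho^R_1$, $W_2=(X-W_1\mathcal C_{1,1})\mathcal C_{2,1}^{-1}$. For $j=3,\dots,m$: if $j=2k+1$, set $X=A^*W_{2k-1}$, $\mathcal C_{2k-1,2k}=X^*W_{2k}$, $\alpha_{2k}=\mathcal C_{2k-1,2k}^*(\rho^L_{2k-1})^{-1}$, form $\mathcal C_{2k-1,2k+1},\mathcal C_{2k,2k},\mathcal C_{2k,2k+1}$ by the formulas in 4, and set $W_{2k+1}=(X-W_{2k-2}\mathcal C_{2k-1,2k-2}^*-W_{2k-1}\mathcal C_{2k-1,2k-1}^*-W_{2k}\mathcal C_{2k-1,2k}^*)(\mathcal C_{2k-1,2k+1}^*)^{-1}$; if $j=2k+2$, set $X=AW_{2k}$, $\mathcal C_{2k+1,2k}=W_{2k+1}^*X$, $\alpha_{2k+1}=(\rho^R_{2k})^{-1}\mathcal C_{2k+1,2k}^*$, form $\mathcal C_{2k+1,2k+1},\mathcal C_{2k+2,2k},\mathcal C_{2k+2,2k+1}$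 by the formulas in 4, and set $W_{2k+2}=(X-W_{2k-1}\mathcal C_{2k-1,2k}-W_{2k}\mathcal C_{2k,2k}-W_{2k+1}\mathcal C_{2k+1,2k})\mathcal C_{2k+2,2k}^{-1}$. 7. Each iteration $j\ge3$ uses exactly one multiplication of a block vector by $A$ or $A^*$ and one block inner product $X^*Y$; its total cost on block vectors, apart from the multiplication by $A$ or $A^*$, is at most $13s^2n$ scalar operations, when a block inner product and a product of an $n\times s$ by an $s\times s$ matrix are charged $2s^2n$ operations each and a difference of block vectors $sn$ (operations on $s\times s$ matrices are not counted). -/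

import Mathlib

open scoped Matrix ComplexOrder MatrixOrder LaurentPolynomial

noncomputable section

/-- `s × s` complex matrices. -/
abbrev SqMat (s : ℕ) := Matrix (Fin s) (Fin s) ℂ

/-- Block vectors: `n × s` complex matrices. -/
abbrev BlockVec (n s : ℕ) := Matrix (Fin n) (Fin s) ℂ

/-- Matrix polynomials `∑ z ^ k C_k` (the indeterminate commutes with the coefficients). -/
abbrev MatPoly (s : ℕ) := Polynomial (SqMat s)

/-- Laurent matrix polynomials `∑ z ^ k C_k`, `k ∈ ℤ`. -/
abbrev MatLaurent (s : ℕ) := LaurentPolynomial (SqMat s)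

/-! ### Block spans and extended block Krylov subspaces -/

/-- The block span `{∑ X_k C_k : C_k ∈ ℂ^{s × s}}`, as a complex subspace of `ℂ^{n × s}`. -/
def blockSpan {n s m : ℕ} (X : Fin m → BlockVec n s) : Submodule ℂ (BlockVec n s) where
  carrier := {Y | ∃ c : Fin m → SqMat s, Y = ∑ k, X k * c k}
  add_mem' := by
    rintro _ _ ⟨c, rfl⟩ ⟨d, rfl⟩
    exact ⟨fun k => c k + d k, by simp [Matrix.mul_add, Finset.sum_add_distrib]⟩
  zero_mem' := ⟨fun _ => 0, by simp⟩
  smul_mem' := by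
    rintro a _ ⟨c, rfl⟩
    exact ⟨fun k => a • c k, by simp [Finset.smul_sum]⟩

/-- The exponents `0, 1, -1, 2, -2, …`, indexed from `0`. -/
def extExponent (k : ℕ) : ℤ :=
  if k % 2 = 1 then (k / 2 : ℕ) + 1 else -((k / 2 : ℕ) : ℤ)

/-- The extended block Krylov subspace: the block span of the first `m` of the block vectors
`B, A B, A⁻¹ B, A² B, A⁻² B, …`. -/
def extBlockKrylov {n s : ℕ} (A : SqMat n) (B : BlockVec n s) (m : ℕ) :
    Submodule ℂ (BlockVec n s) :=
  blockSpan fun k : Fin m => A ^ extExponent k * B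

/-! ### Matrix-valued inner products induced by `(A, B)` -/

/-- The action `R(A) ∘ B = ∑ A ^ k B C_k` of `R(z) = ∑ z ^ k C_k`. -/
def laurentAct {n s : ℕ} (A : SqMat n) (B : BlockVec n s) (R : MatLaurent s) : BlockVec n s :=
  R.coeff.sum fun k c => A ^ k * B * c

/-- The right inner product `⟪R, S⟫ = (R(A) ∘ B)ᴴ (S(A) ∘ B)`. -/
def rightInner {n s : ℕ} (A : SqMat n) (B : BlockVec n s) (R S : MatLaurent s) : SqMat s :=
  (laurentAct A B R)ᴴ * laurentAct A B S

/-- The value `P(w) = ∑ w ^ k C_k` of a matrix polynomial at a scalar. -/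
def matEval {s : ℕ} (P : MatPoly s) (w : ℂ) : SqMat s :=
  P.sum fun k c => w ^ k • c

/-- The mass `Bᴴ Π_w B` that the matrix-valued spectral measure of `(A, B)` has at `w`, where
`Π_w` is the orthogonal projection onto the `w`-eigenspace of `A`. For an orthonormal
eigenbasis `u_j` of a normal `A` this is the sum of `(u_jᴴ B)ᴴ (u_jᴴ B)` over all `j` whose
eigenvalue is `w`. -/
def spectralMass {n s : ℕ} (A : SqMat n) (B : BlockVec n s) (w : ℂ) : SqMat s :=
  Matrix.of fun i j =>
    inner ℂ (WithLp.toLp 2 fun r => B r i)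
      ((Module.End.eigenspace (Matrix.toEuclideanLin A) w).starProjection
        (WithLp.toLp 2 fun r => B r j))

/-- The left inner product `∫ P dμ Qᴴ`, where `μ` is the (discrete) spectral measure of
`(A, B)`; the sum is over the distinct eigenvalues of `A`. -/
def leftInner {n s : ℕ} (A : SqMat n) (B : BlockVec n s) (P Q : MatPoly s) : SqMat s :=
  ∑ w ∈ A.charpoly.roots.toFinset, matEval P w * spectralMass A B w * (matEval Q w)ᴴ

/-! ### Orthonormal matrix polynomials on the unit circle, Verblunsky coefficients -/

/-- The reversed polynomial `∑_{j ≤ k} z ^ (k - j) P_jᴴ` of `P = ∑_{j ≤ k} z ^ j P_j`. -/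
def reversedPoly {s : ℕ} (k : ℕ) (P : MatPoly s) : MatPoly s :=
  ∑ j ∈ Finset.range (k + 1), Polynomial.monomial (k - j) (P.coeff j)ᴴ

/-- `φR 0, …, φR d` and `φL 0, …, φL d` are right and left orthonormal matrix polynomials for
the inner products induced by `(A, B)`, with the normalization for which the Szegő recurrence
holds with Hermitian positive definite coefficients `ρ`: the constants satisfy
`φL 0 = (φR 0)ᴴ`, and consecutive leading coefficients have positive definite quotients. -/
structure IsOMPUC {n s : ℕ} (A : SqMat n) (B : BlockVec n s) (d : ℕ)
    (φR φL : ℕ → MatPoly s) : Prop where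
  degree_right : ∀ k ≤ d, (φR k).natDegree = k
  degree_left : ∀ k ≤ d, (φL k).natDegree = k
  orthonormal_right : ∀ i ≤ d, ∀ j ≤ d,
    rightInner A B (φR i).toLaurent (φR j).toLaurent = if i = j then 1 else 0
  orthonormal_left : ∀ i ≤ d, ∀ j ≤ d,
    leftInner A B (φL i) (φL j) = if i = j then 1 else 0
  constants : (φL 0).coeff 0 = ((φR 0).coeff 0)ᴴ
  leading_right : ∀ k < d, (((φR (k + 1)).coeff (k + 1))⁻¹ * (φR k).coeff k).PosDef
  leading_left : ∀ k < d, ((φL k).coeff k * ((φL (k + 1)).coeff (k + 1))⁻¹).PosDef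

/-- The Verblunsky coefficients `α_k = ⟪z φR_{k-1}, φL_{k-1}^#⟫`, `k ≥ 1`. -/
def verblunsky {n s : ℕ} (A : SqMat n) (B : BlockVec n s) (φR φL : ℕ → MatPoly s) (k : ℕ) :
    SqMat s :=
  rightInner A B (LaurentPolynomial.T 1 * (φR (k - 1)).toLaurent)
    (reversedPoly (k - 1) (φL (k - 1))).toLaurent

/-- `ρ^R = (I - α αᴴ)^{1/2}`. -/
def rhoR {s : ℕ} (α : SqMat s) : SqMat s := CFC.sqrt (1 - α * αᴴ)

/-- `ρ^L = (I - αᴴ α)^{1/2}`. -/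
def rhoL {s : ℕ} (α : SqMat s) : SqMat s := CFC.sqrt (1 - αᴴ * α)

/-! ### CMV basis, CMV blocks and the CMV matrix -/

/-- The CMV basis `χ_{2k} = z^{-k} φL_{2k}^#`, `χ_{2k+1} = z^{-k} φR_{2k+1}`. -/
def cmvBasis {s : ℕ} (φR φL : ℕ → MatPoly s) (k : ℕ) : MatLaurent s :=
  LaurentPolynomial.T (-((k / 2 : ℕ) : ℤ)) *
    (if k % 2 = 0 then reversedPoly k (φL k) else φR k).toLaurent

/-- The block vectors `W_k = χ_{k-1}(A) ∘ B`, `k ≥ 1`. -/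
def cmvVector {n s : ℕ} (A : SqMat n) (B : BlockVec n s) (φR φL : ℕ → MatPoly s) (k : ℕ) :
    BlockVec n s :=
  laurentAct A B (cmvBasis φR φL (k - 1))

/-- The CMV blocks `C_{i,j} = ⟪χ_{i-1}, z χ_{j-1}⟫`, `i, j ≥ 1`. -/
def cmvBlock {n s : ℕ} (A : SqMat n) (B : BlockVec n s) (φR φL : ℕ → MatPoly s) (i j : ℕ) :
    SqMat s :=
  rightInner A B (cmvBasis φR φL (i - 1)) (LaurentPolynomial.T 1 * cmvBasis φR φL (j - 1))

/-- The blocks (indexed from `1`) of `L = diag(Θ_1, Θ_3, …)`, where `Θ_k` is the `2 × 2` block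
matrix with rows `α_kᴴ, ρ^L_k` and `ρ^R_k, -α_k`. -/
def cmvL {s : ℕ} (α : ℕ → SqMat s) (i j : ℕ) : SqMat s :=
  if i % 2 = 1 ∧ j = i then (α i)ᴴ
  else if i % 2 = 1 ∧ j = i + 1 then rhoL (α i)
  else if i % 2 = 0 ∧ j + 1 = i then rhoR (α (i - 1))
  else if i % 2 = 0 ∧ j = i then -α (i - 1)
  else 0

/-- The blocks (indexed from `1`) of `M = diag(I, Θ_2, Θ_4, …)`. -/
def cmvM {s : ℕ} (α : ℕ → SqMat s) (i j : ℕ) : SqMat s :=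
  if i = 1 ∧ j = 1 then 1
  else if i % 2 = 0 ∧ j = i then (α i)ᴴ
  else if i % 2 = 0 ∧ j = i + 1 then rhoL (α i)
  else if i % 2 = 1 ∧ j + 1 = i then rhoR (α (i - 1))
  else if i % 2 = 1 ∧ j = i then -α (i - 1)
  else 0

/-- The `m × m` block cutoff of a block matrix whose blocks are indexed from `1`. -/
def cutoff {s : ℕ} (m : ℕ) (C : ℕ → ℕ → SqMat s) :
    Matrix (Fin m × Fin s) (Fin m × Fin s) ℂ :=
  Matrix.of fun p q => C (p.1 + 1) (q.1 + 1) p.2 q.2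

/-- The block row `[W_1, …, W_m]`. -/
def blockRow {n s : ℕ} (m : ℕ) (W : ℕ → BlockVec n s) : Matrix (Fin n) (Fin m × Fin s) ℂ :=
  Matrix.of fun r q => W (q.1 + 1) r q.2

/-! ### The orthogonalization procedure, with a count of its operations on block vectors -/

/-- Operation counts: multiplications of a block vector by `A` or `Aᴴ`, block inner products
`Xᴴ Y`, and scalar operations spent on block vectors other than the multiplications by `A`
or `Aᴴ`. -/
@[ext]
structure OpCount where
  matvecs : ℕ
  inners : ℕ
  flops : ℕ

/-- A computed value together with the operations spent on it. -/
structure Counted (β : Type) where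
  val : β
  cost : OpCount

instance : Monad Counted where
  pure x := ⟨x, ⟨0, 0, 0⟩⟩
  bind x f :=
    ⟨(f x.val).val,
      ⟨x.cost.matvecs + (f x.val).cost.matvecs, x.cost.inners + (f x.val).cost.inners,
        x.cost.flops + (f x.val).cost.flops⟩⟩

/-- Multiplication of a block vector by an `n × n` matrix. -/
def opApply {n s : ℕ} (A : SqMat n) (X : BlockVec n s) : Counted (BlockVec n s) :=
  ⟨A * X, ⟨1, 0, 0⟩⟩

/-- Block inner product: `s ^ 2` scalar products of vectors of length `n`. -/
def opInner {n s : ℕ} (X Y : BlockVec n s) : Counted (SqMat s) :=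
  ⟨Xᴴ * Y, ⟨0, 1, 2 * s ^ 2 * n⟩⟩

/-- Product of an `n × s` block vector by an `s × s` matrix. -/
def opMul {n s : ℕ} (X : BlockVec n s) (c : SqMat s) : Counted (BlockVec n s) :=
  ⟨X * c, ⟨0, 0, 2 * s ^ 2 * n⟩⟩

/-- Difference of two block vectors. -/
def opSub {n s : ℕ} (X Y : BlockVec n s) : Counted (BlockVec n s) :=
  ⟨X - Y, ⟨0, 0, s * n⟩⟩

/-- The data available during the procedure: block vectors, Verblunsky coefficients and CMV
blocks computed so far; entries that have not been computed are zero. -/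
@[ext]
structure CMVState (n s : ℕ) where
  W : ℕ → BlockVec n s
  α : ℕ → SqMat s
  C : ℕ → ℕ → SqMat s

/-- Store the block `X` at position `(i, j)`. -/
def setBlock {s : ℕ} (C : ℕ → ℕ → SqMat s) (i j : ℕ) (X : SqMat s) : ℕ → ℕ → SqMat s :=
  Function.update C i (Function.update (C i) j X)

/-- Initialization and first step: `W_0 = 0`, `C_{1,0} = 0`, `W_1 = B`, and the computation of
`C_{1,1}`, `α_1`, `C_{2,1}` and `W_2`. -/
def cmvInit {n s : ℕ} (A : SqMat n) (B : BlockVec n s) : Counted (CMVState n s) := do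
  let x ← opApply A B
  let c11 ← opInner B x
  let a1 := c11ᴴ
  let c21 := rhoR a1
  let p ← opMul B c11
  let y ← opSub x p
  let w2 ← opMul y c21⁻¹
  pure
    { W := Function.update (Function.update (fun _ => 0) 1 B) 2 w2
      α := Function.update (fun _ => 0) 1 a1
      C := setBlock (setBlock (fun _ _ => 0) 1 1 c11) 2 1 c21 }

/-- Iteration `j = 2k + 1`. -/
def cmvOddStep {n s : ℕ} (A : SqMat n) (k : ℕ) (st : CMVState n s) :
    Counted (CMVState n s) := do
  let x ← opApply Aᴴ (st.W (2 * k - 1))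
  let c ← opInner x (st.W (2 * k))
  let a := cᴴ * (rhoL (st.α (2 * k - 1)))⁻¹
  let c' := rhoL (st.α (2 * k - 1)) * rhoL a
  let p₁ ← opMul (st.W (2 * k - 2)) (st.C (2 * k - 1) (2 * k - 2))ᴴ
  let y₁ ← opSub x p₁
  let p₂ ← opMul (st.W (2 * k - 1)) (st.C (2 * k - 1) (2 * k - 1))ᴴ
  let y₂ ← opSub y₁ p₂
  let p₃ ← opMul (st.W (2 * k)) cᴴ
  let y₃ ← opSub y₂ p₃
  let w ← opMul y₃ (c'ᴴ)⁻¹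
  pure
    { W := Function.update st.W (2 * k + 1) w
      α := Function.update st.α (2 * k) a
      C := setBlock (setBlock (setBlock (setBlock st.C (2 * k - 1) (2 * k) c)
        (2 * k - 1) (2 * k + 1) c')
        (2 * k) (2 * k) (-st.α (2 * k - 1) * aᴴ))
        (2 * k) (2 * k + 1) (-st.α (2 * k - 1) * rhoL a) }

/-- Iteration `j = 2k + 2`. -/
def cmvEvenStep {n s : ℕ} (A : SqMat n) (k : ℕ) (st : CMVState n s) :
    Counted (CMVState n s) := do
  let x ← opApply A (st.W (2 * k))
  let c ← opInner (st.W (2 * k + 1)) x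
  let a := (rhoR (st.α (2 * k)))⁻¹ * cᴴ
  let c' := rhoR a * rhoR (st.α (2 * k))
  let p₁ ← opMul (st.W (2 * k - 1)) (st.C (2 * k - 1) (2 * k))
  let y₁ ← opSub x p₁
  let p₂ ← opMul (st.W (2 * k)) (st.C (2 * k) (2 * k))
  let y₂ ← opSub y₁ p₂
  let p₃ ← opMul (st.W (2 * k + 1)) c
  let y₃ ← opSub y₂ p₃
  let w ← opMul y₃ c'⁻¹
  pure
    { W := Function.update st.W (2 * k + 2) w
      α := Function.update st.α (2 * k + 1) a
      C := setBlock (setBlock (setBlock (setBlock st.C (2 * k + 1) (2 * k) c)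
        (2 * k + 1) (2 * k + 1) (-aᴴ * st.α (2 * k)))
        (2 * k + 2) (2 * k) c')
        (2 * k + 2) (2 * k + 1) (-rhoR a * st.α (2 * k)) }

/-- Iteration `j ≥ 3` of the loop. -/
def cmvStep {n s : ℕ} (A : SqMat n) (j : ℕ) (st : CMVState n s) : Counted (CMVState n s) :=
  if j % 2 = 1 then cmvOddStep A (j / 2) st else cmvEvenStep A (j / 2 - 1) st

/-- Initialization followed by the iterations `j = 3, …, t + 2`. -/
def cmvLoop {n s : ℕ} (A : SqMat n) (B : BlockVec n s) : ℕ → Counted (CMVState n s)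
  | 0 => cmvInit A B
  | t + 1 => do
    let st ← cmvLoop A B t
    cmvStep A (t + 3) st

/-- The procedure with `m` steps: initialization followed by the iterations `j = 3, …, m`. -/
def cmvProcedure {n s : ℕ} (A : SqMat n) (B : BlockVec n s) (m : ℕ) : Counted (CMVState n s) :=
  cmvLoop A B (m - 2)

end

/-! Everything is carried out with block vectors instead of polynomials. Put `X k = φR_k(A) ∘ B`.
The moments of the spectral measure are `Bᴴ A^k B`, so the left inner product of `P` and `Q` is the
right inner product, taken for `A⁻¹`, of the polynomials with adjoint coefficients (`leftInner_eq`).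
The left polynomials thus give vectors `Y k` that form the same kind of system for `A⁻¹`, and the
reversed left polynomial acts as `A^k Y k`. Exchanging `A` with `A⁻¹` exchanges `X` with `Y` and `α`
with its adjoint (`systemVerblunsky_swap`), so the left half of the theory follows from the right
half.

The Szegő recurrence (`szego_aux`) holds because `A X_k - A^k Y_k αᴴ - X_{k+1} r`, with `r` the
quotient of leading coefficients, lies in the span of `B, …, A^k B` and is also orthogonal to it.
Comparing norms gives `r² = 1 - α αᴴ`, and since `r` is positive definite, `r = ρ^R`. With the
intertwining `ρ^R α = α ρ^L`, the inner products of neighbouring vectors are exactly the four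
entries of `Θ`.

The CMV vectors `W` orthonormalize the powers `0, 1, -1, 2, …`, and an alternate basis `V`
orthonormalizes `0, -1, 1, -2, …`. Each vector lies in one window of exponents and is orthogonal to
the preceding window, so `Wᴴ A V` and `Vᴴ W` are block diagonal, with the blocks of `L` and `M`.
Inserting the expansion in `V` between `Wᴴ A` and `W` gives `C = L M`. The finite cutoff loses
nothing: for even `m` the vectors `Aᴴ W_i`, for odd `m` the vectors `W_j`, lie in the span of `V_1,
…, V_m` (`systemCMV_factorization`).

The block formulas, the zero pattern and the short recurrences are consequences of the factorization
and of expansion in `W`. The procedure is correct by induction with the invariant `StateCorrect`: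
each step solves one recurrence for its last vector, whose coefficient is a product of invertible
`ρ`'s. Existence of the polynomials is block Gram–Schmidt, run for `A` and for `A⁻¹` with the same
constant term and with Hermitian square roots as normalizing factors. -/

noncomputable section

/-! ### Krylov spans -/

section Krylov

variable {n s : ℕ}

/-- The block span of `A ^ k B`, `a ≤ k ≤ b`. -/
def krylovSpan (A : SqMat n) (B : BlockVec n s) (a b : ℤ) : Submodule ℂ (BlockVec n s) :=
  Submodule.span ℂ {Z | ∃ (k : ℤ) (c : SqMat s), a ≤ k ∧ k ≤ b ∧ Z = A ^ k * B * c}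

theorem zpow_mul_mem_krylovSpan (A : SqMat n) (B : BlockVec n s) {a b k : ℤ} (hak : a ≤ k)
    (hkb : k ≤ b) (c : SqMat s) : A ^ k * B * c ∈ krylovSpan A B a b :=
  Submodule.subset_span ⟨k, c, hak, hkb, rfl⟩

theorem krylovSpan_le {A : SqMat n} {B : BlockVec n s} {a b : ℤ}
    {p : Submodule ℂ (BlockVec n s)}
    (h : ∀ k, a ≤ k → k ≤ b → ∀ c : SqMat s, A ^ k * B * c ∈ p) : krylovSpan A B a b ≤ p := by
  refine Submodule.span_le.2 ?_
  rintro _ ⟨k, c, hak, hkb, rfl⟩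
  exact h k hak hkb c

theorem krylovSpan_mono {A : SqMat n} {B : BlockVec n s} {a b a' b' : ℤ} (ha : a' ≤ a)
    (hb : b ≤ b') : krylovSpan A B a b ≤ krylovSpan A B a' b' :=
  krylovSpan_le fun _ h₁ h₂ c => zpow_mul_mem_krylovSpan A B (ha.trans h₁) (h₂.trans hb) c

theorem mul_right_mem_krylovSpan {A : SqMat n} {B : BlockVec n s} {a b : ℤ} {Z : BlockVec n s}
    (hZ : Z ∈ krylovSpan A B a b) (c : SqMat s) : Z * c ∈ krylovSpan A B a b := by
  have : krylovSpan A B a b ≤ (krylovSpan A B a b).comap (mulRightLinearMap (Fin n) ℂ c) := by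
    refine krylovSpan_le fun k h₁ h₂ d => ?_
    simpa [Matrix.mul_assoc] using zpow_mul_mem_krylovSpan A B h₁ h₂ (d * c)
  exact this hZ

theorem zpow_mul_left_mem_krylovSpan {A : SqMat n} (hA : IsUnit A.det) {B : BlockVec n s}
    {a b : ℤ} {Z : BlockVec n s} (hZ : Z ∈ krylovSpan A B a b) (j : ℤ) :
    A ^ j * Z ∈ krylovSpan A B (j + a) (j + b) := by
  have : krylovSpan A B a b ≤
      (krylovSpan A B (j + a) (j + b)).comap (mulLeftLinearMap (Fin s) ℂ (A ^ j)) := by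
    refine krylovSpan_le fun k h₁ h₂ d => ?_
    have := zpow_mul_mem_krylovSpan A B (a := j + a) (b := j + b) (k := j + k) (by lia) (by lia) d
    rw [Matrix.zpow_add hA] at this
    simpa [Matrix.mul_assoc] using this
  exact this hZ

/-- `Z` is orthogonal to the block vectors `A ^ k B`, `a ≤ k ≤ b`. -/
def KrylovOrth (A : SqMat n) (B : BlockVec n s) (a b : ℤ) (Z : BlockVec n s) : Prop :=
  ∀ Y ∈ krylovSpan A B a b, Yᴴ * Z = 0

theorem krylovOrth_of_forall {A : SqMat n} {B : BlockVec n s} {a b : ℤ} {Z : BlockVec n s}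
    (h : ∀ k, a ≤ k → k ≤ b → (A ^ k * B)ᴴ * Z = 0) : KrylovOrth A B a b Z := by
  intro Y hY
  induction hY using Submodule.span_induction with
  | mem Y hY =>
    obtain ⟨k, c, h₁, h₂, rfl⟩ := hY
    rw [Matrix.conjTranspose_mul, Matrix.mul_assoc, h k h₁ h₂, Matrix.mul_zero]
  | zero => simp
  | add Y₁ Y₂ _ _ h₁ h₂ => simp [Matrix.add_mul, h₁, h₂]
  | smul c Y _ h => simp [h]

theorem KrylovOrth.mono {A : SqMat n} {B : BlockVec n s} {a b a' b' : ℤ} {Z : BlockVec n s}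
    (h : KrylovOrth A B a b Z) (ha : a ≤ a') (hb : b' ≤ b) : KrylovOrth A B a' b' Z :=
  fun Y hY => h Y (krylovSpan_mono ha hb hY)

theorem KrylovOrth.mul_right {A : SqMat n} {B : BlockVec n s} {a b : ℤ} {Z : BlockVec n s}
    (h : KrylovOrth A B a b Z) (c : SqMat s) : KrylovOrth A B a b (Z * c) :=
  fun Y hY => by rw [← Matrix.mul_assoc, h Y hY, Matrix.zero_mul]

theorem KrylovOrth.sub {A : SqMat n} {B : BlockVec n s} {a b : ℤ} {Z Z' : BlockVec n s}
    (h : KrylovOrth A B a b Z) (h' : KrylovOrth A B a b Z') : KrylovOrth A B a b (Z - Z') :=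
  fun Y hY => by rw [Matrix.mul_sub, h Y hY, h' Y hY, sub_zero]

/-! ### Integer powers of a unitary matrix -/

theorem isUnit_det_of_unitary {A : SqMat n} (hA : A ∈ Matrix.unitaryGroup (Fin n) ℂ) :
    IsUnit A.det := Matrix.UnitaryGroup.det_isUnit ⟨A, hA⟩

theorem inv_eq_of_unitary {A : SqMat n} (hA : A ∈ Matrix.unitaryGroup (Fin n) ℂ) :
    A⁻¹ = Aᴴ :=
  Matrix.inv_eq_right_inv (Matrix.mem_unitaryGroup_iff.1 hA)

theorem inv_mem_unitaryGroup {A : SqMat n} (hA : A ∈ Matrix.unitaryGroup (Fin n) ℂ) :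
    A⁻¹ ∈ Matrix.unitaryGroup (Fin n) ℂ := by
  rw [inv_eq_of_unitary hA]; exact Unitary.star_mem hA

theorem conjTranspose_zpow_of_unitary {A : SqMat n} (hA : A ∈ Matrix.unitaryGroup (Fin n) ℂ)
    (k : ℤ) : (A ^ k)ᴴ = A ^ (-k) := by
  rw [Matrix.conjTranspose_zpow, ← inv_eq_of_unitary hA,
    Matrix.inv_zpow' (isUnit_det_of_unitary hA)]

theorem zpow_mul_zpow_mul {A : SqMat n} (hA : A ∈ Matrix.unitaryGroup (Fin n) ℂ)
    (j k : ℤ) (Z : BlockVec n s) : A ^ j * (A ^ k * Z) = A ^ (j + k) * Z := by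
  rw [Matrix.zpow_add (isUnit_det_of_unitary hA), Matrix.mul_assoc]

theorem mul_zpow_mul_blockVec {A : SqMat n} (hA : A ∈ Matrix.unitaryGroup (Fin n) ℂ)
    (k : ℤ) (Z : BlockVec n s) : A * (A ^ k * Z) = A ^ (1 + k) * Z := by
  simpa using zpow_mul_zpow_mul hA 1 k Z

/-- Moving powers of a unitary matrix between the factors of a block inner product. -/
theorem zpow_mul_conjTranspose_mul {A : SqMat n} (hA : A ∈ Matrix.unitaryGroup (Fin n) ℂ)
    (j k : ℤ) (Y Z : BlockVec n s) : (A ^ j * Y)ᴴ * (A ^ k * Z) = Yᴴ * (A ^ (k - j) * Z) := by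
  rw [Matrix.conjTranspose_mul, conjTranspose_zpow_of_unitary hA, Matrix.mul_assoc,
    zpow_mul_zpow_mul hA, neg_add_eq_sub]

theorem KrylovOrth.zpow_mul {A : SqMat n} (hA : A ∈ Matrix.unitaryGroup (Fin n) ℂ)
    {B : BlockVec n s} {a b : ℤ} {Z : BlockVec n s} (h : KrylovOrth A B a b Z) (j : ℤ) :
    KrylovOrth A B (j + a) (j + b) (A ^ j * Z) := by
  refine krylovOrth_of_forall fun k h₁ h₂ => ?_
  rw [zpow_mul_conjTranspose_mul hA]
  have := h (A ^ (k - j) * B * 1) (zpow_mul_mem_krylovSpan A B (by lia) (by lia) 1)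
  rw [Matrix.mul_one, Matrix.conjTranspose_mul, Matrix.mul_assoc,
    conjTranspose_zpow_of_unitary hA, neg_sub] at this
  exact this

theorem krylovSpan_inv {A : SqMat n} (hA : A ∈ Matrix.unitaryGroup (Fin n) ℂ)
    (B : BlockVec n s) (a b : ℤ) : krylovSpan A⁻¹ B a b = krylovSpan A B (-b) (-a) := by
  have hdet := isUnit_det_of_unitary hA
  apply le_antisymm
  · refine krylovSpan_le fun k h₁ h₂ c => ?_
    rw [Matrix.inv_zpow' hdet]
    exact zpow_mul_mem_krylovSpan A B (by lia) (by lia) c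
  · refine krylovSpan_le fun k h₁ h₂ c => ?_
    have := zpow_mul_mem_krylovSpan A⁻¹ B (a := a) (b := b) (k := -k) (by lia) (by lia) c
    rwa [Matrix.inv_zpow' hdet, neg_neg] at this

theorem krylovOrth_inv {A : SqMat n} (hA : A ∈ Matrix.unitaryGroup (Fin n) ℂ)
    {B : BlockVec n s} {a b : ℤ} {Z : BlockVec n s} :
    KrylovOrth A⁻¹ B a b Z ↔ KrylovOrth A B (-b) (-a) Z := by
  rw [KrylovOrth, KrylovOrth, krylovSpan_inv hA]

/-! ### Block spans and dimensions -/

/-- The linear map `(c_k) ↦ ∑ X_k c_k`. -/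
def blockMap {m : ℕ} (X : Fin m → BlockVec n s) : (Fin m → SqMat s) →ₗ[ℂ] BlockVec n s where
  toFun c := ∑ k, X k * c k
  map_add' c d := by simp [Matrix.mul_add, Finset.sum_add_distrib]
  map_smul' a c := by simp [Finset.smul_sum]

theorem range_blockMap {m : ℕ} (X : Fin m → BlockVec n s) :
    LinearMap.range (blockMap X) = blockSpan X := by
  ext Y
  constructor
  · rintro ⟨c, rfl⟩; exact ⟨c, rfl⟩
  · rintro ⟨c, rfl⟩; exact ⟨c, rfl⟩

theorem finrank_pi_sqMat (m : ℕ) : Module.finrank ℂ (Fin m → SqMat s) = s ^ 2 * m := by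
  simp [Module.finrank_pi_fintype, Module.finrank_matrix]; ring

theorem finrank_blockSpan_le {m : ℕ} (X : Fin m → BlockVec n s) :
    Module.finrank ℂ (blockSpan X) ≤ s ^ 2 * m := by
  rw [← range_blockMap, ← finrank_pi_sqMat m]
  exact LinearMap.finrank_range_le _

/-- Rank–nullity: full dimension of a block span means uniqueness of the block coefficients. -/
theorem blockMap_injective_iff {m : ℕ} (X : Fin m → BlockVec n s) :
    Function.Injective (blockMap X) ↔ Module.finrank ℂ (blockSpan X) = s ^ 2 * m := by
  rw [← range_blockMap, ← finrank_pi_sqMat m, ← LinearMap.ker_eq_bot]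
  have := LinearMap.finrank_range_add_finrank_ker (blockMap X)
  constructor
  · intro h; rw [h, finrank_bot] at this; lia
  · intro h; exact Submodule.finrank_eq_zero.1 (by lia)

theorem mem_blockSpan {m : ℕ} (X : Fin m → BlockVec n s) (k : Fin m) (c : SqMat s) :
    X k * c ∈ blockSpan X :=
  ⟨Pi.single k c, by
    rw [Finset.sum_eq_single k] <;> simp +contextual⟩

theorem blockSpan_le {m : ℕ} {X : Fin m → BlockVec n s} {p : Submodule ℂ (BlockVec n s)}
    (h : ∀ k c, X k * c ∈ p) : blockSpan X ≤ p := by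
  rintro _ ⟨c, rfl⟩
  exact Submodule.sum_mem _ fun k _ => h k _

theorem krylovSpan_eq_blockSpan (A : SqMat n) (B : BlockVec n s) (a : ℤ) (m : ℕ) :
    krylovSpan A B a (a + m - 1) = blockSpan fun k : Fin m => A ^ (a + (k : ℕ)) * B := by
  apply le_antisymm
  · refine krylovSpan_le fun k h₁ h₂ c => ?_
    have := mem_blockSpan (fun k : Fin m => A ^ (a + (k : ℕ)) * B)
      ⟨(k - a).toNat, by lia⟩ c
    simpa [Int.toNat_of_nonneg (sub_nonneg.2 h₁)] using this
  · exact blockSpan_le fun k c => zpow_mul_mem_krylovSpan A B (by have := k.2; lia) (by have := k.2; lia) c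

/-- The first `m` exponents of `0, 1, -1, 2, …` fill an interval, so extended Krylov spaces are
windows of consecutive powers and can be shifted. -/
theorem extBlockKrylov_eq_krylovSpan (A : SqMat n) (B : BlockVec n s) (m : ℕ) (hm : 1 ≤ m) :
    extBlockKrylov A B m =
      krylovSpan A B (-(((m - 1) / 2 : ℕ) : ℤ)) ((m / 2 : ℕ) : ℤ) := by
  apply le_antisymm
  · refine blockSpan_le fun k c => zpow_mul_mem_krylovSpan A B ?_ ?_ c
    · unfold extExponent; split_ifs <;> lia
    · unfold extExponent; split_ifs <;> lia
  · refine krylovSpan_le fun k h₁ h₂ c => ?_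
    obtain ⟨i, hi, rfl⟩ : ∃ i < m, extExponent i = k := by
      by_cases hk : 0 < k
      -- Counting from `0`, a positive exponent `k` sits at position `2k - 1`, and an exponent `k ≤
      -- 0` at position `-2k`.
      · exact ⟨2 * k.toNat - 1, by lia, by unfold extExponent; split_ifs <;> lia⟩
      · exact ⟨2 * (-k).toNat, by lia, by unfold extExponent; split_ifs <;> lia⟩
    exact mem_blockSpan (fun k : Fin m => A ^ extExponent k * B) ⟨i, hi⟩ c

theorem finrank_krylovSpan_shift {A : SqMat n} (hA : IsUnit A.det) (B : BlockVec n s)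
    (a b j : ℤ) :
    Module.finrank ℂ (krylovSpan A B (j + a) (j + b)) =
      Module.finrank ℂ (krylovSpan A B a b) := by
  have key : ∀ a b j : ℤ, Module.finrank ℂ (krylovSpan A B (j + a) (j + b)) ≤
      Module.finrank ℂ (krylovSpan A B a b) := by
    intro a b j
    have : krylovSpan A B (j + a) (j + b) ≤
        (krylovSpan A B a b).map (mulLeftLinearMap (Fin s) ℂ (A ^ j)) := by
      intro Z hZ
      refine ⟨A ^ (-j) * Z, ?_, ?_⟩
      · simpa using zpow_mul_left_mem_krylovSpan hA hZ (-j)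
      · simp [← Matrix.mul_assoc, ← Matrix.zpow_add hA]
    exact (Submodule.finrank_mono this).trans (Submodule.finrank_map_le _ _)
  refine le_antisymm (key a b j) ?_
  -- The reverse inequality is the same one applied to the shift back by `-j`.
  have := key (j + a) (j + b) (-j)
  rwa [neg_add_cancel_left, neg_add_cancel_left] at this

/-- Orthonormal block vectors are block independent. -/
theorem finrank_blockSpan_of_orthonormal {m : ℕ} {V : Fin m → BlockVec n s}
    (h : ∀ i j, (V i)ᴴ * V j = if i = j then 1 else 0) :
    Module.finrank ℂ (blockSpan V) = s ^ 2 * m := by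
  rw [← blockMap_injective_iff, injective_iff_map_eq_zero]
  intro c hc
  ext1 i
  have : (V i)ᴴ * blockMap V c = c i := by
    simp [blockMap, Matrix.mul_sum, ← Matrix.mul_assoc, h]
  rw [← this, hc]; simp

/-- A dimension count: `m` orthonormal block vectors already span dimension `s² m`, the most that a
window of `m` powers can have. -/
theorem blockSpan_eq_krylovSpan_of_orthonormal {A : SqMat n} {B : BlockVec n s} {a : ℤ} {m : ℕ}
    {V : Fin m → BlockVec n s} (h : ∀ i j, (V i)ᴴ * V j = if i = j then 1 else 0)
    (hV : ∀ i, V i ∈ krylovSpan A B a (a + m - 1)) :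
    blockSpan V = krylovSpan A B a (a + m - 1) := by
  apply Submodule.eq_of_le_of_finrank_le
  · exact blockSpan_le fun k c => mul_right_mem_krylovSpan (hV k) c
  · rw [finrank_blockSpan_of_orthonormal h, krylovSpan_eq_blockSpan]
    exact finrank_blockSpan_le _

/-- Expansion in an orthonormal basis of a Krylov span. -/
theorem eq_sum_of_orthonormal {A : SqMat n} {B : BlockVec n s} {a b : ℤ} {m : ℕ}
    {V : ℕ → BlockVec n s} (hb : b = a + m - 1)
    (h : ∀ i ∈ Finset.Icc 1 m, ∀ j ∈ Finset.Icc 1 m, (V i)ᴴ * V j = if i = j then 1 else 0)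
    (hV : ∀ i ∈ Finset.Icc 1 m, V i ∈ krylovSpan A B a b) {Z : BlockVec n s}
    (hZ : Z ∈ krylovSpan A B a b) :
    Z = ∑ i ∈ Finset.Icc 1 m, V i * ((V i)ᴴ * Z) := by
  subst hb
  have h' : ∀ i j : Fin m, (V (i + 1))ᴴ * V (j + 1) = if i = j then 1 else 0 := by
    intro i j
    rw [h _ (by simp) _ (by simp)]
    simp [Fin.ext_iff]
  rw [← blockSpan_eq_krylovSpan_of_orthonormal h' fun i => hV _ (by simp)] at hZ
  obtain ⟨c, rfl⟩ := hZ
  have hc : ∀ i : Fin m, (V (i + 1))ᴴ * ∑ k : Fin m, V (k + 1) * c k = c i := by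
    intro i
    simp [Matrix.mul_sum, ← Matrix.mul_assoc, h']
  have : Finset.Icc 1 m = (Finset.range m).image (· + 1) := by
    ext x; simp only [Finset.mem_Icc, Finset.mem_image, Finset.mem_range]
    constructor
    · rintro ⟨h₁, h₂⟩; exact ⟨x - 1, by lia, by lia⟩
    · rintro ⟨y, hy, rfl⟩; lia
  rw [this, Finset.sum_image (by simp), Finset.sum_range]
  simp [hc]

end Krylov

/-! ### Square roots and intertwining -/

section Sqrt

variable {s : ℕ}

theorem rhoR_eq_of_posDef {α r : SqMat s} (hr : r.PosDef) (h : r * r = 1 - α * αᴴ) :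
    rhoR α = r :=
  CFC.sqrt_unique h hr.posSemidef.nonneg

theorem rhoR_conjTranspose (α : SqMat s) : rhoR αᴴ = rhoL α := by
  simp [rhoR, rhoL]

/-- Square roots intertwine: if `p ^ 2 a = a q ^ 2` with `p`, `q` positive definite, then
`p a = a q`. -/
theorem mul_eq_mul_of_sq_mul_eq_mul_sq {p q a : SqMat s} (hp : p.PosDef) (hq : q.PosDef)
    (h : p * p * a = a * (q * q)) : p * a = a * q := by
  set D := p * a - a * q with hD
  -- The defect `D` solves a homogeneous Sylvester equation. Multiplying by `Dᴴ` and taking traces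
  -- equates a nonnegative number with a nonpositive one.
  have hsylv : p * D = -(D * q) := by
    rw [hD, Matrix.mul_sub, Matrix.sub_mul, ← Matrix.mul_assoc, h]
    simp only [Matrix.mul_assoc]; abel
  have h₁ : 0 ≤ (Dᴴ * p * D).trace := (hp.posSemidef.conjTranspose_mul_mul_same D).trace_nonneg
  have h₂ : 0 ≤ (D * q * Dᴴ).trace := (hq.posSemidef.mul_mul_conjTranspose_same D).trace_nonneg
  have h₃ : (Dᴴ * p * D).trace = -(D * q * Dᴴ).trace := by
    rw [Matrix.mul_assoc, hsylv, Matrix.mul_neg, Matrix.trace_neg, Matrix.trace_mul_comm]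
  have h₄ : (Dᴴ * p * D).trace = 0 :=
    le_antisymm (by rw [h₃]; simpa using h₂) h₁
  have h₅ : Dᴴ * p * D = 0 :=
    (hp.posSemidef.conjTranspose_mul_mul_same D).trace_eq_zero_iff.1 h₄
  have h₆ : D = 0 := by
    by_contra hne
    obtain ⟨i, j, hij⟩ : ∃ i j, D i j ≠ 0 := by
      by_contra! hc
      exact hne (by ext i j; exact hc i j)
    have hx : D.col j ≠ 0 := fun h0 => hij (congrFun h0 i)
    have hpos := hp.dotProduct_mulVec_pos hx
    have : star (D.col j) ⬝ᵥ p *ᵥ D.col j = (Dᴴ * p * D) j j := by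
      rw [Matrix.mul_assoc, Matrix.mul_apply]
      rfl
    rw [this, h₅] at hpos
    simp at hpos
  exact sub_eq_zero.1 h₆

/-- Positive definiteness gives `‖α x‖ < 1` for each unit vector; compactness of the sphere keeps
the inequality strict for the supremum. -/
theorem norm_toEuclideanCLM_lt_one {α : SqMat s} (h : (1 - αᴴ * α).PosDef) :
    ‖Matrix.toEuclideanCLM (𝕜 := ℂ) α‖ < 1 := by
  set T := Matrix.toEuclideanCLM (𝕜 := ℂ) α with hT
  have key : ∀ x : EuclideanSpace ℂ (Fin s), ‖x‖ = 1 → ‖T x‖ < 1 := by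
    intro x hx
    have hx0 : WithLp.ofLp x ≠ 0 := by
      intro h0
      have : x = 0 := by ext i; exact congrFun h0 i
      simp [this] at hx
    have hpos := h.dotProduct_mulVec_pos hx0
    have h₁ : star (WithLp.ofLp x) ⬝ᵥ WithLp.ofLp x = 1 := by
      have := EuclideanSpace.inner_eq_star_dotProduct x x
      rw [inner_self_eq_norm_sq_to_K, hx] at this
      rw [dotProduct_comm, ← this]; simp
    have h₂ : star (WithLp.ofLp x) ⬝ᵥ (αᴴ * α) *ᵥ WithLp.ofLp x = ((‖T x‖ ^ 2 : ℝ) : ℂ) := by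
      have := EuclideanSpace.inner_eq_star_dotProduct (T x) (T x)
      rw [inner_self_eq_norm_sq_to_K] at this
      push_cast
      refine Eq.trans ?_ this.symm
      rw [hT, Matrix.ofLp_toEuclideanCLM, dotProduct_comm (α *ᵥ _), Matrix.star_mulVec,
        ← Matrix.mulVec_mulVec, Matrix.dotProduct_mulVec]
    rw [Matrix.sub_mulVec, Matrix.one_mulVec, dotProduct_sub, h₁, h₂, sub_pos] at hpos
    have : ‖T x‖ ^ 2 < 1 := by exact_mod_cast hpos
    nlinarith [norm_nonneg (T x)]
  -- For `s = 0` the unit sphere is empty and has no maximizer.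
  rcases isEmpty_or_nonempty (Fin s) with hs | hs
  · have : T = 0 := Subsingleton.elim _ _
    simp [this]
  · obtain ⟨x, hx, hmax⟩ := (isCompact_sphere (0 : EuclideanSpace ℂ (Fin s)) 1).exists_isMaxOn
      (NormedSpace.sphere_nonempty.2 zero_le_one) T.continuous.norm.continuousOn
    refine lt_of_le_of_lt ?_ (key x (by simpa using hx))
    refine ContinuousLinearMap.opNorm_le_of_unit_norm (norm_nonneg _) fun y hy => ?_
    exact hmax (by simpa using hy)

end Sqrt

/-! ### Orthonormal systems of Szegő type -/

section Szego

variable {n s : ℕ}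

/-- Orthonormal block vectors `X_k = A ^ k B κ_k + …`, `k ≤ d`, obtained from
`B, A B, …, A ^ d B`, with positive definite quotients of the leading coefficients. -/
structure IsSzegoSystem (A : SqMat n) (B : BlockVec n s) (d : ℕ) (X : ℕ → BlockVec n s)
    (κ : ℕ → SqMat s) : Prop where
  leading : ∀ k ≤ d, X k - A ^ (k : ℤ) * B * κ k ∈ krylovSpan A B 0 (k - 1)
  isUnit : ∀ k ≤ d, IsUnit (κ k)
  orthonormal : ∀ i ≤ d, ∀ j ≤ d, (X i)ᴴ * X j = if i = j then 1 else 0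
  ratio : ∀ k < d, ((κ (k + 1))⁻¹ * κ k).PosDef

variable {A : SqMat n} {B : BlockVec n s} {d : ℕ} {X Y : ℕ → BlockVec n s} {κ κ' : ℕ → SqMat s}

theorem IsSzegoSystem.mem (h : IsSzegoSystem A B d X κ) {k : ℕ} (hk : k ≤ d) :
    X k ∈ krylovSpan A B 0 k := by
  have h₁ := krylovSpan_mono (A := A) (B := B) le_rfl (by lia : (k : ℤ) - 1 ≤ k) (h.leading k hk)
  have h₂ := zpow_mul_mem_krylovSpan A B (by lia : (0 : ℤ) ≤ k) (le_refl (k : ℤ)) (κ k)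
  simpa using add_mem h₁ h₂

theorem IsSzegoSystem.orth (h : IsSzegoSystem A B d X κ) {k : ℕ} (hk : k ≤ d) :
    KrylovOrth A B 0 (k - 1) (X k) := by
  have key : ∀ j < k, (A ^ (j : ℤ) * B)ᴴ * X k = 0 := by
    intro j
    induction j using Nat.strong_induction_on with
    | _ j ih =>
      intro hj
      have hE : KrylovOrth A B 0 (j - 1) (X k) := by
        refine krylovOrth_of_forall fun i h₁ h₂ => ?_
        lift i to ℕ using h₁
        exact ih i (by lia) (by lia)
      -- Pair `X k` with `X j` minus its leading term: by induction only the leading term of `X j`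
      -- could contribute, and its coefficient `κ j` can be cancelled.
      have h₁ := hE _ (h.leading j (by lia))
      rw [Matrix.conjTranspose_sub, Matrix.sub_mul, h.orthonormal j (by lia) k hk,
        if_neg hj.ne, zero_sub, neg_eq_zero, Matrix.conjTranspose_mul, Matrix.mul_assoc] at h₁
      have hu : IsUnit (κ j)ᴴ := (Matrix.isUnit_conjTranspose _).2 (h.isUnit j (by lia))
      exact hu.mul_right_eq_zero.1 h₁
  refine krylovOrth_of_forall fun i h₁ h₂ => ?_
  lift i to ℕ using h₁
  exact key i (by lia)

theorem IsSzegoSystem.orthonormal_self (h : IsSzegoSystem A B d X κ) {k : ℕ} (hk : k ≤ d) :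
    (X k)ᴴ * X k = 1 := by
  simpa using h.orthonormal k hk k hk

theorem KrylovOrth.eq_zero_of_mem {a b : ℤ} {Z : BlockVec n s} (h : KrylovOrth A B a b Z)
    (hZ : Z ∈ krylovSpan A B a b) : Z = 0 :=
  Matrix.conjTranspose_mul_self_eq_zero.1 (h Z hZ)

theorem KrylovOrth.conjTranspose_mul {a b : ℤ} {Y Z : BlockVec n s} (h : KrylovOrth A B a b Z)
    (hY : Y ∈ krylovSpan A B a b) : Zᴴ * Y = 0 := by
  simpa using congrArg Matrix.conjTranspose (h Y hY)

/-- The Verblunsky coefficient `α_{k+1}` of a pair of Szegő systems for `A` and `A⁻¹`. -/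
def systemVerblunsky (A : SqMat n) (X Y : ℕ → BlockVec n s) (k : ℕ) : SqMat s :=
  (A * X k)ᴴ * (A ^ (k : ℤ) * Y k)

theorem conjTranspose_mul_mul_eq_systemVerblunsky (A : SqMat n) (X Y : ℕ → BlockVec n s)
    (k : ℕ) : (A ^ (k : ℤ) * Y k)ᴴ * (A * X k) = (systemVerblunsky A X Y k)ᴴ := by
  simp [systemVerblunsky]

/-- Both sides reduce to `Y_kᴴ A^(1-k) X_k`. This symmetry transfers each statement on right
polynomials to left ones. -/
theorem systemVerblunsky_swap (hA : A ∈ Matrix.unitaryGroup (Fin n) ℂ)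
    (X Y : ℕ → BlockVec n s) (k : ℕ) :
    systemVerblunsky A⁻¹ Y X k = (systemVerblunsky A X Y k)ᴴ := by
  have hdet := isUnit_det_of_unitary hA
  have h₁ := zpow_mul_conjTranspose_mul hA (-1) (-k) (Y k) (X k)
  have h₂ := zpow_mul_conjTranspose_mul hA k 1 (Y k) (X k)
  rw [show -(k : ℤ) - -1 = 1 - k by ring] at h₁
  rw [← conjTranspose_mul_mul_eq_systemVerblunsky, systemVerblunsky, Matrix.inv_zpow' hdet,
    ← Matrix.zpow_neg_one, h₁, ← h₂, zpow_one]

variable (hA : A ∈ Matrix.unitaryGroup (Fin n) ℂ)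
include hA

theorem IsSzegoSystem.reversed_mem (h : IsSzegoSystem A⁻¹ B d Y κ') {k : ℕ} (hk : k ≤ d) :
    A ^ (k : ℤ) * Y k ∈ krylovSpan A B 0 k := by
  have h₁ := h.mem hk
  rw [krylovSpan_inv hA] at h₁
  simpa using zpow_mul_left_mem_krylovSpan (isUnit_det_of_unitary hA) h₁ k

theorem IsSzegoSystem.reversed_orth (h : IsSzegoSystem A⁻¹ B d Y κ') {k : ℕ} (hk : k ≤ d) :
    KrylovOrth A B 1 k (A ^ (k : ℤ) * Y k) := by
  have h₁ := h.orth hk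
  rw [krylovOrth_inv hA] at h₁
  simpa using h₁.zpow_mul hA k

theorem IsSzegoSystem.reversed_orthonormal (h : IsSzegoSystem A⁻¹ B d Y κ') {k : ℕ}
    (hk : k ≤ d) : (A ^ (k : ℤ) * Y k)ᴴ * (A ^ (k : ℤ) * Y k) = 1 := by
  rw [zpow_mul_conjTranspose_mul hA, sub_self, zpow_zero, Matrix.one_mul, h.orthonormal_self hk]

/-- The reversed polynomial and `z, …, z ^ k` span all polynomials of degree at most `k`. -/
theorem IsSzegoSystem.krylovOrth_of_reversed (h : IsSzegoSystem A⁻¹ B d Y κ') {k : ℕ}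
    (hk : k ≤ d) {Z : BlockVec n s} (hZ : KrylovOrth A B 1 k Z)
    (hYZ : (A ^ (k : ℤ) * Y k)ᴴ * Z = 0) : KrylovOrth A B 0 k Z := by
  have hdet := isUnit_det_of_unitary hA
  refine krylovOrth_of_forall fun i h₁ h₂ => ?_
  rcases h₁.eq_or_lt with rfl | h₁
  -- The only missing exponent is `0`. Modulo the powers `1, …, k`, the reversed vector equals `B
  -- κ'_k`, and `κ'_k` is invertible.
  · have h₃ := h.leading k hk
    rw [krylovSpan_inv hA] at h₃
    have h₄ := zpow_mul_left_mem_krylovSpan hdet h₃ k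
    have h₅ : A ^ (k : ℤ) * (Y k - A⁻¹ ^ (k : ℤ) * B * κ' k) = A ^ (k : ℤ) * Y k - B * κ' k := by
      rw [Matrix.mul_sub, Matrix.mul_assoc, Matrix.inv_zpow' hdet, zpow_mul_zpow_mul hA]
      simp
    rw [h₅, show (k : ℤ) + -(k - 1) = 1 by ring, neg_zero, add_zero] at h₄
    have h₆ := hZ _ h₄
    rw [Matrix.conjTranspose_sub, Matrix.sub_mul, hYZ, zero_sub, neg_eq_zero,
      Matrix.conjTranspose_mul, Matrix.mul_assoc] at h₆
    have hu : IsUnit (κ' k)ᴴ := (Matrix.isUnit_conjTranspose _).2 (h.isUnit k hk)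
    simpa using hu.mul_right_eq_zero.1 h₆
  · simpa using hZ (A ^ i * B * 1) (zpow_mul_mem_krylovSpan A B (by lia) h₂ 1)

theorem IsSzegoSystem.mul_mem (h : IsSzegoSystem A B d X κ) {k : ℕ} (hk : k ≤ d) :
    A * X k ∈ krylovSpan A B 1 (k + 1) := by
  simpa [add_comm] using zpow_mul_left_mem_krylovSpan (isUnit_det_of_unitary hA) (h.mem hk) 1

theorem IsSzegoSystem.mul_orth (h : IsSzegoSystem A B d X κ) {k : ℕ} (hk : k ≤ d) :
    KrylovOrth A B 1 k (A * X k) := by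
  simpa using (h.orth hk).zpow_mul hA 1

theorem IsSzegoSystem.mul_orthonormal (h : IsSzegoSystem A B d X κ) {k : ℕ} (hk : k ≤ d) :
    (A * X k)ᴴ * (A * X k) = 1 := by
  have := zpow_mul_conjTranspose_mul hA 1 1 (X k) (X k)
  simpa [h.orthonormal_self hk] using this

/-- The difference of the two sides belongs to the span of the powers `0, …, k`, since the choice of
quotient cancels the terms in `A^(k+1)`. It is orthogonal to the powers `1, …, k` and, by the choice
of `α`, to the reversed vector, hence to that whole span. -/
theorem IsSzegoSystem.szego_aux (hX : IsSzegoSystem A B d X κ) (hY : IsSzegoSystem A⁻¹ B d Y κ')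
    {k : ℕ} (hk : k < d) :
    A * X k = A ^ (k : ℤ) * Y k * (systemVerblunsky A X Y k)ᴴ +
      X (k + 1) * ((κ (k + 1))⁻¹ * κ k) := by
  have hdet := isUnit_det_of_unitary hA
  set α := systemVerblunsky A X Y k
  set r := (κ (k + 1))⁻¹ * κ k with hr
  have hXo : KrylovOrth A B 0 k (X (k + 1)) := by simpa using hX.orth (k := k + 1) hk
  have hmem : A * X k - A ^ (k : ℤ) * Y k * αᴴ - X (k + 1) * r ∈ krylovSpan A B 0 k := by
    have h₁ := zpow_mul_left_mem_krylovSpan hdet (hX.leading k hk.le) 1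
    rw [zpow_one, Matrix.mul_sub, Matrix.mul_assoc, mul_zpow_mul_blockVec hA, add_sub_cancel] at h₁
    have h₂ := mul_right_mem_krylovSpan (hX.leading (k + 1) hk) r
    have h₃ : A ^ ((k + 1 : ℕ) : ℤ) * B * κ (k + 1) * r = A ^ (1 + (k : ℤ)) * B * κ k := by
      rw [hr, Matrix.mul_assoc, ← Matrix.mul_assoc (κ (k + 1)), Matrix.mul_nonsing_inv,
        Matrix.one_mul]
      · push_cast; rw [add_comm]
      · exact (Matrix.isUnit_iff_isUnit_det _).1 (hX.isUnit (k + 1) hk)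
    rw [Matrix.sub_mul, h₃] at h₂
    push_cast at h₂
    rw [add_sub_cancel_right] at h₂
    have h₄ := sub_mem (sub_mem (krylovSpan_mono (by lia) le_rfl h₁) h₂)
      (mul_right_mem_krylovSpan (hY.reversed_mem hA hk.le) αᴴ)
    rw [← Matrix.mul_assoc] at h₄
    convert h₄ using 1
    abel
  have horth : KrylovOrth A B 0 k (A * X k - A ^ (k : ℤ) * Y k * αᴴ - X (k + 1) * r) := by
    refine hY.krylovOrth_of_reversed hA hk.le ?_ ?_
    · exact ((hX.mul_orth hA hk.le).sub ((hY.reversed_orth hA hk.le).mul_right _)).sub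
        ((hXo.mono (by lia) le_rfl).mul_right _)
    · rw [Matrix.mul_sub, Matrix.mul_sub, ← Matrix.mul_assoc _ _ αᴴ, ← Matrix.mul_assoc _ _ r,
        hY.reversed_orthonormal hA hk.le, conjTranspose_mul_mul_eq_systemVerblunsky,
        hXo _ (hY.reversed_mem hA hk.le)]
      simp [α]
  have := horth.eq_zero_of_mem hmem
  rw [sub_sub, sub_eq_zero] at this
  exact this

/-- The leading coefficients have the quotient `ρ^R = (I - α αᴴ)^{1/2}`. -/
theorem IsSzegoSystem.rhoR_eq (hX : IsSzegoSystem A B d X κ) (hY : IsSzegoSystem A⁻¹ B d Y κ')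
    {k : ℕ} (hk : k < d) : rhoR (systemVerblunsky A X Y k) = (κ (k + 1))⁻¹ * κ k := by
  refine rhoR_eq_of_posDef (hX.ratio k hk) ?_
  have h := hX.szego_aux hA hY hk
  set α := systemVerblunsky A X Y k with hα
  set r := (κ (k + 1))⁻¹ * κ k with hr
  have h₁ : X (k + 1) * r = A * X k - A ^ (k : ℤ) * Y k * αᴴ := by rw [h]; abel
  have h₂ : rᴴ * r = (X (k + 1) * r)ᴴ * (X (k + 1) * r) := by
    rw [Matrix.conjTranspose_mul (X (k + 1)) r, Matrix.mul_assoc rᴴ, ← Matrix.mul_assoc _ (X (k + 1)),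
      hX.orthonormal_self (k := k + 1) hk, Matrix.one_mul]
  have hYX := conjTranspose_mul_mul_eq_systemVerblunsky A X Y k
  have hrH : rᴴ = r := (hX.ratio k hk).1
  -- The residual is orthogonal to the reversed vector, so its Gram matrix reduces to its inner
  -- product with `A X_k`.
  have e₁ : (A ^ (k : ℤ) * Y k)ᴴ * (A * X k - A ^ (k : ℤ) * Y k * αᴴ) = 0 := by
    rw [Matrix.mul_sub, ← Matrix.mul_assoc _ _ αᴴ, hY.reversed_orthonormal hA hk.le, hYX]
    simp [hα]
  have e₂ : (A * X k)ᴴ * (A * X k - A ^ (k : ℤ) * Y k * αᴴ) = 1 - α * αᴴ := by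
    rw [Matrix.mul_sub, hX.mul_orthonormal hA hk.le, ← Matrix.mul_assoc _ _ αᴴ, hα,
      systemVerblunsky]
  rw [hrH, h₁] at h₂
  rw [h₂]
  conv_lhs => rw [Matrix.conjTranspose_sub, Matrix.sub_mul, e₂, Matrix.conjTranspose_mul,
    Matrix.mul_assoc, e₁, Matrix.mul_zero, sub_zero]

theorem IsSzegoSystem.posDef_rhoR (hX : IsSzegoSystem A B d X κ)
    (hY : IsSzegoSystem A⁻¹ B d Y κ') {k : ℕ} (hk : k < d) :
    (rhoR (systemVerblunsky A X Y k)).PosDef := by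
  rw [hX.rhoR_eq hA hY hk]; exact hX.ratio k hk

/-- The Szegő recurrence for the right polynomials. -/
theorem IsSzegoSystem.szego (hX : IsSzegoSystem A B d X κ) (hY : IsSzegoSystem A⁻¹ B d Y κ')
    {k : ℕ} (hk : k < d) :
    A * X k = A ^ (k : ℤ) * Y k * (systemVerblunsky A X Y k)ᴴ +
      X (k + 1) * rhoR (systemVerblunsky A X Y k) := by
  rw [hX.rhoR_eq hA hY hk]; exact hX.szego_aux hA hY hk

theorem IsSzegoSystem.inv_inv (hX : IsSzegoSystem A B d X κ) :
    IsSzegoSystem A⁻¹⁻¹ B d X κ := by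
  rwa [Matrix.nonsing_inv_nonsing_inv _ (isUnit_det_of_unitary hA)]

theorem IsSzegoSystem.posDef_rhoL (hX : IsSzegoSystem A B d X κ)
    (hY : IsSzegoSystem A⁻¹ B d Y κ') {k : ℕ} (hk : k < d) :
    (rhoL (systemVerblunsky A X Y k)).PosDef := by
  have := hY.posDef_rhoR (inv_mem_unitaryGroup hA) (hX.inv_inv hA) hk
  rwa [systemVerblunsky_swap hA, rhoR_conjTranspose] at this

/-- The Szegő recurrence for the reversed left polynomials. -/
theorem IsSzegoSystem.szego_reversed (hX : IsSzegoSystem A B d X κ)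
    (hY : IsSzegoSystem A⁻¹ B d Y κ') {k : ℕ} (hk : k < d) :
    A ^ (k : ℤ) * Y k = A * X k * systemVerblunsky A X Y k +
      A ^ ((k + 1 : ℕ) : ℤ) * Y (k + 1) * rhoL (systemVerblunsky A X Y k) := by
  have hdet := isUnit_det_of_unitary hA
  have h := hY.szego (inv_mem_unitaryGroup hA) (hX.inv_inv hA) hk
  rw [systemVerblunsky_swap hA, rhoR_conjTranspose, Matrix.conjTranspose_conjTranspose,
    Matrix.inv_zpow' hdet, ← Matrix.zpow_neg_one] at h
  -- The recurrence of the system for `A⁻¹`, multiplied by `A^(k+1)`, becomes one between reversed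
  -- vectors.
  have h' := congrArg (fun Z : BlockVec n s => A ^ ((k + 1 : ℕ) : ℤ) * Z) h
  simp only [Matrix.mul_add, ← Matrix.mul_assoc, ← Matrix.zpow_add hdet] at h'
  simpa [Matrix.mul_assoc] using h'

/-! #### Inner products of consecutive members -/

theorem IsSzegoSystem.inner_mul (hX : IsSzegoSystem A B d X κ) (hY : IsSzegoSystem A⁻¹ B d Y κ')
    {k : ℕ} (hk : k < d) :
    (X (k + 1))ᴴ * (A * X k) = rhoR (systemVerblunsky A X Y k) := by
  have hXo : KrylovOrth A B 0 k (X (k + 1)) := by simpa using hX.orth (k := k + 1) hk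
  rw [hX.szego hA hY hk, Matrix.mul_add, ← Matrix.mul_assoc _ _ (systemVerblunsky A X Y k)ᴴ,
    ← Matrix.mul_assoc _ _ (rhoR _), hX.orthonormal_self (k := k + 1) hk, hXo.conjTranspose_mul (hY.reversed_mem hA hk.le)]
  simp

theorem IsSzegoSystem.inner_reversed (hX : IsSzegoSystem A B d X κ)
    (hY : IsSzegoSystem A⁻¹ B d Y κ') {k : ℕ} (hk : k < d) :
    (A ^ (k : ℤ) * Y k)ᴴ * (A ^ ((k + 1 : ℕ) : ℤ) * Y (k + 1)) =
      rhoL (systemVerblunsky A X Y k) := by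
  have hYo := hY.reversed_orth hA (k := k + 1) hk
  have hAX := hX.mul_mem hA hk.le
  push_cast at hYo
  have h : (A ^ ((k + 1 : ℕ) : ℤ) * Y (k + 1))ᴴ * (A ^ (k : ℤ) * Y k) =
      rhoL (systemVerblunsky A X Y k) := by
    conv_lhs => rw [hX.szego_reversed hA hY hk]
    rw [Matrix.mul_add, ← Matrix.mul_assoc _ _ (systemVerblunsky A X Y k),
      ← Matrix.mul_assoc _ _ (rhoL _), hY.reversed_orthonormal hA (k := k + 1) hk]
    push_cast
    rw [hYo.conjTranspose_mul hAX]
    simp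
  have h' := congrArg Matrix.conjTranspose h
  rw [(hX.posDef_rhoL hA hY hk).1] at h'
  simpa using h'

/-- The square root squares back only where its argument is nonnegative. Here the identity is
instead read off from the normalization of `A X_k` and the recurrence, which needs no such prior
knowledge. -/
theorem IsSzegoSystem.rhoR_mul_rhoR (hX : IsSzegoSystem A B d X κ)
    (hY : IsSzegoSystem A⁻¹ B d Y κ') {k : ℕ} (hk : k < d) :
    rhoR (systemVerblunsky A X Y k) * rhoR (systemVerblunsky A X Y k) =
      1 - systemVerblunsky A X Y k * (systemVerblunsky A X Y k)ᴴ := by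
  have h₁ := hX.inner_mul hA hY hk
  have h₂ : (A * X k)ᴴ * (A * X k) = _ :=
    congrArg (fun Z => (A * X k)ᴴ * Z) (hX.szego hA hY hk)
  have h₃ := congrArg Matrix.conjTranspose h₁
  rw [Matrix.conjTranspose_mul, Matrix.conjTranspose_conjTranspose,
    (hX.posDef_rhoR hA hY hk).1] at h₃
  rw [Matrix.mul_add, ← Matrix.mul_assoc _ _ (systemVerblunsky A X Y k)ᴴ,
    ← Matrix.mul_assoc _ _ (rhoR _), h₃, hX.mul_orthonormal hA hk.le] at h₂
  rw [h₂]
  exact (add_sub_cancel_left _ _).symm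

theorem IsSzegoSystem.rhoL_mul_rhoL (hX : IsSzegoSystem A B d X κ)
    (hY : IsSzegoSystem A⁻¹ B d Y κ') {k : ℕ} (hk : k < d) :
    rhoL (systemVerblunsky A X Y k) * rhoL (systemVerblunsky A X Y k) =
      1 - (systemVerblunsky A X Y k)ᴴ * systemVerblunsky A X Y k := by
  have := hY.rhoR_mul_rhoR (inv_mem_unitaryGroup hA) (hX.inv_inv hA) hk
  rwa [systemVerblunsky_swap hA, rhoR_conjTranspose, Matrix.conjTranspose_conjTranspose] at this

/-- Pairing the reversed recurrence with `X_{k+1}` gives `0 = ρ^R α + G ρ^L`, where `G` is the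
wanted inner product. The intertwining `ρ^R α = α ρ^L` turns this into `(α + G) ρ^L = 0`, and `ρ^L`
is invertible. -/
theorem IsSzegoSystem.inner_reversed_succ (hX : IsSzegoSystem A B d X κ)
    (hY : IsSzegoSystem A⁻¹ B d Y κ') {k : ℕ} (hk : k < d) :
    (X (k + 1))ᴴ * (A ^ ((k + 1 : ℕ) : ℤ) * Y (k + 1)) = -systemVerblunsky A X Y k := by
  have hR := hX.posDef_rhoR hA hY hk
  have hL := hX.posDef_rhoL hA hY hk
  have hRR := hX.rhoR_mul_rhoR hA hY hk
  have hLL := hX.rhoL_mul_rhoL hA hY hk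
  have h₁ := hX.inner_mul hA hY hk
  have h₂ := congrArg (fun Z => (X (k + 1))ᴴ * Z) (hX.szego_reversed hA hY hk)
  have hXo : KrylovOrth A B 0 k (X (k + 1)) := by simpa using hX.orth (k := k + 1) hk
  simp only [Matrix.mul_add] at h₂
  rw [hXo.conjTranspose_mul (hY.reversed_mem hA hk.le), ← Matrix.mul_assoc _ _ (systemVerblunsky A X Y k), h₁,
    ← Matrix.mul_assoc _ _ (rhoL _)] at h₂
  set α := systemVerblunsky A X Y k
  have h₃ : rhoR α * α = α * rhoL α := by
    refine mul_eq_mul_of_sq_mul_eq_mul_sq hR hL ?_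
    rw [hRR, hLL]
    simp only [Matrix.sub_mul, Matrix.mul_sub, Matrix.one_mul, Matrix.mul_one, Matrix.mul_assoc]
  rw [h₃, ← Matrix.add_mul] at h₂
  have := hL.isUnit.mul_left_eq_zero.1 h₂.symm
  rw [eq_neg_iff_add_eq_zero, add_comm]
  exact this

theorem IsSzegoSystem.norm_verblunsky_lt_one (hX : IsSzegoSystem A B d X κ)
    (hY : IsSzegoSystem A⁻¹ B d Y κ') {k : ℕ} (hk : k < d) :
    ‖Matrix.toEuclideanCLM (𝕜 := ℂ) (systemVerblunsky A X Y k)‖ < 1 := by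
  apply norm_toEuclideanCLM_lt_one
  have hL := hX.posDef_rhoL hA hY hk
  rw [← hX.rhoL_mul_rhoL hA hY hk]
  have := Matrix.PosDef.one (n := Fin s) (R := ℂ) |>.conjTranspose_mul_mul_same
    (B := rhoL (systemVerblunsky A X Y k)) (Matrix.mulVec_injective_of_isUnit hL.isUnit)
  rwa [hL.1, Matrix.mul_one] at this

end Szego

/-! ### CMV vectors -/

section CMV

variable {n s : ℕ}

/-- The CMV vectors of a pair of Szegő systems, indexed from `1`. -/
def systemCMV (A : SqMat n) (X Y : ℕ → BlockVec n s) (i : ℕ) : BlockVec n s :=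
  A ^ (-(((i - 1) / 2 : ℕ) : ℤ)) *
    (if (i - 1) % 2 = 0 then A ^ ((i - 1 : ℕ) : ℤ) * Y (i - 1) else X (i - 1))

/-- The vectors of the alternate CMV basis of a pair of Szegő systems, indexed from `1`. -/
def systemAltCMV (A : SqMat n) (X Y : ℕ → BlockVec n s) (i : ℕ) : BlockVec n s :=
  A ^ (-((i / 2 : ℕ) : ℤ)) *
    (if (i - 1) % 2 = 0 then X (i - 1) else A ^ ((i - 1 : ℕ) : ℤ) * Y (i - 1))

variable {A : SqMat n} {B : BlockVec n s} {m : ℕ} {X Y : ℕ → BlockVec n s} {κ κ' : ℕ → SqMat s}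

theorem exists_parity {i : ℕ} (hi : 1 ≤ i) : ∃ q, i = 2 * q + 1 ∨ i = 2 * q + 2 :=
  ⟨(i - 1) / 2, by lia⟩

theorem systemCMV_odd (A : SqMat n) (X Y : ℕ → BlockVec n s) (q : ℕ) :
    systemCMV A X Y (2 * q + 1) = A ^ (-(q : ℤ)) * (A ^ ((2 * q : ℕ) : ℤ) * Y (2 * q)) := by
  simp [systemCMV]

theorem systemCMV_even (A : SqMat n) (X Y : ℕ → BlockVec n s) (q : ℕ) :
    systemCMV A X Y (2 * q + 2) = A ^ (-(q : ℤ)) * X (2 * q + 1) := by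
  have : (2 * q + 1) / 2 = q := by lia
  simp [systemCMV, this]

theorem systemAltCMV_odd (A : SqMat n) (X Y : ℕ → BlockVec n s) (q : ℕ) :
    systemAltCMV A X Y (2 * q + 1) = A ^ (-(q : ℤ)) * X (2 * q) := by
  have : (2 * q + 1) / 2 = q := by lia
  simp [systemAltCMV, this]

theorem systemAltCMV_even (A : SqMat n) (X Y : ℕ → BlockVec n s) (q : ℕ) :
    systemAltCMV A X Y (2 * q + 2) =
      A ^ (-((q + 1 : ℕ) : ℤ)) * (A ^ ((2 * q + 1 : ℕ) : ℤ) * Y (2 * q + 1)) := by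
  have : (2 * q + 2) / 2 = q + 1 := by lia
  simp [systemAltCMV, this]

variable (hA : A ∈ Matrix.unitaryGroup (Fin n) ℂ) (hX : IsSzegoSystem A B (m - 1) X κ)
  (hY : IsSzegoSystem A⁻¹ B (m - 1) Y κ')
include hA hX hY

/-- The window consists of the first `i` exponents in the order `0, 1, -1, 2, …`. -/
theorem systemCMV_mem {i : ℕ} (hi : 1 ≤ i) (him : i ≤ m) :
    systemCMV A X Y i ∈ krylovSpan A B (-(((i - 1) / 2 : ℕ) : ℤ)) ((i / 2 : ℕ) : ℤ) := by
  have hdet := isUnit_det_of_unitary hA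
  obtain ⟨q, rfl | rfl⟩ := exists_parity hi
  · rw [systemCMV_odd]
    exact krylovSpan_mono (by lia) (by lia)
      (zpow_mul_left_mem_krylovSpan hdet (hY.reversed_mem hA (k := 2 * q) (by lia)) _)
  · rw [systemCMV_even]
    exact krylovSpan_mono (by lia) (by lia)
      (zpow_mul_left_mem_krylovSpan hdet (hX.mem (k := 2 * q + 1) (by lia)) _)

/-- This is the window of the vector with index `i - 1`, and is empty for `i = 1`; orthogonality to
all earlier CMV vectors follows. -/
theorem systemCMV_orth {i : ℕ} (hi : 1 ≤ i) (him : i ≤ m) :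
    KrylovOrth A B (1 - ((i / 2 : ℕ) : ℤ)) (((i - 1) / 2 : ℕ) : ℤ) (systemCMV A X Y i) := by
  obtain ⟨q, rfl | rfl⟩ := exists_parity hi
  · rw [systemCMV_odd]
    exact ((hY.reversed_orth hA (k := 2 * q) (by lia)).zpow_mul hA _).mono (by lia) (by lia)
  · rw [systemCMV_even]
    exact ((hX.orth (k := 2 * q + 1) (by lia)).zpow_mul hA _).mono (by lia) (by lia)

/-- The mirrored windows: the exponents enter in the order `0, -1, 1, -2, …`. -/
theorem systemAltCMV_mem {i : ℕ} (hi : 1 ≤ i) (him : i ≤ m) :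
    systemAltCMV A X Y i ∈ krylovSpan A B (-((i / 2 : ℕ) : ℤ)) (((i - 1) / 2 : ℕ) : ℤ) := by
  have hdet := isUnit_det_of_unitary hA
  obtain ⟨q, rfl | rfl⟩ := exists_parity hi
  · rw [systemAltCMV_odd]
    exact krylovSpan_mono (by lia) (by lia)
      (zpow_mul_left_mem_krylovSpan hdet (hX.mem (k := 2 * q) (by lia)) _)
  · rw [systemAltCMV_even]
    exact krylovSpan_mono (by lia) (by lia)
      (zpow_mul_left_mem_krylovSpan hdet (hY.reversed_mem hA (k := 2 * q + 1) (by lia)) _)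

theorem systemAltCMV_orth {i : ℕ} (hi : 1 ≤ i) (him : i ≤ m) :
    KrylovOrth A B (-(((i - 1) / 2 : ℕ) : ℤ)) (((i / 2 : ℕ) : ℤ) - 1)
      (systemAltCMV A X Y i) := by
  obtain ⟨q, rfl | rfl⟩ := exists_parity hi
  · rw [systemAltCMV_odd]
    exact ((hX.orth (k := 2 * q) (by lia)).zpow_mul hA _).mono (by lia) (by lia)
  · rw [systemAltCMV_even]
    exact ((hY.reversed_orth hA (k := 2 * q + 1) (by lia)).zpow_mul hA _).mono
      (by lia) (by lia)

theorem systemCMV_orthonormal {i j : ℕ} (hi : i ∈ Finset.Icc 1 m) (hj : j ∈ Finset.Icc 1 m) :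
    (systemCMV A X Y i)ᴴ * systemCMV A X Y j = if i = j then 1 else 0 := by
  rw [Finset.mem_Icc] at hi hj
  rcases lt_trichotomy i j with h | rfl | h
  · rw [if_neg h.ne]
    exact systemCMV_orth hA hX hY hj.1 hj.2 _
      (krylovSpan_mono (by lia) (by lia) (systemCMV_mem hA hX hY hi.1 hi.2))
  · rw [if_pos rfl]
    obtain ⟨q, rfl | rfl⟩ := exists_parity hi.1
    · rw [systemCMV_odd, zpow_mul_conjTranspose_mul hA]
      simpa using hY.reversed_orthonormal hA (k := 2 * q) (by lia)
    · rw [systemCMV_even, zpow_mul_conjTranspose_mul hA]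
      simpa using hX.orthonormal_self (k := 2 * q + 1) (by lia)
  · rw [if_neg h.ne']
    exact (systemCMV_orth hA hX hY hi.1 hi.2).conjTranspose_mul
      (krylovSpan_mono (by lia) (by lia) (systemCMV_mem hA hX hY hj.1 hj.2))

theorem systemAltCMV_orthonormal {i j : ℕ} (hi : i ∈ Finset.Icc 1 m)
    (hj : j ∈ Finset.Icc 1 m) :
    (systemAltCMV A X Y i)ᴴ * systemAltCMV A X Y j = if i = j then 1 else 0 := by
  rw [Finset.mem_Icc] at hi hj
  rcases lt_trichotomy i j with h | rfl | h
  · rw [if_neg h.ne]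
    exact systemAltCMV_orth hA hX hY hj.1 hj.2 _
      (krylovSpan_mono (by lia) (by lia) (systemAltCMV_mem hA hX hY hi.1 hi.2))
  · rw [if_pos rfl]
    obtain ⟨q, rfl | rfl⟩ := exists_parity hi.1
    · rw [systemAltCMV_odd, zpow_mul_conjTranspose_mul hA]
      simpa using hX.orthonormal_self (k := 2 * q) (by lia)
    · rw [systemAltCMV_even, zpow_mul_conjTranspose_mul hA]
      simpa using hY.reversed_orthonormal hA (k := 2 * q + 1) (by lia)
  · rw [if_neg h.ne']
    exact (systemAltCMV_orth hA hX hY hi.1 hi.2).conjTranspose_mul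
      (krylovSpan_mono (by lia) (by lia) (systemAltCMV_mem hA hX hY hj.1 hj.2))

/-- The inner products of the two CMV bases are the blocks of `M`. -/
theorem systemAltCMV_conjTranspose_mul_systemCMV {α : ℕ → SqMat s} (h0 : X 0 = Y 0)
    (hα : ∀ k, α k = systemVerblunsky A X Y (k - 1)) {i j : ℕ} (hi : i ∈ Finset.Icc 1 m)
    (hj : j ∈ Finset.Icc 1 m) :
    (systemAltCMV A X Y i)ᴴ * systemCMV A X Y j = cmvM α i j := by
  rw [Finset.mem_Icc] at hi hj
  have hW := systemCMV_mem hA hX hY hj.1 hj.2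
  have hV := systemAltCMV_mem hA hX hY hi.1 hi.2
  -- The diagonal blocks of `M` are the index groups `{1}, {2, 3}, {4, 5}, …`, told apart by `i /
  -- 2`. Across groups, one vector lies in a window to which the other is orthogonal.
  rcases lt_trichotomy (i / 2) (j / 2) with h | h | h
  · rw [systemCMV_orth hA hX hY hj.1 hj.2 _ (krylovSpan_mono (by lia) (by lia) hV), cmvM,
      if_neg (by lia), if_neg (by lia), if_neg (by lia), if_neg (by lia), if_neg (by lia)]
  · rcases Nat.eq_zero_or_pos (i / 2) with h' | h'
    · obtain rfl : i = 1 := by lia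
      obtain rfl : j = 1 := by lia
      rw [systemAltCMV_odd _ _ _ 0, systemCMV_odd _ _ _ 0]
      simp [cmvM, h0, hY.orthonormal_self (k := 0) (by lia)]
    · obtain ⟨q, rfl | rfl⟩ := exists_parity hi.1
      · obtain ⟨q, rfl⟩ : ∃ q', q = q' + 1 := ⟨q - 1, by lia⟩
        rw [systemAltCMV_odd]
        rcases (by lia : j = 2 * q + 2 ∨ j = 2 * (q + 1) + 1) with rfl | rfl
        · rw [systemCMV_even, zpow_mul_conjTranspose_mul hA, cmvM,
            if_neg (by lia), if_neg (by lia), if_neg (by lia), if_pos (by lia), hα]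
          rw [show -(q : ℤ) - -((q + 1 : ℕ) : ℤ) = 1 by push_cast; ring, zpow_one]
          exact hX.inner_mul hA hY (k := 2 * q + 1) (by lia)
        · rw [systemCMV_odd, zpow_mul_conjTranspose_mul hA, cmvM,
            if_neg (by lia), if_neg (by lia), if_neg (by lia), if_neg (by lia),
            if_pos (by lia), hα]
          have := hX.inner_reversed_succ hA hY (k := 2 * q + 1) (by lia)
          rw [sub_self, zpow_zero, Matrix.one_mul]
          exact this
      · rw [systemAltCMV_even]
        rcases (by lia : j = 2 * q + 2 ∨ j = 2 * (q + 1) + 1) with rfl | rfl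
        · rw [systemCMV_even, zpow_mul_conjTranspose_mul hA, cmvM,
            if_neg (by lia), if_pos (by lia), hα]
          rw [show -(q : ℤ) - -((q + 1 : ℕ) : ℤ) = 1 by push_cast; ring, zpow_one]
          -- No polynomial of the next degree enters here, so this entry is available even when its
          -- index is `m`.
          exact conjTranspose_mul_mul_eq_systemVerblunsky A X Y (2 * q + 1)
        · rw [systemCMV_odd, zpow_mul_conjTranspose_mul hA, cmvM,
            if_neg (by lia), if_neg (by lia), if_pos (by lia), hα]
          have := hX.inner_reversed hA hY (k := 2 * q + 1) (by lia)
          rw [sub_self, zpow_zero, Matrix.one_mul]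
          exact this
  · rw [(systemAltCMV_orth hA hX hY hi.1 hi.2).conjTranspose_mul
      (krylovSpan_mono (by lia) (by lia) hW), cmvM,
      if_neg (by lia), if_neg (by lia), if_neg (by lia), if_neg (by lia), if_neg (by lia)]

/-- The inner products of the CMV basis with `A` times the alternate basis are the blocks
of `L`. -/
theorem systemCMV_conjTranspose_mul_mul_systemAltCMV {α : ℕ → SqMat s}
    (hα : ∀ k, α k = systemVerblunsky A X Y (k - 1)) {i j : ℕ} (hi : i ∈ Finset.Icc 1 m)
    (hj : j ∈ Finset.Icc 1 m) :
    (systemCMV A X Y i)ᴴ * (A * systemAltCMV A X Y j) = cmvL α i j := by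
  rw [Finset.mem_Icc] at hi hj
  have hW := systemCMV_mem hA hX hY hi.1 hi.2
  have hV := zpow_mul_left_mem_krylovSpan (isUnit_det_of_unitary hA)
    (systemAltCMV_mem hA hX hY hj.1 hj.2) 1
  have hVo := (systemAltCMV_orth hA hX hY hj.1 hj.2).zpow_mul hA 1
  rw [zpow_one] at hV hVo
  -- The diagonal blocks of `L` are the groups `{1, 2}, {3, 4}, …`, told apart by `(i - 1) / 2`.
  rcases lt_trichotomy ((i - 1) / 2) ((j - 1) / 2) with h | h | h
  · rw [hVo _ (krylovSpan_mono (by lia) (by lia) hW), cmvL,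
      if_neg (by lia), if_neg (by lia), if_neg (by lia), if_neg (by lia)]
  · obtain ⟨q, rfl | rfl⟩ := exists_parity hi.1
    · rw [systemCMV_odd]
      rcases (by lia : j = 2 * q + 1 ∨ j = 2 * q + 2) with rfl | rfl
      · rw [systemAltCMV_odd, mul_zpow_mul_blockVec hA, zpow_mul_conjTranspose_mul hA, cmvL,
          if_pos (by lia), hα]
        rw [show 1 + -(q : ℤ) - -(q : ℤ) = 1 by ring, zpow_one]
        exact conjTranspose_mul_mul_eq_systemVerblunsky A X Y (2 * q)
      · rw [systemAltCMV_even, mul_zpow_mul_blockVec hA, zpow_mul_conjTranspose_mul hA, cmvL,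
          if_neg (by lia), if_pos (by lia), hα,
          show (1 + -((q + 1 : ℕ) : ℤ) - -(q : ℤ)) = 0 by push_cast; ring, zpow_zero,
          Matrix.one_mul]
        exact hX.inner_reversed hA hY (k := 2 * q) (by lia)
    · rw [systemCMV_even]
      rcases (by lia : j = 2 * q + 1 ∨ j = 2 * q + 2) with rfl | rfl
      · rw [systemAltCMV_odd, mul_zpow_mul_blockVec hA, zpow_mul_conjTranspose_mul hA, cmvL,
          if_neg (by lia), if_neg (by lia), if_pos (by lia), hα]
        rw [show 1 + -(q : ℤ) - -(q : ℤ) = 1 by ring, zpow_one]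
        exact hX.inner_mul hA hY (k := 2 * q) (by lia)
      · rw [systemAltCMV_even, mul_zpow_mul_blockVec hA, zpow_mul_conjTranspose_mul hA, cmvL,
          if_neg (by lia), if_neg (by lia), if_neg (by lia), if_pos (by lia), hα,
          show (1 + -((q + 1 : ℕ) : ℤ) - -(q : ℤ)) = 0 by push_cast; ring, zpow_zero,
          Matrix.one_mul]
        exact hX.inner_reversed_succ hA hY (k := 2 * q) (by lia)
  · rw [(systemCMV_orth hA hX hY hi.1 hi.2).conjTranspose_mul
      (krylovSpan_mono (by lia) (by lia) hV), cmvL,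
      if_neg (by lia), if_neg (by lia), if_neg (by lia), if_neg (by lia)]

/-- Expansion in the CMV basis. -/
theorem eq_sum_systemCMV {p : ℕ} (hp : 1 ≤ p) (hpm : p ≤ m) {Z : BlockVec n s}
    (hZ : Z ∈ krylovSpan A B (-(((p - 1) / 2 : ℕ) : ℤ)) ((p / 2 : ℕ) : ℤ)) :
    Z = ∑ i ∈ Finset.Icc 1 p, systemCMV A X Y i * ((systemCMV A X Y i)ᴴ * Z) := by
  have hsub : ∀ i ∈ Finset.Icc 1 p, i ∈ Finset.Icc 1 m := by
    intro i hi; rw [Finset.mem_Icc] at hi ⊢; lia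
  refine eq_sum_of_orthonormal (by lia)
    (fun i hi j hj => systemCMV_orthonormal hA hX hY (hsub i hi) (hsub j hj)) ?_ hZ
  intro i hi
  rw [Finset.mem_Icc] at hi
  exact krylovSpan_mono (by lia) (by lia) (systemCMV_mem hA hX hY hi.1 (hi.2.trans hpm))

/-- Expansion in the alternate CMV basis. -/
theorem eq_sum_systemAltCMV {Z : BlockVec n s} (hm : 1 ≤ m)
    (hZ : Z ∈ krylovSpan A B (-((m / 2 : ℕ) : ℤ)) (((m - 1) / 2 : ℕ) : ℤ)) :
    Z = ∑ i ∈ Finset.Icc 1 m, systemAltCMV A X Y i * ((systemAltCMV A X Y i)ᴴ * Z) := by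
  refine eq_sum_of_orthonormal (by lia)
    (fun i hi j hj => systemAltCMV_orthonormal hA hX hY hi hj) ?_ hZ
  intro i hi
  rw [Finset.mem_Icc] at hi
  exact krylovSpan_mono (by lia) (by lia) (systemAltCMV_mem hA hX hY hi.1 hi.2)

/-- The factorization of the cutoff CMV matrix. -/
theorem systemCMV_factorization {α : ℕ → SqMat s} (h0 : X 0 = Y 0)
    (hα : ∀ k, α k = systemVerblunsky A X Y (k - 1)) {i j : ℕ} (hi : i ∈ Finset.Icc 1 m)
    (hj : j ∈ Finset.Icc 1 m) :
    (systemCMV A X Y i)ᴴ * A * systemCMV A X Y j =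
      ∑ l ∈ Finset.Icc 1 m, cmvL α i l * cmvM α l j := by
  have hi' := Finset.mem_Icc.1 hi
  have hj' := Finset.mem_Icc.1 hj
  have hm : 1 ≤ m := hi'.1.trans hi'.2
  have hsum : ∑ l ∈ Finset.Icc 1 m, cmvL α i l * cmvM α l j =
      ∑ l ∈ Finset.Icc 1 m, (systemCMV A X Y i)ᴴ * (A * systemAltCMV A X Y l) *
        ((systemAltCMV A X Y l)ᴴ * systemCMV A X Y j) := by
    refine Finset.sum_congr rfl fun l hl => ?_
    rw [systemAltCMV_conjTranspose_mul_systemCMV hA hX hY h0 hα hl hj,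
      systemCMV_conjTranspose_mul_mul_systemAltCMV hA hX hY hα hi hl]
  rw [hsum]
  -- The parity decides which factor can be expanded in the alternate basis. For `m = 2q` its window
  -- is `[-q, q - 1]`, which contains those of all `Aᴴ W_i`; for `m = 2q + 1` it is `[-q, q]`, which
  -- contains those of all `W_j`.
  rcases Nat.even_or_odd m with hme | hmo
  · have hmem : Aᴴ * systemCMV A X Y i ∈
        krylovSpan A B (-((m / 2 : ℕ) : ℤ)) (((m - 1) / 2 : ℕ) : ℤ) := by
      have := zpow_mul_left_mem_krylovSpan (isUnit_det_of_unitary hA)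
        (systemCMV_mem hA hX hY hi'.1 hi'.2) (-1)
      rw [Matrix.zpow_neg_one, inv_eq_of_unitary hA] at this
      exact krylovSpan_mono (by grind) (by grind) this
    have hexp := congrArg Matrix.conjTranspose (eq_sum_systemAltCMV hA hX hY hm hmem)
    rw [Matrix.conjTranspose_mul, Matrix.conjTranspose_conjTranspose] at hexp
    rw [hexp, Matrix.conjTranspose_sum, Matrix.sum_mul]
    simp [Matrix.mul_assoc]
  · have hmem : systemCMV A X Y j ∈
        krylovSpan A B (-((m / 2 : ℕ) : ℤ)) (((m - 1) / 2 : ℕ) : ℤ) :=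
      krylovSpan_mono (by grind) (by grind) (systemCMV_mem hA hX hY hj'.1 hj'.2)
    conv_lhs => rw [eq_sum_systemAltCMV hA hX hY hm hmem]
    simp [Matrix.mul_sum, Matrix.mul_assoc]

end CMV

/-! ### Spectral decomposition of unitary matrices -/

section Spectral

variable {n s : ℕ}

theorem inner_toEuclideanLin_of_unitary {A : SqMat n}
    (hA : A ∈ Matrix.unitaryGroup (Fin n) ℂ) (x y : EuclideanSpace ℂ (Fin n)) :
    inner ℂ (Matrix.toEuclideanLin A x) (Matrix.toEuclideanLin A y) = inner ℂ x y := by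
  have h : Aᴴ * A = 1 := Matrix.mem_unitaryGroup_iff'.1 hA
  rw [EuclideanSpace.inner_eq_star_dotProduct, EuclideanSpace.inner_eq_star_dotProduct,
    Matrix.ofLp_toLpLin, Matrix.ofLp_toLpLin, Matrix.toLin'_apply, Matrix.toLin'_apply,
    Matrix.star_mulVec, dotProduct_comm, ← Matrix.dotProduct_mulVec, Matrix.mulVec_mulVec, h, Matrix.one_mulVec,
    dotProduct_comm]

theorem eigenvalue_norm_of_unitary {A : SqMat n} (hA : A ∈ Matrix.unitaryGroup (Fin n) ℂ)
    {w : ℂ} {v : EuclideanSpace ℂ (Fin n)} (hv : v ≠ 0) (h : Matrix.toEuclideanLin A v = w • v) :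
    starRingEnd ℂ w * w = 1 := by
  have h₁ := inner_toEuclideanLin_of_unitary hA v v
  rw [h, inner_smul_left, inner_smul_right, ← mul_assoc] at h₁
  exact (mul_eq_right₀ (inner_self_ne_zero.2 hv)).1 h₁

theorem mem_roots_charpoly_iff (A : SqMat n) (w : ℂ) :
    w ∈ A.charpoly.roots.toFinset ↔ Module.End.HasEigenvalue (Matrix.toEuclideanLin A) w := by
  rw [Multiset.mem_toFinset, Polynomial.mem_roots A.charpoly_monic.ne_zero,
    Module.End.hasEigenvalue_iff_isRoot_charpoly]
  have : (Matrix.toEuclideanLin A).charpoly = A.charpoly := by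
    rw [Matrix.toEuclideanLin, Matrix.toLpLin_eq_toLin, Matrix.charpoly_toLin]
  rw [this]

theorem norm_of_mem_roots_charpoly {A : SqMat n} (hA : A ∈ Matrix.unitaryGroup (Fin n) ℂ)
    {w : ℂ} (hw : w ∈ A.charpoly.roots.toFinset) : starRingEnd ℂ w * w = 1 := by
  obtain ⟨v, hv⟩ := ((mem_roots_charpoly_iff A w).1 hw).exists_hasEigenvector
  exact eigenvalue_norm_of_unitary hA hv.2 hv.apply_eq_smul

/-- The inner product of eigenvectors for `w` and `w'` is multiplied by `conj w * w'` under `A`, yet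
is preserved; on the unit circle this factor is `1` only for `w = w'`. -/
theorem orthogonalFamily_eigenspace_of_unitary {A : SqMat n}
    (hA : A ∈ Matrix.unitaryGroup (Fin n) ℂ) :
    OrthogonalFamily ℂ
      (fun w : A.charpoly.roots.toFinset =>
        Module.End.eigenspace (Matrix.toEuclideanLin A) (w : ℂ))
      fun w => (Module.End.eigenspace (Matrix.toEuclideanLin A) (w : ℂ)).subtypeₗᵢ := by
  rintro ⟨w, hw⟩ ⟨w', hw'⟩ hne ⟨v, hv⟩ ⟨v', hv'⟩
  rw [Module.End.mem_eigenspace_iff] at hv hv'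
  have h := inner_toEuclideanLin_of_unitary hA v v'
  have hw₁ := norm_of_mem_roots_charpoly hA hw
  rw [hv, hv', inner_smul_left, inner_smul_right, ← mul_assoc] at h
  by_contra hvv
  have h₁ : starRingEnd ℂ w * w' = 1 := (mul_eq_right₀ hvv).1 h
  have h₂ : starRingEnd ℂ w ≠ 0 := left_ne_zero_of_mul_eq_one h₁
  exact hne (Subtype.ext (mul_left_cancel₀ h₂ (hw₁.trans h₁.symm)))

/-- The orthogonal complement of all eigenspaces is invariant; were it nonzero, it would contain an
eigenvector. -/
theorem iSup_eigenspace_of_unitary {A : SqMat n} (hA : A ∈ Matrix.unitaryGroup (Fin n) ℂ) :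
    ⨆ w : A.charpoly.roots.toFinset,
      Module.End.eigenspace (Matrix.toEuclideanLin A) (w : ℂ) = ⊤ := by
  set T := Matrix.toEuclideanLin A
  set K := ⨆ w : A.charpoly.roots.toFinset, Module.End.eigenspace T (w : ℂ) with hK
  rw [← Submodule.orthogonal_eq_bot_iff]
  have hinv : ∀ x ∈ Kᗮ, T x ∈ Kᗮ := by
    intro x hx
    rw [hK, ← Submodule.iInf_orthogonal, Submodule.mem_iInf] at hx ⊢
    rintro ⟨w, hw⟩ v hv
    have hv' := Module.End.mem_eigenspace_iff.1 hv
    have hw₁ := norm_of_mem_roots_charpoly hA hw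
    have h := inner_toEuclideanLin_of_unitary hA v x
    change inner ℂ (T v) (T x) = _ at h
    rw [hv', inner_smul_left, hx ⟨w, hw⟩ v hv] at h
    exact (mul_eq_zero.1 h).resolve_left (left_ne_zero_of_mul_eq_one hw₁)
  by_contra hne
  have : Nontrivial Kᗮ := Submodule.nontrivial_iff_ne_bot.2 hne
  obtain ⟨w, hw⟩ := Module.End.exists_eigenvalue (T.restrict hinv)
  obtain ⟨⟨v, hvK⟩, hv⟩ := hw.exists_hasEigenvector
  have hTv : T v = w • v := congrArg Subtype.val hv.apply_eq_smul
  have hv0 : v ≠ 0 := fun h => hv.2 (Subtype.ext h)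
  have hmem : v ∈ Module.End.eigenspace T w := Module.End.mem_eigenspace_iff.2 hTv
  have hroot : w ∈ A.charpoly.roots.toFinset :=
    (mem_roots_charpoly_iff A w).2
      (Module.End.hasEigenvalue_of_hasEigenvector ⟨hmem, hv0⟩)
  have hvK' : v ∈ K := Submodule.mem_iSup_of_mem (⟨w, hroot⟩ : A.charpoly.roots.toFinset) hmem
  exact hv0 (inner_self_eq_zero.1 (hvK v hvK'))

theorem sum_starProjection_eigenspace {A : SqMat n} (hA : A ∈ Matrix.unitaryGroup (Fin n) ℂ)
    (x : EuclideanSpace ℂ (Fin n)) :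
    ∑ w ∈ A.charpoly.roots.toFinset,
      (Module.End.eigenspace (Matrix.toEuclideanLin A) w).starProjection x = x := by
  rw [← Finset.sum_coe_sort A.charpoly.roots.toFinset fun w =>
    (Module.End.eigenspace (Matrix.toEuclideanLin A) w).starProjection x]
  exact (orthogonalFamily_eigenspace_of_unitary hA).sum_projection_of_mem_iSup x
    (by rw [iSup_eigenspace_of_unitary hA]; trivial)

theorem zpow_mulVec_of_eigenvector {A : SqMat n} (hA : IsUnit A.det) {w : ℂ} (hw : w ≠ 0)
    {v : Fin n → ℂ} (h : A *ᵥ v = w • v) (k : ℤ) : (A ^ k) *ᵥ v = w ^ k • v := by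
  have hpow : ∀ k : ℕ, (A ^ k) *ᵥ v = w ^ k • v := by
    intro k
    induction k with
    | zero => simp
    | succ k ih => rw [pow_succ', ← Matrix.mulVec_mulVec, ih, Matrix.mulVec_smul, h, smul_smul,
        pow_succ]
  rcases k.eq_nat_or_neg with ⟨k, rfl | rfl⟩
  · simpa using hpow k
  · have h₁ : A ^ (-(k : ℤ)) *ᵥ (A ^ k *ᵥ v) = v := by
      rw [Matrix.mulVec_mulVec, ← zpow_natCast, Matrix.zpow_neg_mul_zpow_self _ hA,
        Matrix.one_mulVec]
    rw [hpow, Matrix.mulVec_smul] at h₁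
    rw [zpow_neg, zpow_natCast, eq_inv_smul_iff₀ (pow_ne_zero k hw), h₁]

/-- The moments of the spectral measure. -/
theorem sum_zpow_smul_spectralMass {A : SqMat n} (hA : A ∈ Matrix.unitaryGroup (Fin n) ℂ)
    (B : BlockVec n s) (k : ℤ) :
    ∑ w ∈ A.charpoly.roots.toFinset, w ^ k • spectralMass A B w = Bᴴ * (A ^ k * B) := by
  have hdet := isUnit_det_of_unitary hA
  ext i j
  set x : EuclideanSpace ℂ (Fin n) := WithLp.toLp 2 fun r => B r i with hx
  set y : EuclideanSpace ℂ (Fin n) := WithLp.toLp 2 fun r => B r j with hy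
  have h₁ : (Bᴴ * (A ^ k * B)) i j = inner ℂ x (Matrix.toEuclideanLin (A ^ k) y) := by
    rw [EuclideanSpace.inner_eq_star_dotProduct, dotProduct_comm, Matrix.mul_apply]
    rfl
  have h₂ : ∀ w ∈ A.charpoly.roots.toFinset,
      Matrix.toEuclideanLin (A ^ k)
        ((Module.End.eigenspace (Matrix.toEuclideanLin A) w).starProjection y) =
      w ^ k • (Module.End.eigenspace (Matrix.toEuclideanLin A) w).starProjection y := by
    intro w hw
    have hmem := Submodule.starProjection_apply_mem
      (Module.End.eigenspace (Matrix.toEuclideanLin A) w) y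
    have hw0 : w ≠ 0 := right_ne_zero_of_mul_eq_one (norm_of_mem_roots_charpoly hA hw)
    have h := congrArg WithLp.ofLp (Module.End.mem_eigenspace_iff.1 hmem)
    exact congrArg (WithLp.toLp 2) (zpow_mulVec_of_eigenvector hdet hw0 h k)
  -- Resolve `y` into its eigencomponents, on which `A^k` acts by `w^k`.
  rw [h₁, ← sum_starProjection_eigenspace hA y, map_sum, inner_sum, Matrix.sum_apply]
  refine Finset.sum_congr rfl fun w hw => ?_
  rw [h₂ w hw, inner_smul_right]
  rfl

end Spectral

/-! ### Matrix polynomials applied to `(A, B)` -/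

section Polynomials

variable {n s : ℕ}

/-- `∑_{j < N} A ^ j B c_j`. -/
def coeffAct (A : SqMat n) (B : BlockVec n s) (N : ℕ) (c : ℕ → SqMat s) : BlockVec n s :=
  ∑ j ∈ Finset.range N, A ^ (j : ℤ) * B * c j

theorem coeffAct_succ (A : SqMat n) (B : BlockVec n s) (N : ℕ) (c : ℕ → SqMat s) :
    coeffAct A B (N + 1) c = coeffAct A B N c + A ^ (N : ℤ) * B * c N :=
  Finset.sum_range_succ _ _

theorem coeffAct_mem (A : SqMat n) (B : BlockVec n s) (N : ℕ) (c : ℕ → SqMat s) :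
    coeffAct A B N c ∈ krylovSpan A B 0 ((N : ℤ) - 1) :=
  Submodule.sum_mem _ fun j hj => by
    rw [Finset.mem_range] at hj
    exact zpow_mul_mem_krylovSpan A B (by lia) (by lia) _

theorem exists_eq_coeffAct {A : SqMat n} {B : BlockVec n s} {N : ℕ} {Z : BlockVec n s}
    (hZ : Z ∈ krylovSpan A B 0 ((N : ℤ) - 1)) : ∃ c, Z = coeffAct A B N c := by
  have h := krylovSpan_eq_blockSpan A B 0 N
  simp only [zero_add] at h
  rw [h] at hZ
  obtain ⟨c, rfl⟩ := hZ
  refine ⟨fun j => if hj : j < N then c ⟨j, hj⟩ else 0, ?_⟩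
  simp [coeffAct, Finset.sum_range]

/-! ### The action of Laurent polynomials and of reversed polynomials -/

theorem laurentAct_add (A : SqMat n) (B : BlockVec n s) (R S : MatLaurent s) :
    laurentAct A B (R + S) = laurentAct A B R + laurentAct A B S := by
  rw [laurentAct, AddMonoidAlgebra.coeff_add]
  exact Finsupp.sum_add_index' (by simp) (by simp [Matrix.mul_add])

theorem laurentAct_zero (A : SqMat n) (B : BlockVec n s) :
    laurentAct A B (0 : MatLaurent s) = 0 := by
  simp [laurentAct]

theorem laurentAct_sum (A : SqMat n) (B : BlockVec n s) {ι : Type*} (t : Finset ι)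
    (f : ι → MatLaurent s) : laurentAct A B (∑ i ∈ t, f i) = ∑ i ∈ t, laurentAct A B (f i) :=
  map_sum (⟨⟨laurentAct A B, laurentAct_zero A B⟩, laurentAct_add A B⟩ :
    MatLaurent s →+ BlockVec n s) f t

theorem laurentAct_C_mul_T (A : SqMat n) (B : BlockVec n s) (c : SqMat s) (k : ℤ) :
    laurentAct A B (LaurentPolynomial.C c * LaurentPolynomial.T k) = A ^ k * B * c := by
  rw [← LaurentPolynomial.single_eq_C_mul_T, laurentAct, AddMonoidAlgebra.coeff_single,
    Finsupp.sum_single_index]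
  simp

theorem laurentAct_T_mul {A : SqMat n} (hA : A ∈ Matrix.unitaryGroup (Fin n) ℂ)
    (B : BlockVec n s) (j : ℤ) (R : MatLaurent s) :
    laurentAct A B (LaurentPolynomial.T j * R) = A ^ j * laurentAct A B R := by
  induction R using LaurentPolynomial.induction_on' with
  | add p q hp hq => rw [mul_add, laurentAct_add, laurentAct_add, hp, hq, Matrix.mul_add]
  | C_mul_T k c =>
    rw [LaurentPolynomial.T_mul, LaurentPolynomial.mul_T_assoc, laurentAct_C_mul_T,
      laurentAct_C_mul_T, add_comm, Matrix.zpow_add (isUnit_det_of_unitary hA)]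
    simp [Matrix.mul_assoc]

theorem laurentAct_monomial (A : SqMat n) (B : BlockVec n s) (k : ℕ) (c : SqMat s) :
    laurentAct A B (Polynomial.toLaurent (Polynomial.monomial k c)) = A ^ (k : ℤ) * B * c := by
  rw [Polynomial.toLaurent_C_mul_T, laurentAct_C_mul_T]

theorem laurentAct_toLaurent (A : SqMat n) (B : BlockVec n s) {N : ℕ} {P : MatPoly s}
    (hP : P.natDegree < N) : laurentAct A B P.toLaurent = coeffAct A B N P.coeff := by
  conv_lhs => rw [P.as_sum_range' N hP]
  rw [map_sum, laurentAct_sum]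
  simp only [laurentAct_monomial]
  rfl

theorem laurentAct_reversedPoly {A : SqMat n} (hA : A ∈ Matrix.unitaryGroup (Fin n) ℂ)
    (B : BlockVec n s) (k : ℕ) (P : MatPoly s) :
    laurentAct A B (reversedPoly k P).toLaurent =
      A ^ (k : ℤ) * coeffAct A⁻¹ B (k + 1) fun j => (P.coeff j)ᴴ := by
  have hdet := isUnit_det_of_unitary hA
  rw [reversedPoly, map_sum, laurentAct_sum, coeffAct, Matrix.mul_sum]
  refine Finset.sum_congr rfl fun j hj => ?_
  rw [Finset.mem_range] at hj
  rw [laurentAct_monomial, Matrix.inv_zpow' hdet, ← Matrix.mul_assoc, ← Matrix.mul_assoc,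
    ← Matrix.zpow_add hdet, Nat.cast_sub (by lia), sub_eq_add_neg]

theorem matEval_eq {N : ℕ} {P : MatPoly s} (hP : P.natDegree < N) (w : ℂ) :
    matEval P w = ∑ k ∈ Finset.range N, w ^ k • P.coeff k :=
  Polynomial.sum_over_range' P (by simp) N hP

/-- The left inner product for `A` is a right inner product for `A⁻¹`. -/
theorem leftInner_eq {A : SqMat n} (hA : A ∈ Matrix.unitaryGroup (Fin n) ℂ) (B : BlockVec n s)
    {M N : ℕ} {P Q : MatPoly s} (hP : P.natDegree < M) (hQ : Q.natDegree < N) :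
    leftInner A B P Q =
      (coeffAct A⁻¹ B M fun j => (P.coeff j)ᴴ)ᴴ * coeffAct A⁻¹ B N fun j => (Q.coeff j)ᴴ := by
  have hdet := isUnit_det_of_unitary hA
  -- On the unit circle conjugation is inversion, so only moments of index `i - j` occur.
  have hw : ∀ w ∈ A.charpoly.roots.toFinset, ∀ i j : ℕ,
      w ^ i * star (w ^ j) = w ^ ((i : ℤ) - j) := by
    intro w hw i j
    have h₁ := norm_of_mem_roots_charpoly hA hw
    have h₂ : w ≠ 0 := right_ne_zero_of_mul_eq_one h₁
    rw [zpow_sub₀ h₂, zpow_natCast, zpow_natCast, div_eq_mul_inv, star_pow, ← inv_pow,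
      ← eq_inv_of_mul_eq_one_left h₁]
    rfl
  have key : ∀ i j : ℕ, ∑ w ∈ A.charpoly.roots.toFinset,
      (w ^ i * star (w ^ j)) • spectralMass A B w = (A⁻¹ ^ (i : ℤ) * B)ᴴ * (A⁻¹ ^ (j : ℤ) * B) := by
    intro i j
    -- For `A` the corresponding inner product would have the moment index `j - i`; passing to `A⁻¹`
    -- gives the required sign.
    rw [Matrix.inv_zpow' hdet, Matrix.inv_zpow' hdet, zpow_mul_conjTranspose_mul hA,
      show -(j : ℤ) - -(i : ℤ) = i - j by ring, ← sum_zpow_smul_spectralMass hA]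
    exact Finset.sum_congr rfl fun w h => by rw [hw w h]
  have h₁ : leftInner A B P Q = ∑ i ∈ Finset.range M, ∑ j ∈ Finset.range N,
      P.coeff i * (∑ w ∈ A.charpoly.roots.toFinset,
        (w ^ i * star (w ^ j)) • spectralMass A B w) * (Q.coeff j)ᴴ := by
    have h₂ : ∀ w, matEval P w * spectralMass A B w * (matEval Q w)ᴴ =
        ∑ i ∈ Finset.range M, ∑ j ∈ Finset.range N,
          P.coeff i * ((w ^ i * star (w ^ j)) • spectralMass A B w) * (Q.coeff j)ᴴ := by
      intro w
      rw [matEval_eq hP, matEval_eq hQ, Matrix.conjTranspose_sum, Matrix.sum_mul, Matrix.sum_mul]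
      simp only [Matrix.mul_sum]
      refine Finset.sum_congr rfl fun i _ => Finset.sum_congr rfl fun j _ => ?_
      simp only [Matrix.conjTranspose_smul, Matrix.smul_mul, Matrix.mul_smul, smul_smul]
      rw [mul_comm]
    rw [leftInner]
    simp only [h₂]
    rw [Finset.sum_comm]
    refine Finset.sum_congr rfl fun i _ => ?_
    rw [Finset.sum_comm]
    refine Finset.sum_congr rfl fun j _ => ?_
    rw [Matrix.mul_sum, Matrix.sum_mul]
  simp only [key] at h₁
  rw [h₁, coeffAct, coeffAct, Matrix.conjTranspose_sum, Matrix.sum_mul]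
  simp only [Matrix.mul_sum]
  refine Finset.sum_congr rfl fun i _ => Finset.sum_congr rfl fun j _ => ?_
  rw [Matrix.conjTranspose_mul _ (P.coeff i)ᴴ, Matrix.conjTranspose_conjTranspose]
  simp only [Matrix.mul_assoc]

/-! ### Szegő systems from orthonormal polynomials -/

theorem isSzegoSystem_of_coeff {A : SqMat n} {B : BlockVec n s} {d : ℕ} {c : ℕ → ℕ → SqMat s}
    (horth : ∀ i ≤ d, ∀ j ≤ d,
      (coeffAct A B (i + 1) (c i))ᴴ * coeffAct A B (j + 1) (c j) = if i = j then 1 else 0)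
    (hratio : ∀ k < d, ((c (k + 1) (k + 1))⁻¹ * c k k).PosDef) :
    IsSzegoSystem A B d (fun k => coeffAct A B (k + 1) (c k)) fun k => c k k where
  leading k _ := by
    simp only [coeffAct_succ, add_sub_cancel_right]
    exact coeffAct_mem A B k (c k)
  isUnit k hk := by
    rcases k with _ | k
    · have h := horth 0 (by lia) 0 (by lia)
      simp only [coeffAct, zero_add, Finset.sum_range_one, if_true] at h
      rw [← Matrix.mul_assoc] at h
      exact (Matrix.isUnit_iff_isUnit_det _).2 (Matrix.isUnit_det_of_left_inverse h)
    -- A positive definite quotient is invertible, hence so is its factor `κ_{k+1}⁻¹`; this excludes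
    -- the default inverse of a singular matrix.
    · have h := (Matrix.isUnit_iff_isUnit_det _).1 (hratio k hk).isUnit
      rw [Matrix.det_mul] at h
      exact (Matrix.isUnit_iff_isUnit_det _).2
        (Matrix.isUnit_nonsing_inv_det_iff.1 (isUnit_of_mul_isUnit_left h))
  orthonormal := horth
  ratio := hratio

variable {A : SqMat n} {B : BlockVec n s} {d : ℕ} {φR φL : ℕ → MatPoly s}

/-- The right orthonormal polynomials applied to `(A, B)`. -/
def rightVectors (A : SqMat n) (B : BlockVec n s) (φR : ℕ → MatPoly s) (k : ℕ) :
    BlockVec n s :=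
  coeffAct A B (k + 1) (φR k).coeff

/-- The left orthonormal polynomials with adjoint coefficients, applied to `(A⁻¹, B)`. -/
def leftVectors (A : SqMat n) (B : BlockVec n s) (φL : ℕ → MatPoly s) (k : ℕ) :
    BlockVec n s :=
  coeffAct A⁻¹ B (k + 1) fun j => ((φL k).coeff j)ᴴ

theorem IsOMPUC.rightSystem (h : IsOMPUC A B d φR φL) :
    IsSzegoSystem A B d (rightVectors A B φR) fun k => (φR k).coeff k := by
  refine isSzegoSystem_of_coeff (c := fun k => (φR k).coeff) (fun i hi j hj => ?_)
    h.leading_right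
  have := h.orthonormal_right i hi j hj
  rwa [rightInner,
    laurentAct_toLaurent A B (N := i + 1) (by rw [h.degree_right i hi]; lia),
    laurentAct_toLaurent A B (N := j + 1) (by rw [h.degree_right j hj]; lia)] at this

/-- Taking adjoints of the coefficients turns left orthonormality into right orthonormality for
`A⁻¹`, and reverses the order in the quotients of leading coefficients. -/
theorem IsOMPUC.leftSystem (hA : A ∈ Matrix.unitaryGroup (Fin n) ℂ)
    (h : IsOMPUC A B d φR φL) :
    IsSzegoSystem A⁻¹ B d (leftVectors A B φL) fun k => ((φL k).coeff k)ᴴ := by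
  refine isSzegoSystem_of_coeff (c := fun k j => ((φL k).coeff j)ᴴ) (fun i hi j hj => ?_)
    fun k hk => ?_
  · rw [← h.orthonormal_left i hi j hj]
    exact (leftInner_eq hA B (by rw [h.degree_left i hi]; lia)
      (by rw [h.degree_left j hj]; lia)).symm
  · have := (h.leading_left k hk).conjTranspose
    rwa [Matrix.conjTranspose_mul, Matrix.conjTranspose_nonsing_inv] at this

theorem IsOMPUC.rightVectors_zero (h : IsOMPUC A B d φR φL) :
    rightVectors A B φR 0 = leftVectors A B φL 0 := by
  simp [rightVectors, leftVectors, coeffAct, h.constants]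

theorem IsOMPUC.laurentAct_right (h : IsOMPUC A B d φR φL) {k : ℕ} (hk : k ≤ d) :
    laurentAct A B (φR k).toLaurent = rightVectors A B φR k :=
  laurentAct_toLaurent A B (by rw [h.degree_right k hk]; lia)

theorem IsOMPUC.cmvVector_eq (hA : A ∈ Matrix.unitaryGroup (Fin n) ℂ)
    (h : IsOMPUC A B d φR φL) {i : ℕ} (hi : i - 1 ≤ d) :
    cmvVector A B φR φL i = systemCMV A (rightVectors A B φR) (leftVectors A B φL) i := by
  rw [cmvVector, cmvBasis, laurentAct_T_mul hA, systemCMV]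
  congr 1
  split_ifs
  · exact laurentAct_reversedPoly hA B _ _
  · exact h.laurentAct_right hi

theorem IsOMPUC.verblunsky_eq (hA : A ∈ Matrix.unitaryGroup (Fin n) ℂ)
    (h : IsOMPUC A B d φR φL) {k : ℕ} (hk : k - 1 ≤ d) :
    verblunsky A B φR φL k =
      systemVerblunsky A (rightVectors A B φR) (leftVectors A B φL) (k - 1) := by
  rw [verblunsky, rightInner, laurentAct_T_mul hA, zpow_one, laurentAct_reversedPoly hA,
    h.laurentAct_right hk]
  rfl

theorem cmvBlock_eq (hA : A ∈ Matrix.unitaryGroup (Fin n) ℂ) (i j : ℕ) :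
    cmvBlock A B φR φL i j = (cmvVector A B φR φL i)ᴴ * A * cmvVector A B φR φL j := by
  rw [cmvBlock, rightInner, laurentAct_T_mul hA, zpow_one, Matrix.mul_assoc]
  rfl

end Polynomials

/-! ### Existence of orthonormal polynomials -/

section Existence

variable {n s : ℕ}

/-- `B, A B, …, A ^ d B` are block independent. -/
def BlockIndependent (A : SqMat n) (B : BlockVec n s) (d : ℕ) : Prop :=
  ∀ k ≤ d, ∀ c : SqMat s, A ^ (k : ℤ) * B * c ∈ krylovSpan A B 0 ((k : ℤ) - 1) → c = 0

theorem blockIndependent_of_finrank {A : SqMat n} {B : BlockVec n s} {d : ℕ}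
    (h : Module.finrank ℂ (krylovSpan A B 0 d) = s ^ 2 * (d + 1)) : BlockIndependent A B d := by
  have heq := krylovSpan_eq_blockSpan A B 0 (d + 1)
  push_cast at heq
  simp only [zero_add, add_sub_cancel_right] at heq
  rw [heq, ← blockMap_injective_iff, injective_iff_map_eq_zero] at h
  intro k hk c hc
  obtain ⟨c', hc'⟩ := exists_eq_coeffAct hc
  -- The assumed dependence, written as a coefficient sequence in the kernel of the injective block
  -- map.
  set e : ℕ → SqMat s := fun j => if j < k then c' j else if j = k then -c else 0 with he
  have h₁ : coeffAct A B (d + 1) e = 0 := by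
    have h₂ : coeffAct A B (d + 1) e = coeffAct A B (k + 1) e := by
      refine (Finset.sum_subset (by simpa using hk) fun j _ hj => ?_).symm
      rw [Finset.mem_range] at hj
      simp only [he]
      rw [if_neg (by lia), if_neg (by lia), Matrix.mul_zero]
    have h₃ : coeffAct A B k e = coeffAct A B k c' := by
      refine Finset.sum_congr rfl fun j hj => ?_
      rw [Finset.mem_range] at hj
      simp only [he, if_pos hj]
    rw [h₂, coeffAct_succ, h₃, ← hc']
    simp [he]
  have h₄ := h (fun j : Fin (d + 1) => e j) (by
    rw [coeffAct, Finset.sum_range] at h₁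
    exact h₁)
  have h₅ := congrFun h₄ ⟨k, by lia⟩
  simpa [he] using h₅

theorem BlockIndependent.posDef {A : SqMat n} {B : BlockVec n s} {d : ℕ}
    (h : BlockIndependent A B d) {k : ℕ} (hk : k ≤ d) {κ : SqMat s} (hκ : IsUnit κ)
    {Z : BlockVec n s} (hZ : Z - A ^ (k : ℤ) * B * κ ∈ krylovSpan A B 0 ((k : ℤ) - 1)) :
    (Zᴴ * Z).PosDef := by
  refine Matrix.PosDef.conjTranspose_mul_self Z ?_
  rw [← Matrix.coe_mulVecLin, ← LinearMap.ker_eq_bot, LinearMap.ker_eq_bot']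
  intro v hv
  rw [Matrix.mulVecLin_apply] at hv
  -- A kernel vector, repeated in every column, becomes a matrix coefficient to which block
  -- independence applies.
  set c : SqMat s := Matrix.of fun i _ => v i with hc
  have hZc : Z * c = 0 := by
    ext i j
    exact congrFun hv i
  have h₁ := mul_right_mem_krylovSpan hZ c
  rw [Matrix.sub_mul, hZc, zero_sub, neg_mem_iff, Matrix.mul_assoc] at h₁
  have h₂ : c = 0 := hκ.mul_right_eq_zero.1 (h k hk _ h₁)
  ext i
  exact congrFun (congrFun h₂ i) i

theorem posDef_sqrt {G : SqMat s} (hG : G.PosDef) : (CFC.sqrt G).PosDef := by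
  have h₁ : (CFC.sqrt G).PosSemidef := Matrix.nonneg_iff_posSemidef.1 (CFC.sqrt_nonneg G)
  rw [h₁.posDef_iff_isUnit]
  have h₂ := CFC.sqrt_mul_sqrt_self G hG.posSemidef.nonneg
  have h₃ := hG.isUnit
  rw [← h₂] at h₃
  exact isUnit_of_mul_isUnit_left h₃

theorem sqrt_inv_mul_mul_sqrt_inv {G : SqMat s} (hG : G.PosDef) :
    ((CFC.sqrt G)⁻¹)ᴴ * G * (CFC.sqrt G)⁻¹ = 1 := by
  have hu := (Matrix.isUnit_iff_isUnit_det _).1 (posDef_sqrt hG).isUnit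
  have h₂ := CFC.sqrt_mul_sqrt_self G hG.posSemidef.nonneg
  have h₃ : (CFC.sqrt G)ᴴ = CFC.sqrt G := (posDef_sqrt hG).1
  rw [Matrix.conjTranspose_nonsing_inv, h₃]
  nth_rw 2 [← h₂]
  rw [← Matrix.mul_assoc, Matrix.nonsing_inv_mul _ hu, Matrix.one_mul,
    Matrix.mul_nonsing_inv _ hu]

theorem exists_normalization {A : SqMat n} {B : BlockVec n s} {d : ℕ}
    (h : BlockIndependent A B d) : ∃ K : SqMat s, Kᴴ * (Bᴴ * B) * K = 1 :=
  ⟨_, sqrt_inv_mul_mul_sqrt_inv (h.posDef (k := 0) (by lia) isUnit_one (by simp))⟩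

/-- The Gram–Schmidt construction of a Szegő system with prescribed constant term. -/
theorem BlockIndependent.exists_isSzegoSystem {A : SqMat n}
    (hA : A ∈ Matrix.unitaryGroup (Fin n) ℂ) {B : BlockVec n s} {d : ℕ}
    (h : BlockIndependent A B d) {K : SqMat s} (hK : Kᴴ * (Bᴴ * B) * K = 1) :
    ∃ X κ, IsSzegoSystem A B d X κ ∧ X 0 = B * K ∧ κ 0 = K := by
  have hdet := isUnit_det_of_unitary hA
  have hKu : IsUnit K :=
    (Matrix.isUnit_iff_isUnit_det _).2 (Matrix.isUnit_det_of_left_inverse hK)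
  have hBK : (B * K)ᴴ * (B * K) = 1 := by
    rw [← hK, Matrix.conjTranspose_mul]; simp only [Matrix.mul_assoc]
  induction d with
  | zero =>
    refine ⟨fun _ => B * K, fun _ => K, ⟨?_, fun _ _ => hKu, ?_, by lia⟩, rfl, rfl⟩
    · intro k hk
      obtain rfl : k = 0 := by lia
      simp
    · intro i hi j hj
      rw [if_pos (by lia), hBK]
  | succ d ih =>
    obtain ⟨X, κ, hX, hX0, hκ0⟩ := ih fun k hk => h k (by lia)
    -- Orthogonalizing `A X_d` rather than `A^(d+1) B` keeps the leading coefficient `κ_d`.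
    set Z := A * X d - ∑ i ∈ Finset.range (d + 1), X i * ((X i)ᴴ * (A * X d)) with hZ
    have hZmem : Z - A ^ ((d + 1 : ℕ) : ℤ) * B * κ d ∈
        krylovSpan A B 0 (((d + 1 : ℕ) : ℤ) - 1) := by
      have h₁ := zpow_mul_left_mem_krylovSpan hdet (hX.leading d le_rfl) 1
      rw [zpow_one, Matrix.mul_sub, Matrix.mul_assoc, mul_zpow_mul_blockVec hA,
        ← Matrix.mul_assoc] at h₁
      have h₂ : ∑ i ∈ Finset.range (d + 1), X i * ((X i)ᴴ * (A * X d)) ∈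
          krylovSpan A B 0 (((d + 1 : ℕ) : ℤ) - 1) := by
        refine Submodule.sum_mem _ fun i hi => mul_right_mem_krylovSpan ?_ _
        rw [Finset.mem_range] at hi
        exact krylovSpan_mono le_rfl (by lia) (hX.mem (k := i) (by lia))
      have h₃ := sub_mem (krylovSpan_mono (by lia) (by push_cast; lia) h₁) h₂
      have h₄ : A ^ ((d + 1 : ℕ) : ℤ) = A ^ (1 + (d : ℤ)) := by congr 1; push_cast; ring
      rw [hZ, h₄]
      convert h₃ using 1
      abel
    have hZorth : ∀ i ≤ d, (X i)ᴴ * Z = 0 := by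
      intro i hi
      have h₁ : ∀ j ∈ Finset.range (d + 1), (X i)ᴴ * (X j * ((X j)ᴴ * (A * X d))) =
          if i = j then (X j)ᴴ * (A * X d) else 0 := by
        intro j hj
        rw [Finset.mem_range] at hj
        rw [← Matrix.mul_assoc, hX.orthonormal i hi j (by lia)]
        split_ifs <;> simp
      rw [hZ, Matrix.mul_sub, Matrix.mul_sum, Finset.sum_congr rfl h₁, Finset.sum_ite_eq,
        if_pos (by rw [Finset.mem_range]; lia), sub_self]
    have hG := h.posDef le_rfl (hX.isUnit d le_rfl) hZmem
    -- With `κ_{d+1} = κ_d ρ⁻¹` the quotient of leading coefficients is `ρ` itself; the Hermitian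
    -- square root makes it positive definite.
    set ρ := CFC.sqrt (Zᴴ * Z) with hρ
    have hρu := (posDef_sqrt hG).isUnit
    have hρd := (Matrix.isUnit_iff_isUnit_det _).1 hρu
    have hZn : (Z * ρ⁻¹)ᴴ * (Z * ρ⁻¹) = 1 := by
      rw [← sqrt_inv_mul_mul_sqrt_inv hG, Matrix.conjTranspose_mul]
      simp only [Matrix.mul_assoc, hρ]
    refine ⟨Function.update X (d + 1) (Z * ρ⁻¹), Function.update κ (d + 1) (κ d * ρ⁻¹),
      ⟨?_, ?_, ?_, ?_⟩, ?_, ?_⟩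
    · intro k hk
      rcases (by lia : k = d + 1 ∨ k ≤ d) with rfl | hk
      · rw [Function.update_self, Function.update_self]
        have := mul_right_mem_krylovSpan hZmem ρ⁻¹
        rwa [Matrix.sub_mul, Matrix.mul_assoc _ (κ d)] at this
      · rw [Function.update_of_ne (by lia), Function.update_of_ne (by lia)]
        exact hX.leading k hk
    · intro k hk
      rcases (by lia : k = d + 1 ∨ k ≤ d) with rfl | hk
      · rw [Function.update_self]
        exact (hX.isUnit d le_rfl).mul (posDef_sqrt hG).inv.isUnit
      · rw [Function.update_of_ne (by lia)]
        exact hX.isUnit k hk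
    · intro i hi j hj
      rcases (by lia : i = d + 1 ∨ i ≤ d) with rfl | hi <;>
        rcases (by lia : j = d + 1 ∨ j ≤ d) with rfl | hj
      · rw [Function.update_self, hZn, if_pos rfl]
      · rw [Function.update_self, Function.update_of_ne (by lia), if_neg (by lia),
          Matrix.conjTranspose_mul, Matrix.mul_assoc]
        have := congrArg Matrix.conjTranspose (hZorth j hj)
        rw [Matrix.conjTranspose_mul, Matrix.conjTranspose_conjTranspose] at this
        simp [this]
      · rw [Function.update_self, Function.update_of_ne (by lia), if_neg (by lia),
          ← Matrix.mul_assoc, hZorth i hi, Matrix.zero_mul]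
      · rw [Function.update_of_ne (by lia), Function.update_of_ne (by lia)]
        exact hX.orthonormal i hi j hj
    · intro k hk
      rcases (by lia : k = d ∨ k < d) with rfl | hk
      · rw [Function.update_self, Function.update_of_ne (by lia), Matrix.mul_inv_rev,
          Matrix.nonsing_inv_nonsing_inv _ hρd, Matrix.mul_assoc, Matrix.nonsing_inv_mul _
          ((Matrix.isUnit_iff_isUnit_det _).1 (hX.isUnit k le_rfl)), Matrix.mul_one]
        exact posDef_sqrt hG
      · rw [Function.update_of_ne (by lia), Function.update_of_ne (by lia)]
        exact hX.ratio k hk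
    · rw [Function.update_of_ne (by lia), hX0]
    · rw [Function.update_of_ne (by lia), hκ0]

/-- The coefficients of the polynomials of a Szegő system. -/
theorem IsSzegoSystem.exists_coeff {A : SqMat n} {B : BlockVec n s} {d : ℕ}
    {X : ℕ → BlockVec n s} {κ : ℕ → SqMat s} (h : IsSzegoSystem A B d X κ) :
    ∃ c : ℕ → ℕ → SqMat s, (∀ k, c k k = κ k) ∧ (∀ k ≤ d, X k = coeffAct A B (k + 1) (c k)) := by
  have h₁ : ∀ k, ∃ c, k ≤ d → X k - A ^ (k : ℤ) * B * κ k = coeffAct A B k c := by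
    intro k
    by_cases hk : k ≤ d
    · obtain ⟨c, hc⟩ := exists_eq_coeffAct (h.leading k hk)
      exact ⟨c, fun _ => hc⟩
    · exact ⟨0, fun h => absurd h hk⟩
  choose c hc using h₁
  refine ⟨fun k => Function.update (c k) k (κ k), by simp, fun k hk => ?_⟩
  have h₂ : coeffAct A B k (Function.update (c k) k (κ k)) = coeffAct A B k (c k) := by
    refine Finset.sum_congr rfl fun j hj => ?_
    rw [Finset.mem_range] at hj
    rw [Function.update_of_ne hj.ne]
  rw [coeffAct_succ, h₂, ← hc k hk]
  simp

/-- The polynomial `∑_{j ≤ k} z ^ j c_j`. -/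
def polyOfCoeff (k : ℕ) (c : ℕ → SqMat s) : MatPoly s :=
  ∑ j ∈ Finset.range (k + 1), Polynomial.monomial j (c j)

theorem polyOfCoeff_coeff {k j : ℕ} (hj : j ≤ k) (c : ℕ → SqMat s) :
    (polyOfCoeff k c).coeff j = c j := by
  rw [polyOfCoeff, Polynomial.finsetSum_coeff, Finset.sum_eq_single j]
  · simp
  · intro i _ hi; rw [Polynomial.coeff_monomial, if_neg hi]
  · intro h; rw [Finset.mem_range] at h; lia

theorem polyOfCoeff_natDegree {k : ℕ} {c : ℕ → SqMat s} (hc : c k ≠ 0) :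
    (polyOfCoeff k c).natDegree = k := by
  refine Polynomial.natDegree_eq_of_le_of_coeff_ne_zero ?_ (by rwa [polyOfCoeff_coeff le_rfl])
  refine Polynomial.natDegree_sum_le_of_forall_le _ _ fun j hj => ?_
  rw [Finset.mem_range] at hj
  exact (Polynomial.natDegree_monomial_le _).trans (by lia)

theorem coeffAct_congr {A : SqMat n} {B : BlockVec n s} {N : ℕ} {c c' : ℕ → SqMat s}
    (h : ∀ j < N, c j = c' j) : coeffAct A B N c = coeffAct A B N c' :=
  Finset.sum_congr rfl fun j hj => by rw [h j (Finset.mem_range.1 hj)]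

/-- Gram–Schmidt for `A` gives the right polynomials; for `A⁻¹`, after taking adjoints of the
coefficients, it gives the left ones. The common start `K` yields the normalization of the
constants. -/
theorem exists_isOMPUC {A : SqMat n} (hA : A ∈ Matrix.unitaryGroup (Fin n) ℂ)
    {B : BlockVec n s} {d : ℕ} (hs : 0 < s) (h : BlockIndependent A B d)
    (h' : BlockIndependent A⁻¹ B d) {K : SqMat s} (hK : Kᴴ * (Bᴴ * B) * K = 1) :
    ∃ φR φL : ℕ → MatPoly s, IsOMPUC A B d φR φL ∧ φR 0 = Polynomial.C K := by
  -- Makes the matrix ring nontrivial, so invertible leading coefficients are nonzero and the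
  -- degrees are exact.
  have : Nonempty (Fin s) := ⟨⟨0, hs⟩⟩
  obtain ⟨X, κ, hX, -, hκ⟩ := h.exists_isSzegoSystem hA hK
  obtain ⟨Y, κ', hY, -, hκ'⟩ := h'.exists_isSzegoSystem (inv_mem_unitaryGroup hA) hK
  obtain ⟨c, hcκ, hc⟩ := hX.exists_coeff
  obtain ⟨c', hcκ', hc'⟩ := hY.exists_coeff
  have hne : ∀ k ≤ d, c k k ≠ 0 := fun k hk => by rw [hcκ]; exact (hX.isUnit k hk).ne_zero
  have hne' : ∀ k ≤ d, (c' k k)ᴴ ≠ 0 := fun k hk => by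
    rw [hcκ', Matrix.conjTranspose_eq_zero.ne]; exact (hY.isUnit k hk).ne_zero
  have hdeg : ∀ k ≤ d, (polyOfCoeff k (c k)).natDegree = k := fun k hk =>
    polyOfCoeff_natDegree (hne k hk)
  have hdeg' : ∀ k ≤ d, (polyOfCoeff k fun j => (c' k j)ᴴ).natDegree = k := fun k hk =>
    polyOfCoeff_natDegree (hne' k hk)
  have hact : ∀ k ≤ d, laurentAct A B (polyOfCoeff k (c k)).toLaurent = X k := fun k hk => by
    rw [laurentAct_toLaurent A B (N := k + 1) (by rw [hdeg k hk]; lia), hc k hk]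
    exact coeffAct_congr fun j hj => polyOfCoeff_coeff (by lia) _
  have hact' : ∀ k ≤ d, coeffAct A⁻¹ B (k + 1)
      (fun i => ((polyOfCoeff k fun j => (c' k j)ᴴ).coeff i)ᴴ) = Y k := fun k hk => by
    rw [hc' k hk]
    exact coeffAct_congr fun j hj => by rw [polyOfCoeff_coeff (by lia)]; simp
  refine ⟨fun k => polyOfCoeff k (c k), fun k => polyOfCoeff k fun j => (c' k j)ᴴ,
    ⟨hdeg, hdeg', ?_, ?_, ?_, ?_, ?_⟩, ?_⟩
  · intro i hi j hj
    rw [rightInner, hact i hi, hact j hj, hX.orthonormal i hi j hj]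
  · intro i hi j hj
    rw [leftInner_eq hA B (M := i + 1) (N := j + 1) (by rw [hdeg' i hi]; lia)
      (by rw [hdeg' j hj]; lia), hact' i hi, hact' j hj, hY.orthonormal i hi j hj]
  · rw [polyOfCoeff_coeff le_rfl, polyOfCoeff_coeff le_rfl, hcκ, hcκ', hκ, hκ']
  · intro k hk
    simp only [polyOfCoeff_coeff le_rfl, hcκ]
    exact hX.ratio k hk
  · intro k hk
    simp only [polyOfCoeff_coeff le_rfl, hcκ']
    have := (hY.ratio k hk).conjTranspose
    rwa [Matrix.conjTranspose_mul, Matrix.conjTranspose_nonsing_inv] at this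
  · simp [polyOfCoeff, hcκ, hκ]

end Existence

/-! ### The blocks of the CMV matrix -/

section Blocks

variable {n s : ℕ}

theorem cmvL_odd_self (α : ℕ → SqMat s) {i : ℕ} (hi : i % 2 = 1) : cmvL α i i = (α i)ᴴ :=
  if_pos ⟨hi, rfl⟩

theorem cmvL_odd_succ (α : ℕ → SqMat s) {i j : ℕ} (hi : i % 2 = 1) (hj : j = i + 1) :
    cmvL α i j = rhoL (α i) := by
  rw [cmvL, if_neg (by lia), if_pos (by lia)]

theorem cmvL_even_pred (α : ℕ → SqMat s) {i j : ℕ} (hi : i % 2 = 0) (hj : i = j + 1) :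
    cmvL α i j = rhoR (α j) := by
  subst hj
  rw [cmvL, if_neg (by lia), if_neg (by lia), if_pos (by lia), Nat.add_sub_cancel]

theorem cmvL_even_self (α : ℕ → SqMat s) {i j : ℕ} (hi : i % 2 = 0) (hj : i = j + 1) :
    cmvL α i i = -α j := by
  subst hj
  rw [cmvL, if_neg (by lia), if_neg (by lia), if_neg (by lia), if_pos (by lia),
    Nat.add_sub_cancel]

theorem cmvL_eq_zero (α : ℕ → SqMat s) {i j : ℕ} (hi : 1 ≤ i)
    (h : (i - 1) / 2 ≠ (j - 1) / 2) : cmvL α i j = 0 := by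
  rw [cmvL, if_neg (by lia), if_neg (by lia), if_neg (by lia), if_neg (by lia)]

theorem cmvM_one_one (α : ℕ → SqMat s) : cmvM α 1 1 = 1 := if_pos ⟨rfl, rfl⟩

theorem cmvM_even_self (α : ℕ → SqMat s) {i : ℕ} (hi : i % 2 = 0) : cmvM α i i = (α i)ᴴ := by
  rw [cmvM, if_neg (by lia), if_pos (by lia)]

theorem cmvM_even_succ (α : ℕ → SqMat s) {i j : ℕ} (hi : i % 2 = 0) (hj : j = i + 1) :
    cmvM α i j = rhoL (α i) := by
  rw [cmvM, if_neg (by lia), if_neg (by lia), if_pos (by lia)]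

theorem cmvM_odd_pred (α : ℕ → SqMat s) {i j : ℕ} (hi : i % 2 = 1) (hj : i = j + 1)
    (hj0 : 0 < j) : cmvM α i j = rhoR (α j) := by
  subst hj
  rw [cmvM, if_neg (by lia), if_neg (by lia), if_neg (by lia), if_pos (by lia),
    Nat.add_sub_cancel]

theorem cmvM_odd_self (α : ℕ → SqMat s) {i j : ℕ} (hi : i % 2 = 1) (hj : i = j + 1)
    (hj0 : 0 < j) : cmvM α i i = -α j := by
  subst hj
  rw [cmvM, if_neg (by lia), if_neg (by lia), if_neg (by lia), if_neg (by lia),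
    if_pos (by lia), Nat.add_sub_cancel]

theorem cmvM_eq_zero (α : ℕ → SqMat s) {i j : ℕ} (h : i / 2 ≠ j / 2) : cmvM α i j = 0 := by
  rw [cmvM, if_neg (by lia), if_neg (by lia), if_neg (by lia), if_neg (by lia),
    if_neg (by lia)]

/-- The relations between CMV vectors, CMV blocks and Verblunsky coefficients from which the
recurrences follow. -/
structure IsCMVSystem (A : SqMat n) (B : BlockVec n s) (m : ℕ) (W : ℕ → BlockVec n s)
    (C : ℕ → ℕ → SqMat s) (α : ℕ → SqMat s) : Prop where
  unitary : A ∈ Matrix.unitaryGroup (Fin n) ℂ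
  mem : ∀ i ∈ Finset.Icc 1 m,
    W i ∈ krylovSpan A B (-(((i - 1) / 2 : ℕ) : ℤ)) ((i / 2 : ℕ) : ℤ)
  expand : ∀ p, 1 ≤ p → p ≤ m → ∀ Z ∈ krylovSpan A B (-(((p - 1) / 2 : ℕ) : ℤ)) ((p / 2 : ℕ) : ℤ),
    Z = ∑ i ∈ Finset.Icc 1 p, W i * ((W i)ᴴ * Z)
  orthonormal : ∀ i ∈ Finset.Icc 1 m, ∀ j ∈ Finset.Icc 1 m,
    (W i)ᴴ * W j = if i = j then 1 else 0
  block : ∀ i ∈ Finset.Icc 1 m, ∀ j ∈ Finset.Icc 1 m, C i j = (W i)ᴴ * A * W j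
  factor : ∀ i ∈ Finset.Icc 1 m, ∀ j ∈ Finset.Icc 1 m,
    C i j = ∑ l ∈ Finset.Icc 1 m, cmvL α i l * cmvM α l j
  norm_lt : ∀ k ∈ Finset.Ico 1 m, ‖Matrix.toEuclideanCLM (𝕜 := ℂ) (α k)‖ < 1
  isUnit_rhoR : ∀ k ∈ Finset.Ico 1 m, IsUnit (rhoR (α k))
  isUnit_rhoL : ∀ k ∈ Finset.Ico 1 m, IsUnit (rhoL (α k))

theorem IsOMPUC.isCMVSystem {A : SqMat n} {B : BlockVec n s} {m : ℕ} {φR φL : ℕ → MatPoly s}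
    (hA : A ∈ Matrix.unitaryGroup (Fin n) ℂ) (h : IsOMPUC A B (m - 1) φR φL) :
    IsCMVSystem A B m (cmvVector A B φR φL) (cmvBlock A B φR φL) (verblunsky A B φR φL) := by
  have hX := h.rightSystem
  have hY := h.leftSystem hA
  set X := rightVectors A B φR
  set Y := leftVectors A B φL
  have h0 : X 0 = Y 0 := h.rightVectors_zero
  have hW : ∀ i ∈ Finset.Icc 1 m, cmvVector A B φR φL i = systemCMV A X Y i := fun i hi =>
    h.cmvVector_eq hA (by rw [Finset.mem_Icc] at hi; lia)
  have hα : ∀ k, k ≤ m → verblunsky A B φR φL k = systemVerblunsky A X Y (k - 1) :=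
    fun k hk => h.verblunsky_eq hA (by lia)
  refine ⟨hA, ?_, ?_, ?_, fun i _ j _ => cmvBlock_eq hA i j, ?_, ?_, ?_, ?_⟩
  · intro i hi
    rw [hW i hi]
    rw [Finset.mem_Icc] at hi
    exact systemCMV_mem hA hX hY hi.1 hi.2
  · intro p hp hpm Z hZ
    refine (eq_sum_systemCMV hA hX hY hp hpm hZ).trans (Finset.sum_congr rfl fun i hi => ?_)
    rw [hW i (by rw [Finset.mem_Icc] at hi ⊢; lia)]
  · intro i hi j hj
    rw [hW i hi, hW j hj, systemCMV_orthonormal hA hX hY hi hj]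
  · intro i hi j hj
    rw [cmvBlock_eq hA, hW i hi, hW j hj]
    rw [systemCMV_factorization hA hX hY (α := fun k => systemVerblunsky A X Y (k - 1)) h0
      (fun _ => rfl) hi hj]
    refine Finset.sum_congr rfl fun l hl => ?_
    -- The two families of Verblunsky coefficients are identified only for indices up to `m`, so
    -- they are exchanged entry by entry inside the cutoff.
    rw [Finset.mem_Icc] at hi hj hl
    have e₁ : cmvL (fun k => systemVerblunsky A X Y (k - 1)) i l =
        cmvL (verblunsky A B φR φL) i l := by
      unfold cmvL; rw [hα i hi.2, hα (i - 1) (by lia)]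
    have e₂ : cmvM (fun k => systemVerblunsky A X Y (k - 1)) l j =
        cmvM (verblunsky A B φR φL) l j := by
      unfold cmvM; rw [hα l hl.2, hα (l - 1) (by lia)]
    rw [e₁, e₂]
  · intro k hk
    rw [Finset.mem_Ico] at hk
    rw [hα k hk.2.le]
    exact hX.norm_verblunsky_lt_one hA hY (by lia)
  · intro k hk
    rw [Finset.mem_Ico] at hk
    rw [hα k hk.2.le]
    exact (hX.posDef_rhoR hA hY (by lia)).isUnit
  · intro k hk
    rw [Finset.mem_Ico] at hk
    rw [hα k hk.2.le]
    exact (hX.posDef_rhoL hA hY (by lia)).isUnit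

variable {A : SqMat n} {B : BlockVec n s} {m : ℕ} {W : ℕ → BlockVec n s}
  {C : ℕ → ℕ → SqMat s} {α : ℕ → SqMat s}

/-- The values `(l - 1) / 2` and `l / 2` together determine `l ≥ 1`, so the matrix product has at
most one nonzero term. -/
theorem IsCMVSystem.block_eq (h : IsCMVSystem A B m W C α) {i j : ℕ} (l : ℕ) (hi : 1 ≤ i)
    (him : i ≤ m) (hj : 1 ≤ j) (hjm : j ≤ m) (hl : 1 ≤ l) (hlm : l ≤ m)
    (hil : (i - 1) / 2 = (l - 1) / 2) (hlj : l / 2 = j / 2) :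
    C i j = cmvL α i l * cmvM α l j := by
  rw [h.factor i (Finset.mem_Icc.2 ⟨hi, him⟩) j (Finset.mem_Icc.2 ⟨hj, hjm⟩)]
  refine Finset.sum_eq_single_of_mem l (Finset.mem_Icc.2 ⟨hl, hlm⟩) fun l' hl' hne => ?_
  rw [Finset.mem_Icc] at hl'
  by_cases h₁ : (i - 1) / 2 = (l' - 1) / 2
  · rw [cmvM_eq_zero α (by lia), mul_zero]
  · rw [cmvL_eq_zero α hi h₁, zero_mul]

/-- For `i ∈ {2k - 1, 2k}` one has `(i - 1) / 2 * 2 = 2k - 2`, so the condition says that `j` is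
outside `2k - 2, …, 2k + 1`; then no `l` is shared by the supports of the two factors. -/
theorem IsCMVSystem.block_eq_zero (h : IsCMVSystem A B m W C α) {i j : ℕ} (hi : 1 ≤ i)
    (him : i ≤ m) (hj : 1 ≤ j) (hjm : j ≤ m)
    (hij : (i - 1) / 2 * 2 + 3 < j ∨ j + 2 < (i - 1) / 2 * 2 + 2) : C i j = 0 := by
  rw [h.factor i (Finset.mem_Icc.2 ⟨hi, him⟩) j (Finset.mem_Icc.2 ⟨hj, hjm⟩)]
  refine Finset.sum_eq_zero fun l hl => ?_
  rw [Finset.mem_Icc] at hl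
  by_cases h₁ : (i - 1) / 2 = (l - 1) / 2
  · rw [cmvM_eq_zero α (by lia), mul_zero]
  · rw [cmvL_eq_zero α hi h₁, zero_mul]

theorem IsCMVSystem.block_one_one (h : IsCMVSystem A B m W C α) (hm : 1 ≤ m) :
    C 1 1 = (α 1)ᴴ := by
  rw [h.block_eq 1 le_rfl hm le_rfl hm le_rfl hm rfl rfl, cmvL_odd_self α rfl, cmvM_one_one,
    mul_one]

theorem IsCMVSystem.block_two_one (h : IsCMVSystem A B m W C α) (hm : 2 ≤ m) :
    C 2 1 = rhoR (α 1) := by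
  rw [h.block_eq 1 (by lia) hm le_rfl (by lia) le_rfl (by lia) rfl rfl,
    cmvL_even_pred α rfl rfl, cmvM_one_one, mul_one]

theorem IsCMVSystem.blocks_even_column (h : IsCMVSystem A B m W C α) {k : ℕ} (hk : 1 ≤ k)
    (hkm : 2 * k ≤ m) :
    C (2 * k - 1) (2 * k) = rhoL (α (2 * k - 1)) * (α (2 * k))ᴴ ∧
      C (2 * k) (2 * k) = -α (2 * k - 1) * (α (2 * k))ᴴ := by
  constructor
  · rw [h.block_eq (2 * k) (by lia) (by lia) (by lia) (by lia) (by lia) (by lia) (by lia)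
      (by lia), cmvL_odd_succ α (by lia) (by lia), cmvM_even_self α (by lia)]
  · rw [h.block_eq (2 * k) (by lia) (by lia) (by lia) (by lia) (by lia) (by lia) (by lia)
      (by lia), cmvL_even_self α (j := 2 * k - 1) (by lia) (by lia),
      cmvM_even_self α (by lia)]

theorem IsCMVSystem.blocks_odd (h : IsCMVSystem A B m W C α) {k : ℕ} (hk : 1 ≤ k)
    (hkm : 2 * k + 1 ≤ m) :
    C (2 * k - 1) (2 * k + 1) = rhoL (α (2 * k - 1)) * rhoL (α (2 * k)) ∧
      C (2 * k) (2 * k + 1) = -α (2 * k - 1) * rhoL (α (2 * k)) ∧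
      C (2 * k + 1) (2 * k) = (α (2 * k + 1))ᴴ * rhoR (α (2 * k)) ∧
      C (2 * k + 1) (2 * k + 1) = -(α (2 * k + 1))ᴴ * α (2 * k) := by
  refine ⟨?_, ?_, ?_, ?_⟩
  · rw [h.block_eq (2 * k) (by lia) (by lia) (by lia) (by lia) (by lia) (by lia) (by lia)
      (by lia), cmvL_odd_succ α (by lia) (by lia), cmvM_even_succ α (by lia) rfl]
  · rw [h.block_eq (2 * k) (by lia) (by lia) (by lia) (by lia) (by lia) (by lia) (by lia)
      (by lia), cmvL_even_self α (j := 2 * k - 1) (by lia) (by lia),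
      cmvM_even_succ α (by lia) rfl]
  · rw [h.block_eq (2 * k + 1) (by lia) (by lia) (by lia) (by lia) (by lia) (by lia) (by lia)
      (by lia), cmvL_odd_self α (by lia), cmvM_odd_pred α (by lia) rfl (by lia)]
  · rw [h.block_eq (2 * k + 1) (by lia) (by lia) (by lia) (by lia) (by lia) (by lia) (by lia)
      (by lia), cmvL_odd_self α (by lia), cmvM_odd_self α (j := 2 * k) (by lia) rfl (by lia),
      mul_neg, neg_mul]

theorem IsCMVSystem.blocks_even_row (h : IsCMVSystem A B m W C α) {k : ℕ} (hk : 1 ≤ k)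
    (hkm : 2 * k + 2 ≤ m) :
    C (2 * k + 2) (2 * k) = rhoR (α (2 * k + 1)) * rhoR (α (2 * k)) ∧
      C (2 * k + 2) (2 * k + 1) = -rhoR (α (2 * k + 1)) * α (2 * k) := by
  constructor
  · rw [h.block_eq (2 * k + 1) (by lia) (by lia) (by lia) (by lia) (by lia) (by lia) (by lia)
      (by lia), cmvL_even_pred α (by lia) rfl, cmvM_odd_pred α (by lia) rfl (by lia)]
  · rw [h.block_eq (2 * k + 1) (by lia) (by lia) (by lia) (by lia) (by lia) (by lia) (by lia)
      (by lia), cmvL_even_pred α (by lia) rfl,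
      cmvM_odd_self α (j := 2 * k) (by lia) rfl (by lia), mul_neg, neg_mul]

/-! ### Block matrices and their cutoffs -/

theorem blockRow_conjTranspose_mul_mul (A : SqMat n) (m : ℕ) (W : ℕ → BlockVec n s) :
    (blockRow m W)ᴴ * A * blockRow m W = cutoff m fun i j => (W i)ᴴ * A * W j := by
  ext p q
  simp only [blockRow, cutoff, Matrix.mul_apply, Matrix.of_apply, Matrix.conjTranspose_apply]

theorem cutoff_mul_cutoff (m : ℕ) (C D : ℕ → ℕ → SqMat s) :
    cutoff m C * cutoff m D = cutoff m fun i j => ∑ l ∈ Finset.Icc 1 m, C i l * D l j := by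
  ext p q
  have : Finset.Icc 1 m = (Finset.range m).image (· + 1) := by
    ext x; simp only [Finset.mem_Icc, Finset.mem_image, Finset.mem_range]
    constructor
    · rintro ⟨h₁, h₂⟩; exact ⟨x - 1, by lia, by lia⟩
    · rintro ⟨y, hy, rfl⟩; lia
  rw [Matrix.mul_apply, Fintype.sum_prod_type]
  simp only [cutoff, Matrix.of_apply]
  rw [this, Finset.sum_image (by simp), Finset.sum_range, Matrix.sum_apply]
  simp only [Matrix.mul_apply]

theorem cutoff_congr {C D : ℕ → ℕ → SqMat s}
    (h : ∀ i ∈ Finset.Icc 1 m, ∀ j ∈ Finset.Icc 1 m, C i j = D i j) :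
    cutoff m C = cutoff m D := by
  ext p q
  simp only [cutoff, Matrix.of_apply]
  rw [h _ (by simp) _ (by simp)]

/-! ### Short recurrences -/

/-- Multiplication by `A` shifts the window by one; the last hypothesis ensures that it still fits
into that of `W_1, …, W_p`. -/
theorem IsCMVSystem.mul_eq_sum (h : IsCMVSystem A B m W C α) {j p : ℕ} (hj : 1 ≤ j)
    (hp : p ≤ m) (hjp : j ≤ p) (h₁ : j / 2 + 1 ≤ p / 2) :
    A * W j = ∑ i ∈ Finset.Icc 1 p, W i * C i j := by
  have hmem := zpow_mul_left_mem_krylovSpan (isUnit_det_of_unitary h.unitary)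
    (h.mem j (Finset.mem_Icc.2 ⟨hj, hjp.trans hp⟩)) 1
  rw [zpow_one] at hmem
  refine (h.expand p (by lia) hp _ (krylovSpan_mono (by lia) (by lia) hmem)).trans
    (Finset.sum_congr rfl fun i hi => ?_)
  rw [Finset.mem_Icc] at hi
  rw [h.block i (by rw [Finset.mem_Icc]; lia) j (by rw [Finset.mem_Icc]; lia)]
  simp only [Matrix.mul_assoc]

theorem IsCMVSystem.conjTranspose_mul_eq_sum (h : IsCMVSystem A B m W C α) {i p : ℕ}
    (hi : 1 ≤ i) (hp : p ≤ m) (hip : i ≤ p) (h₁ : (i - 1) / 2 + 1 ≤ (p - 1) / 2) :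
    Aᴴ * W i = ∑ j ∈ Finset.Icc 1 p, W j * (C i j)ᴴ := by
  have hmem := zpow_mul_left_mem_krylovSpan (isUnit_det_of_unitary h.unitary)
    (h.mem i (Finset.mem_Icc.2 ⟨hi, hip.trans hp⟩)) (-1)
  rw [Matrix.zpow_neg_one, inv_eq_of_unitary h.unitary] at hmem
  refine (h.expand p (by lia) hp _ (krylovSpan_mono (by lia) (by lia) hmem)).trans
    (Finset.sum_congr rfl fun j hj => ?_)
  rw [Finset.mem_Icc] at hj
  rw [h.block i (by rw [Finset.mem_Icc]; lia) j (by rw [Finset.mem_Icc]; lia)]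
  simp [Matrix.mul_assoc]

theorem sum_Icc_last_four {M : Type*} [AddCommMonoid M] (f : ℕ → M) (p : ℕ)
    (h : ∀ i, 1 ≤ i → i ≤ p → f i = 0) :
    ∑ i ∈ Finset.Icc 1 (p + 4), f i = f (p + 1) + f (p + 2) + f (p + 3) + f (p + 4) := by
  rw [Finset.sum_Icc_succ_top (by lia), Finset.sum_Icc_succ_top (by lia),
    Finset.sum_Icc_succ_top (by lia), Finset.sum_Icc_succ_top (by lia),
    Finset.sum_eq_zero fun i hi => h i (Finset.mem_Icc.1 hi).1 (Finset.mem_Icc.1 hi).2, zero_add]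

theorem IsCMVSystem.mul_one_eq (h : IsCMVSystem A B m W C α) (hm : 2 ≤ m) :
    A * W 1 = W 1 * C 1 1 + W 2 * C 2 1 := by
  rw [h.mul_eq_sum (p := 2) le_rfl hm (by lia) (by lia)]
  simp [Finset.sum_Icc_succ_top]

theorem IsCMVSystem.conjTranspose_mul_eq_three (h : IsCMVSystem A B m W C α) (hm : 3 ≤ m)
    {i : ℕ} (hi : 1 ≤ i) (hi2 : i ≤ 2) :
    Aᴴ * W i = W 1 * (C i 1)ᴴ + W 2 * (C i 2)ᴴ + W 3 * (C i 3)ᴴ := by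
  rw [h.conjTranspose_mul_eq_sum (p := 3) hi hm (by lia) (by lia)]
  simp [Finset.sum_Icc_succ_top]

theorem IsCMVSystem.conjTranspose_mul_eq_four (h : IsCMVSystem A B m W C α) {k : ℕ}
    (hk : 2 ≤ k) (hkm : 2 * k + 1 ≤ m) {i : ℕ} (hi : i = 2 * k - 1 ∨ i = 2 * k) :
    Aᴴ * W i = W (2 * k - 2) * (C i (2 * k - 2))ᴴ + W (2 * k - 1) * (C i (2 * k - 1))ᴴ +
      W (2 * k) * (C i (2 * k))ᴴ + W (2 * k + 1) * (C i (2 * k + 1))ᴴ := by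
  obtain ⟨q, rfl⟩ : ∃ q, k = q + 2 := ⟨k - 2, by lia⟩
  have e₁ : 2 * (q + 2) - 2 = 2 * q + 1 + 1 := by lia
  have e₂ : 2 * (q + 2) - 1 = 2 * q + 1 + 2 := by lia
  have e₃ : 2 * (q + 2) = 2 * q + 1 + 3 := by lia
  -- The first window that contains `Aᴴ W_i` has `p = 2k + 1`; the zero pattern removes all but the
  -- last four terms.
  rw [h.conjTranspose_mul_eq_sum (p := 2 * q + 1 + 4) (by lia) (by lia) (by lia) (by lia),
    sum_Icc_last_four _ (2 * q + 1) fun j hj hjq => ?_, e₁, e₂, e₃]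
  rw [h.block_eq_zero (by lia) (by lia) (by lia) (by lia) (by lia), Matrix.conjTranspose_zero,
    Matrix.mul_zero]

theorem IsCMVSystem.mul_eq_four (h : IsCMVSystem A B m W C α) {k : ℕ} (hk : 1 ≤ k)
    (hkm : 2 * k + 2 ≤ m) {j : ℕ} (hj : j = 2 * k ∨ j = 2 * k + 1) :
    A * W j = W (2 * k - 1) * C (2 * k - 1) j + W (2 * k) * C (2 * k) j +
      W (2 * k + 1) * C (2 * k + 1) j + W (2 * k + 2) * C (2 * k + 2) j := by
  obtain ⟨q, rfl⟩ : ∃ q, k = q + 1 := ⟨k - 1, by lia⟩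
  have e₁ : 2 * (q + 1) - 1 = 2 * q + 1 := by lia
  have e₂ : 2 * (q + 1) = 2 * q + 2 := by lia
  rw [h.mul_eq_sum (p := 2 * q + 4) (by lia) (by lia) (by lia) (by lia),
    sum_Icc_last_four _ (2 * q) fun i hi hiq => ?_, e₁, e₂]
  rw [h.block_eq_zero (by lia) (by lia) (by lia) (by lia) (by lia), Matrix.mul_zero]

end Blocks

/-! ### Correctness of the procedure -/

section Procedure

variable {n s : ℕ}

theorem setBlock_apply (C : ℕ → ℕ → SqMat s) (i j : ℕ) (X : SqMat s) (i' j' : ℕ) :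
    setBlock C i j X i' j' = if i' = i ∧ j' = j then X else C i' j' := by
  by_cases hi : i' = i
  · subst hi
    by_cases hj : j' = j
    · subst hj; simp [setBlock]
    · simp [setBlock, hj]
  · simp [setBlock, hi]

/-- The indices of the blocks that are assigned when the block vectors `W_1, …, W_p` have been
computed, together with those that vanish. -/
def IsAssigned (p i j : ℕ) : Prop :=
  i ∈ Finset.Icc 1 p ∧ j ∈ Finset.Icc 1 p ∧ ¬(i = p ∧ j = p) ∧
    ¬(p % 2 = 1 ∧ i = p ∧ j + 1 = p) ∧ ¬(p % 2 = 0 ∧ i + 1 = p ∧ j = p)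

/-- The state agrees with the exact data after the computation of `W_1, …, W_p`. -/
structure StateCorrect (W : ℕ → BlockVec n s) (C : ℕ → ℕ → SqMat s) (α : ℕ → SqMat s) (p : ℕ)
    (st : CMVState n s) : Prop where
  W_zero : st.W 0 = 0
  W_eq : ∀ k, 1 ≤ k → k ≤ p → st.W k = W k
  α_eq : ∀ k, 1 ≤ k → k < p → st.α k = α k
  C_eq : ∀ i j, IsAssigned p i j → st.C i j = C i j
  C_unassigned : ∀ i j, ¬IsAssigned p i j → st.C i j = 0

variable {A : SqMat n} {B : BlockVec n s} {m : ℕ} {W : ℕ → BlockVec n s}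
  {C : ℕ → ℕ → SqMat s} {α : ℕ → SqMat s}

theorem isUnit_det_conjTranspose {c : SqMat s} (hc : IsUnit c) : IsUnit (cᴴ).det :=
  (Matrix.isUnit_iff_isUnit_det _).1 ((Matrix.isUnit_conjTranspose _).2 hc)

theorem IsCMVSystem.stateCorrect_init (h : IsCMVSystem A B m W C α) (hm : 2 ≤ m) :
    StateCorrect W C α 2 (cmvInit A (W 1)).val := by
  have h1 : 1 ∈ Finset.Icc 1 m := Finset.mem_Icc.2 ⟨le_rfl, by lia⟩
  have hC11 : (W 1)ᴴ * (A * W 1) = C 1 1 := by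
    rw [h.block 1 h1 1 h1, Matrix.mul_assoc]
  have hα : ((W 1)ᴴ * (A * W 1))ᴴ = α 1 := by
    rw [hC11, h.block_one_one (by lia), Matrix.conjTranspose_conjTranspose]
  have hC21 : rhoR ((W 1)ᴴ * (A * W 1))ᴴ = C 2 1 := by rw [hα, h.block_two_one hm]
  have hu : IsUnit (C 2 1).det := by
    rw [h.block_two_one hm]
    exact (Matrix.isUnit_iff_isUnit_det _).1 (h.isUnit_rhoR 1 (Finset.mem_Ico.2 ⟨le_rfl, hm⟩))
  have hW2 : (A * W 1 - W 1 * ((W 1)ᴴ * (A * W 1))) *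
      (rhoR ((W 1)ᴴ * (A * W 1))ᴴ)⁻¹ = W 2 := by
    rw [hC21, hC11, h.mul_one_eq hm, add_sub_cancel_left, Matrix.mul_assoc,
      Matrix.mul_nonsing_inv _ hu, Matrix.mul_one]
  -- The value of the counted program unfolds definitionally, so its fields can be stated explicitly
  -- and then rewritten into the exact data.
  have eW : (cmvInit A (W 1)).val.W = Function.update (Function.update (fun _ => 0) 1 (W 1)) 2
      ((A * W 1 - W 1 * ((W 1)ᴴ * (A * W 1))) * (rhoR ((W 1)ᴴ * (A * W 1))ᴴ)⁻¹) := rfl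
  have eα : (cmvInit A (W 1)).val.α =
      Function.update (fun _ : ℕ => (0 : SqMat s)) 1 ((W 1)ᴴ * (A * W 1))ᴴ := rfl
  have eC : (cmvInit A (W 1)).val.C = setBlock (setBlock (fun _ _ => 0) 1 1
      ((W 1)ᴴ * (A * W 1))) 2 1 (rhoR ((W 1)ᴴ * (A * W 1))ᴴ) := rfl
  rw [hW2] at eW
  rw [hα] at eα
  rw [hC21, hC11] at eC
  refine ⟨?_, ?_, ?_, ?_, ?_⟩
  · simp [eW]
  · intro k hk hk2
    rcases (by lia : k = 1 ∨ k = 2) with rfl | rfl <;> simp [eW]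
  · intro k hk hk2
    obtain rfl : k = 1 := by lia
    simp [eα]
  · intro i j hij
    simp only [IsAssigned, Finset.mem_Icc] at hij
    rw [eC, setBlock_apply, setBlock_apply]
    rcases (by lia : i = 1 ∧ j = 1 ∨ i = 2 ∧ j = 1) with ⟨rfl, rfl⟩ | ⟨rfl, rfl⟩ <;> simp
  · intro i j hij
    simp only [IsAssigned, Finset.mem_Icc] at hij
    rw [eC, setBlock_apply, setBlock_apply, if_neg (by lia), if_neg (by lia)]

theorem IsCMVSystem.stateCorrect_oddStep (h : IsCMVSystem A B m W C α) {k : ℕ} (hk : 1 ≤ k)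
    (hkm : 2 * k + 1 ≤ m) {st : CMVState n s} (hst : StateCorrect W C α (2 * k) st) :
    StateCorrect W C α (2 * k + 1) (cmvOddStep A k st).val := by
  have hW₁ := hst.W_eq (2 * k - 1) (by lia) (by lia)
  have hW₂ := hst.W_eq (2 * k) (by lia) (by lia)
  have hα₁ := hst.α_eq (2 * k - 1) (by lia) (by lia)
  obtain ⟨hCa, hCb⟩ := h.blocks_even_column hk (by lia)
  obtain ⟨hCc, hCd, -, -⟩ := h.blocks_odd hk hkm
  have hL₁ := h.isUnit_rhoL (2 * k - 1) (Finset.mem_Ico.2 ⟨by lia, by lia⟩)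
  have hL₂ := h.isUnit_rhoL (2 * k) (Finset.mem_Ico.2 ⟨by lia, by lia⟩)
  have hL₁H : (rhoL (α (2 * k - 1)))ᴴ = rhoL (α (2 * k - 1)) :=
    (Matrix.nonneg_iff_posSemidef.1 (CFC.sqrt_nonneg _)).1
  have hc : (Aᴴ * st.W (2 * k - 1))ᴴ * st.W (2 * k) = C (2 * k - 1) (2 * k) := by
    rw [hW₁, hW₂, h.block _ (Finset.mem_Icc.2 ⟨by lia, by lia⟩) _
      (Finset.mem_Icc.2 ⟨by lia, by lia⟩), Matrix.conjTranspose_mul,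
      Matrix.conjTranspose_conjTranspose]
  have ha : (C (2 * k - 1) (2 * k))ᴴ * (rhoL (α (2 * k - 1)))⁻¹ = α (2 * k) := by
    rw [hCa, Matrix.conjTranspose_mul, Matrix.conjTranspose_conjTranspose, hL₁H,
      Matrix.mul_assoc, Matrix.mul_nonsing_inv _ ((Matrix.isUnit_iff_isUnit_det _).1 hL₁),
      Matrix.mul_one]
  have hrec : Aᴴ * W (2 * k - 1) - st.W (2 * k - 2) * (st.C (2 * k - 1) (2 * k - 2))ᴴ -
      W (2 * k - 1) * (st.C (2 * k - 1) (2 * k - 1))ᴴ - W (2 * k) * (C (2 * k - 1) (2 * k))ᴴ =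
      W (2 * k + 1) * (C (2 * k - 1) (2 * k + 1))ᴴ := by
    rw [hst.C_eq (2 * k - 1) (2 * k - 1) (by simp only [IsAssigned, Finset.mem_Icc]; lia)]
    -- For `k = 1` the exact recurrence has only three terms; the fourth one in the program vanishes
    -- because `W_0 = 0`.
    rcases hk.eq_or_lt with rfl | hk
    · have := h.conjTranspose_mul_eq_three hkm (i := 1) le_rfl (by lia)
      simp only [Nat.mul_one, Nat.sub_self, hst.W_zero, Matrix.zero_mul, sub_zero]
      rw [this]
      abel
    · rw [hst.C_eq (2 * k - 1) (2 * k - 2) (by simp only [IsAssigned, Finset.mem_Icc]; lia),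
        hst.W_eq (2 * k - 2) (by lia) (by lia),
        h.conjTranspose_mul_eq_four hk hkm (Or.inl rfl)]
      abel
  have hu : IsUnit (C (2 * k - 1) (2 * k + 1))ᴴ.det := by
    rw [hCc]; exact isUnit_det_conjTranspose (hL₁.mul hL₂)
  have eW : (cmvOddStep A k st).val.W = Function.update st.W (2 * k + 1)
      ((Aᴴ * st.W (2 * k - 1) - st.W (2 * k - 2) * (st.C (2 * k - 1) (2 * k - 2))ᴴ -
        st.W (2 * k - 1) * (st.C (2 * k - 1) (2 * k - 1))ᴴ -
        st.W (2 * k) * ((Aᴴ * st.W (2 * k - 1))ᴴ * st.W (2 * k))ᴴ) *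
        ((rhoL (st.α (2 * k - 1)) * rhoL (((Aᴴ * st.W (2 * k - 1))ᴴ * st.W (2 * k))ᴴ *
          (rhoL (st.α (2 * k - 1)))⁻¹))ᴴ)⁻¹) := rfl
  have eα : (cmvOddStep A k st).val.α = Function.update st.α (2 * k)
      (((Aᴴ * st.W (2 * k - 1))ᴴ * st.W (2 * k))ᴴ * (rhoL (st.α (2 * k - 1)))⁻¹) := rfl
  have eC : (cmvOddStep A k st).val.C =
      setBlock (setBlock (setBlock (setBlock st.C (2 * k - 1) (2 * k)
        ((Aᴴ * st.W (2 * k - 1))ᴴ * st.W (2 * k)))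
        (2 * k - 1) (2 * k + 1) (rhoL (st.α (2 * k - 1)) *
          rhoL (((Aᴴ * st.W (2 * k - 1))ᴴ * st.W (2 * k))ᴴ * (rhoL (st.α (2 * k - 1)))⁻¹)))
        (2 * k) (2 * k) (-st.α (2 * k - 1) *
          (((Aᴴ * st.W (2 * k - 1))ᴴ * st.W (2 * k))ᴴ * (rhoL (st.α (2 * k - 1)))⁻¹)ᴴ))
        (2 * k) (2 * k + 1) (-st.α (2 * k - 1) *
          rhoL (((Aᴴ * st.W (2 * k - 1))ᴴ * st.W (2 * k))ᴴ *
            (rhoL (st.α (2 * k - 1)))⁻¹)) := rfl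
  rw [hc, hα₁, ha, hW₁, hW₂, hrec, ← hCc, Matrix.mul_assoc, Matrix.mul_nonsing_inv _ hu,
    Matrix.mul_one] at eW
  rw [hc, hα₁, ha] at eα
  rw [hc, hα₁, ha, ← hCc, ← hCb, ← hCd] at eC
  refine ⟨?_, ?_, ?_, ?_, ?_⟩
  · rw [eW, Function.update_of_ne (by lia), hst.W_zero]
  · intro l hl hlk
    rw [eW]
    rcases (by lia : l = 2 * k + 1 ∨ l ≤ 2 * k) with rfl | hlk
    · rw [Function.update_self]
    · rw [Function.update_of_ne (by lia), hst.W_eq l hl hlk]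
  · intro l hl hlk
    rw [eα]
    rcases (by lia : l = 2 * k ∨ l < 2 * k) with rfl | hlk
    · rw [Function.update_self]
    · rw [Function.update_of_ne (by lia), hst.α_eq l hl hlk]
  · intro i j hij
    rw [eC, setBlock_apply, setBlock_apply, setBlock_apply, setBlock_apply]
    split_ifs with h₁ h₂ h₃ h₄
    · rw [h₁.1, h₁.2]
    · rw [h₂.1, h₂.2]
    · rw [h₃.1, h₃.2]
    · rw [h₄.1, h₄.2]
    -- A block that becomes valid in this step without being written lies in the zero pattern, and
    -- its stored value is the default zero.
    · by_cases ho : IsAssigned (2 * k) i j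
      · exact hst.C_eq i j ho
      · rw [hst.C_unassigned i j ho]
        simp only [IsAssigned, Finset.mem_Icc] at hij ho
        rw [h.block_eq_zero (by lia) (by lia) (by lia) (by lia) (by lia)]
  · intro i j hij
    have ho : ¬IsAssigned (2 * k) i j := by
      simp only [IsAssigned, Finset.mem_Icc] at hij ⊢
      lia
    simp only [IsAssigned, Finset.mem_Icc] at hij
    rw [eC, setBlock_apply, setBlock_apply, setBlock_apply, setBlock_apply, if_neg (by lia),
      if_neg (by lia), if_neg (by lia), if_neg (by lia), hst.C_unassigned i j ho]

theorem IsCMVSystem.stateCorrect_evenStep (h : IsCMVSystem A B m W C α) {k : ℕ} (hk : 1 ≤ k)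
    (hkm : 2 * k + 2 ≤ m) {st : CMVState n s} (hst : StateCorrect W C α (2 * k + 1) st) :
    StateCorrect W C α (2 * k + 2) (cmvEvenStep A k st).val := by
  have hW₁ := hst.W_eq (2 * k) (by lia) (by lia)
  have hW₂ := hst.W_eq (2 * k + 1) (by lia) (by lia)
  have hα₁ := hst.α_eq (2 * k) (by lia) (by lia)
  obtain ⟨-, -, hCa, hCb⟩ := h.blocks_odd hk (by lia)
  obtain ⟨hCc, hCd⟩ := h.blocks_even_row hk hkm
  have hR₁ := h.isUnit_rhoR (2 * k) (Finset.mem_Ico.2 ⟨by lia, by lia⟩)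
  have hR₂ := h.isUnit_rhoR (2 * k + 1) (Finset.mem_Ico.2 ⟨by lia, by lia⟩)
  have hR₁H : (rhoR (α (2 * k)))ᴴ = rhoR (α (2 * k)) :=
    (Matrix.nonneg_iff_posSemidef.1 (CFC.sqrt_nonneg _)).1
  have hc : (st.W (2 * k + 1))ᴴ * (A * st.W (2 * k)) = C (2 * k + 1) (2 * k) := by
    rw [hW₁, hW₂, h.block _ (Finset.mem_Icc.2 ⟨by lia, by lia⟩) _
      (Finset.mem_Icc.2 ⟨by lia, by lia⟩), Matrix.mul_assoc]
  have ha : (rhoR (α (2 * k)))⁻¹ * (C (2 * k + 1) (2 * k))ᴴ = α (2 * k + 1) := by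
    rw [hCa, Matrix.conjTranspose_mul, Matrix.conjTranspose_conjTranspose, hR₁H,
      ← Matrix.mul_assoc, Matrix.nonsing_inv_mul _ ((Matrix.isUnit_iff_isUnit_det _).1 hR₁),
      Matrix.one_mul]
  have hrec : A * W (2 * k) - st.W (2 * k - 1) * st.C (2 * k - 1) (2 * k) -
      W (2 * k) * st.C (2 * k) (2 * k) - W (2 * k + 1) * C (2 * k + 1) (2 * k) =
      W (2 * k + 2) * C (2 * k + 2) (2 * k) := by
    rw [hst.C_eq (2 * k) (2 * k) (by simp only [IsAssigned, Finset.mem_Icc]; lia),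
      hst.C_eq (2 * k - 1) (2 * k) (by simp only [IsAssigned, Finset.mem_Icc]; lia),
      hst.W_eq (2 * k - 1) (by lia) (by lia), h.mul_eq_four hk hkm (Or.inl rfl)]
    abel
  have hu : IsUnit (C (2 * k + 2) (2 * k)).det := by
    rw [hCc]; exact (Matrix.isUnit_iff_isUnit_det _).1 (hR₂.mul hR₁)
  have eW : (cmvEvenStep A k st).val.W = Function.update st.W (2 * k + 2)
      ((A * st.W (2 * k) - st.W (2 * k - 1) * st.C (2 * k - 1) (2 * k) -
        st.W (2 * k) * st.C (2 * k) (2 * k) -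
        st.W (2 * k + 1) * ((st.W (2 * k + 1))ᴴ * (A * st.W (2 * k)))) *
        (rhoR ((rhoR (st.α (2 * k)))⁻¹ * ((st.W (2 * k + 1))ᴴ * (A * st.W (2 * k)))ᴴ) *
          rhoR (st.α (2 * k)))⁻¹) := rfl
  have eα : (cmvEvenStep A k st).val.α = Function.update st.α (2 * k + 1)
      ((rhoR (st.α (2 * k)))⁻¹ * ((st.W (2 * k + 1))ᴴ * (A * st.W (2 * k)))ᴴ) := rfl
  have eC : (cmvEvenStep A k st).val.C =
      setBlock (setBlock (setBlock (setBlock st.C (2 * k + 1) (2 * k)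
        ((st.W (2 * k + 1))ᴴ * (A * st.W (2 * k))))
        (2 * k + 1) (2 * k + 1)
          (-((rhoR (st.α (2 * k)))⁻¹ * ((st.W (2 * k + 1))ᴴ * (A * st.W (2 * k)))ᴴ)ᴴ *
            st.α (2 * k)))
        (2 * k + 2) (2 * k)
          (rhoR ((rhoR (st.α (2 * k)))⁻¹ * ((st.W (2 * k + 1))ᴴ * (A * st.W (2 * k)))ᴴ) *
            rhoR (st.α (2 * k))))
        (2 * k + 2) (2 * k + 1)
          (-rhoR ((rhoR (st.α (2 * k)))⁻¹ * ((st.W (2 * k + 1))ᴴ * (A * st.W (2 * k)))ᴴ) *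
            st.α (2 * k)) := rfl
  rw [hc, hα₁, ha, hW₁, hW₂, hrec, ← hCc, Matrix.mul_assoc, Matrix.mul_nonsing_inv _ hu,
    Matrix.mul_one] at eW
  rw [hc, hα₁, ha] at eα
  rw [hc, hα₁, ha, ← hCc, ← hCb, ← hCd] at eC
  refine ⟨?_, ?_, ?_, ?_, ?_⟩
  · rw [eW, Function.update_of_ne (by lia), hst.W_zero]
  · intro l hl hlk
    rw [eW]
    rcases (by lia : l = 2 * k + 2 ∨ l ≤ 2 * k + 1) with rfl | hlk
    · rw [Function.update_self]
    · rw [Function.update_of_ne (by lia), hst.W_eq l hl hlk]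
  · intro l hl hlk
    rw [eα]
    rcases (by lia : l = 2 * k + 1 ∨ l < 2 * k + 1) with rfl | hlk
    · rw [Function.update_self]
    · rw [Function.update_of_ne (by lia), hst.α_eq l hl hlk]
  · intro i j hij
    rw [eC, setBlock_apply, setBlock_apply, setBlock_apply, setBlock_apply]
    split_ifs with h₁ h₂ h₃ h₄
    · rw [h₁.1, h₁.2]
    · rw [h₂.1, h₂.2]
    · rw [h₃.1, h₃.2]
    · rw [h₄.1, h₄.2]
    · by_cases ho : IsAssigned (2 * k + 1) i j
      · exact hst.C_eq i j ho
      · rw [hst.C_unassigned i j ho]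
        simp only [IsAssigned, Finset.mem_Icc] at hij ho
        rw [h.block_eq_zero (by lia) (by lia) (by lia) (by lia) (by lia)]
  · intro i j hij
    have ho : ¬IsAssigned (2 * k + 1) i j := by
      simp only [IsAssigned, Finset.mem_Icc] at hij ⊢
      lia
    simp only [IsAssigned, Finset.mem_Icc] at hij
    rw [eC, setBlock_apply, setBlock_apply, setBlock_apply, setBlock_apply, if_neg (by lia),
      if_neg (by lia), if_neg (by lia), if_neg (by lia), hst.C_unassigned i j ho]

theorem IsCMVSystem.stateCorrect_loop (h : IsCMVSystem A B m W C α) (t : ℕ) (ht : t + 2 ≤ m) :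
    StateCorrect W C α (t + 2) (cmvLoop A (W 1) t).val := by
  induction t with
  | zero => exact h.stateCorrect_init ht
  | succ t ih =>
    have hst := ih (by lia)
    have e : (cmvLoop A (W 1) (t + 1)).val =
        (cmvStep A (t + 3) (cmvLoop A (W 1) t).val).val := rfl
    rw [e, cmvStep]
    split_ifs with hpar
    · obtain ⟨k, hk⟩ : ∃ k, t + 2 = 2 * k := ⟨(t + 2) / 2, by lia⟩
      rw [hk] at hst
      rw [show (t + 3) / 2 = k by lia, show t + 1 + 2 = 2 * k + 1 by lia]
      exact h.stateCorrect_oddStep (by lia) (by lia) hst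
    · obtain ⟨k, hk⟩ : ∃ k, t + 2 = 2 * k + 1 := ⟨(t + 1) / 2, by lia⟩
      rw [hk] at hst
      rw [show (t + 3) / 2 - 1 = k by lia, show t + 1 + 2 = 2 * k + 2 by lia]
      exact h.stateCorrect_evenStep (by lia) (by lia) hst

theorem IsCMVSystem.stateCorrect_procedure (h : IsCMVSystem A B m W C α) (hm : 2 ≤ m) :
    StateCorrect W C α m (cmvProcedure A (W 1) m).val := by
  have := h.stateCorrect_loop (m - 2) (by lia)
  rwa [show m - 2 + 2 = m by lia] at this

theorem IsCMVSystem.procedure_W (h : IsCMVSystem A B m W C α) {k : ℕ}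
    (hk : k ∈ Finset.Icc 1 m) : (cmvProcedure A (W 1) m).val.W k = W k := by
  rw [Finset.mem_Icc] at hk
  by_cases hm : 2 ≤ m
  · exact (h.stateCorrect_procedure hm).W_eq k hk.1 hk.2
  -- For `m = 1` the truncated `m - 2` still runs the initialization, which stores the input as
  -- `W_1` whatever it computes for `W_2`.
  · obtain rfl : m = 1 := by lia
    obtain rfl : k = 1 := by lia
    rfl

/-! ### Cost of an iteration -/

/-- One inner product and four products by `s × s` matrices cost `10 s² n`, the three differences `3
s n`. -/
theorem cmvStep_cost (A : SqMat n) (j : ℕ) (st : CMVState n s) :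
    (cmvStep A j st).cost = ⟨1, 1, 10 * s ^ 2 * n + 3 * (s * n)⟩ := by
  have e₁ : ∀ k, (cmvOddStep A k st).cost.flops = 0 + (2 * s ^ 2 * n + (2 * s ^ 2 * n +
      (s * n + (2 * s ^ 2 * n + (s * n + (2 * s ^ 2 * n + (s * n +
      (2 * s ^ 2 * n + 0)))))))) := fun k => rfl
  have e₂ : ∀ k, (cmvEvenStep A k st).cost.flops = 0 + (2 * s ^ 2 * n + (2 * s ^ 2 * n +
      (s * n + (2 * s ^ 2 * n + (s * n + (2 * s ^ 2 * n + (s * n +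
      (2 * s ^ 2 * n + 0)))))))) := fun k => rfl
  rw [cmvStep]
  split_ifs
  · ext
    · rfl
    · rfl
    · rw [e₁]; ring
  · ext
    · rfl
    · rfl
    · rw [e₂]; ring

theorem cmvStep_flops_le (A : SqMat n) (j : ℕ) (st : CMVState n s) :
    (cmvStep A j st).cost.flops ≤ 13 * s ^ 2 * n := by
  rw [cmvStep_cost]
  have h : s * n ≤ s ^ 2 * n := Nat.mul_le_mul_right n (Nat.le_self_pow two_ne_zero s)
  calc 10 * s ^ 2 * n + 3 * (s * n) ≤ 10 * s ^ 2 * n + 3 * (s ^ 2 * n) := by lia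
    _ = 13 * s ^ 2 * n := by ring

end Procedure

end

theorem mainTheorem8 (n s m : ℕ) (hs : 0 < s) (hm : 1 ≤ m) (A : SqMat n) (B : BlockVec n s)
    (hA : A ∈ Matrix.unitaryGroup (Fin n) ℂ)
    (hdim : Module.finrank ℂ (extBlockKrylov A B m) = s ^ 2 * m) :
    -- existence of the normalized right and left orthonormal polynomials up to degree `m - 1`
    (∃ K : SqMat s, Kᴴ * (Bᴴ * B) * K = 1) ∧
    (∀ K : SqMat s, Kᴴ * (Bᴴ * B) * K = 1 →
      ∃ φR φL : ℕ → MatPoly s, IsOMPUC A B (m - 1) φR φL ∧ φR 0 = Polynomial.C K) ∧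
    -- for all such polynomials:
    (∀ φR φL : ℕ → MatPoly s, IsOMPUC A B (m - 1) φR φL →
      ∀ (W : ℕ → BlockVec n s) (C : ℕ → ℕ → SqMat s) (α : ℕ → SqMat s),
      W = cmvVector A B φR φL → C = cmvBlock A B φR φL → α = verblunsky A B φR φL →
      -- the block vectors `W_1, …, W_m` form an orthonormal basis
      (∀ i ∈ Finset.Icc 1 m, ∀ j ∈ Finset.Icc 1 m, (W i)ᴴ * W j = if i = j then 1 else 0) ∧
      blockSpan (fun k : Fin m => W (k + 1)) = extBlockKrylov A B m ∧
      -- the CMV blocks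
      (∀ i ∈ Finset.Icc 1 m, ∀ j ∈ Finset.Icc 1 m, C i j = (W i)ᴴ * A * W j) ∧
      -- the projection of `A` is the cutoff CMV matrix, and the latter is the product of the
      -- cutoffs of `L` and `M`
      (blockRow m W)ᴴ * A * blockRow m W = cutoff m C ∧
      cutoff m C = cutoff m (cmvL α) * cutoff m (cmvM α) ∧
      (∀ k ∈ Finset.Ico 1 m, ‖Matrix.toEuclideanCLM (𝕜 := ℂ) (α k)‖ < 1) ∧
      -- the blocks in terms of the Verblunsky coefficients, and the zero pattern
      C 1 1 = (α 1)ᴴ ∧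
      (2 ≤ m → C 2 1 = rhoR (α 1)) ∧
      (∀ k, 1 ≤ k → 2 * k ≤ m →
        C (2 * k - 1) (2 * k) = rhoL (α (2 * k - 1)) * (α (2 * k))ᴴ ∧
        C (2 * k) (2 * k) = -α (2 * k - 1) * (α (2 * k))ᴴ) ∧
      (∀ k, 1 ≤ k → 2 * k + 1 ≤ m →
        C (2 * k - 1) (2 * k + 1) = rhoL (α (2 * k - 1)) * rhoL (α (2 * k)) ∧
        C (2 * k) (2 * k + 1) = -α (2 * k - 1) * rhoL (α (2 * k)) ∧
        C (2 * k + 1) (2 * k) = (α (2 * k + 1))ᴴ * rhoR (α (2 * k)) ∧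
        C (2 * k + 1) (2 * k + 1) = -(α (2 * k + 1))ᴴ * α (2 * k)) ∧
      (∀ k, 1 ≤ k → 2 * k + 2 ≤ m →
        C (2 * k + 2) (2 * k) = rhoR (α (2 * k + 1)) * rhoR (α (2 * k)) ∧
        C (2 * k + 2) (2 * k + 1) = -rhoR (α (2 * k + 1)) * α (2 * k)) ∧
      (∀ k, 1 ≤ k → ∀ i ∈ Finset.Icc 1 m, (i = 2 * k - 1 ∨ i = 2 * k) →
        ∀ j ∈ Finset.Icc 1 m, (j + 2 < 2 * k ∨ 2 * k + 1 < j) → C i j = 0) ∧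
      -- the short recurrences
      (2 ≤ m → A * W 1 = W 1 * C 1 1 + W 2 * C 2 1) ∧
      (3 ≤ m → Aᴴ * W 1 = W 1 * (C 1 1)ᴴ + W 2 * (C 1 2)ᴴ + W 3 * (C 1 3)ᴴ) ∧
      (3 ≤ m → Aᴴ * W 2 = W 1 * (C 2 1)ᴴ + W 2 * (C 2 2)ᴴ + W 3 * (C 2 3)ᴴ) ∧
      (∀ k, 2 ≤ k → 2 * k + 1 ≤ m →
        Aᴴ * W (2 * k - 1) =
          W (2 * k - 2) * (C (2 * k - 1) (2 * k - 2))ᴴ +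
          W (2 * k - 1) * (C (2 * k - 1) (2 * k - 1))ᴴ +
          W (2 * k) * (C (2 * k - 1) (2 * k))ᴴ +
          W (2 * k + 1) * (C (2 * k - 1) (2 * k + 1))ᴴ ∧
        Aᴴ * W (2 * k) =
          W (2 * k - 2) * (C (2 * k) (2 * k - 2))ᴴ +
          W (2 * k - 1) * (C (2 * k) (2 * k - 1))ᴴ +
          W (2 * k) * (C (2 * k) (2 * k))ᴴ +
          W (2 * k + 1) * (C (2 * k) (2 * k + 1))ᴴ) ∧
      (∀ k, 1 ≤ k → 2 * k + 2 ≤ m →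
        A * W (2 * k) =
          W (2 * k - 1) * C (2 * k - 1) (2 * k) + W (2 * k) * C (2 * k) (2 * k) +
          W (2 * k + 1) * C (2 * k + 1) (2 * k) + W (2 * k + 2) * C (2 * k + 2) (2 * k) ∧
        A * W (2 * k + 1) =
          W (2 * k - 1) * C (2 * k - 1) (2 * k + 1) + W (2 * k) * C (2 * k) (2 * k + 1) +
          W (2 * k + 1) * C (2 * k + 1) (2 * k + 1) +
          W (2 * k + 2) * C (2 * k + 2) (2 * k + 1)) ∧
      -- the procedure, started with the orthonormal block vector `W_1 = B φR_0`
      W 1 = B * (φR 0).coeff 0 ∧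
      (∀ k ∈ Finset.Icc 1 m, (cmvProcedure A (W 1) m).val.W k = W k) ∧
      (∀ k ∈ Finset.Ico 1 m, (cmvProcedure A (W 1) m).val.α k = α k ∧
        IsUnit (rhoR (α k)) ∧ IsUnit (rhoL (α k))) ∧
      (∀ i ∈ Finset.Icc 1 m, ∀ j ∈ Finset.Icc 1 m,
        ¬ (i = m ∧ j = m) →
        ¬ (m % 2 = 1 ∧ i = m ∧ j + 1 = m) →
        ¬ (m % 2 = 0 ∧ i + 1 = m ∧ j = m) →
        (cmvProcedure A (W 1) m).val.C i j = C i j)) ∧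
    -- the cost of one iteration
    (∀ (st : CMVState n s) (j : ℕ), 3 ≤ j →
      (cmvStep A j st).cost.matvecs = 1 ∧ (cmvStep A j st).cost.inners = 1 ∧
      (cmvStep A j st).cost.flops ≤ 13 * s ^ 2 * n) := by
  have hdet := isUnit_det_of_unitary hA
  have hK := extBlockKrylov_eq_krylovSpan A B m hm
  have hind : BlockIndependent A B (m - 1) := by
    apply blockIndependent_of_finrank
    -- Shifting the powers `0, …, m - 1` down by `(m - 1) / 2` gives the window of the extended
    -- Krylov space. For `A⁻¹` below, the powers `-(m - 1), …, 0` are shifted up by `m / 2` to the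
    -- same window.
    rw [← finrank_krylovSpan_shift hdet B 0 _ (-(((m - 1) / 2 : ℕ) : ℤ)), add_zero,
      show -(((m - 1) / 2 : ℕ) : ℤ) + ((m - 1 : ℕ) : ℤ) = ((m / 2 : ℕ) : ℤ) by lia, ← hK, hdim,
      Nat.sub_add_cancel hm]
  have hind' : BlockIndependent A⁻¹ B (m - 1) := by
    apply blockIndependent_of_finrank
    rw [krylovSpan_inv hA, ← finrank_krylovSpan_shift hdet B _ _ ((m / 2 : ℕ) : ℤ),
      show ((m / 2 : ℕ) : ℤ) + -((m - 1 : ℕ) : ℤ) = -(((m - 1) / 2 : ℕ) : ℤ) by lia, neg_zero,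
      add_zero, ← hK, hdim, Nat.sub_add_cancel hm]
  refine ⟨exists_normalization hind, fun K hKB => exists_isOMPUC hA hs hind hind' hKB, ?_,
    fun st j _ => ⟨by rw [cmvStep_cost], by rw [cmvStep_cost], cmvStep_flops_le A j st⟩⟩
  rintro φR φL hφ W C α rfl rfl rfl
  have h := hφ.isCMVSystem hA
  refine ⟨h.orthonormal, ?_, h.block, ?_, ?_, h.norm_lt, h.block_one_one hm, h.block_two_one,
    fun k hk hkm => h.blocks_even_column hk hkm, fun k hk hkm => h.blocks_odd hk hkm,
    fun k hk hkm => h.blocks_even_row hk hkm, ?_, h.mul_one_eq,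
    fun hm3 => h.conjTranspose_mul_eq_three hm3 le_rfl (by lia),
    fun hm3 => h.conjTranspose_mul_eq_three hm3 (by lia) le_rfl,
    fun k hk hkm => ⟨h.conjTranspose_mul_eq_four hk hkm (Or.inl rfl),
      h.conjTranspose_mul_eq_four hk hkm (Or.inr rfl)⟩,
    fun k hk hkm => ⟨h.mul_eq_four hk hkm (Or.inl rfl), h.mul_eq_four hk hkm (Or.inr rfl)⟩,
    ?_, fun k hk => h.procedure_W hk, ?_, ?_⟩
  · have hb : ((m / 2 : ℕ) : ℤ) = -(((m - 1) / 2 : ℕ) : ℤ) + m - 1 := by lia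
    rw [hK, hb]
    refine blockSpan_eq_krylovSpan_of_orthonormal (fun i j => ?_) fun i => ?_
    · rw [h.orthonormal _ (by simp) _ (by simp)]
      simp [Fin.ext_iff]
    · rw [← hb]
      have := i.2
      exact krylovSpan_mono (by lia) (by lia) (h.mem (i + 1) (by simp))
  · rw [blockRow_conjTranspose_mul_mul]
    exact cutoff_congr fun i hi j hj => (h.block i hi j hj).symm
  · rw [cutoff_mul_cutoff]
    exact cutoff_congr h.factor
  · intro k hk i hi hik j hj hjk
    rw [Finset.mem_Icc] at hi hj
    exact h.block_eq_zero hi.1 hi.2 hj.1 hj.2 (by lia)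
  -- The vector `W_1` comes from the reversed left constant; the normalization of the constants
  -- identifies it with the right one.
  · rw [hφ.cmvVector_eq hA (by lia), systemCMV_odd _ _ _ 0, mul_zero, ← hφ.rightVectors_zero]
    simp [rightVectors, coeffAct]
  · intro k hk
    refine ⟨?_, h.isUnit_rhoR k hk, h.isUnit_rhoL k hk⟩
    rw [Finset.mem_Ico] at hk
    exact (h.stateCorrect_procedure (by lia)).α_eq k hk.1 hk.2
  · intro i hi j hj h₁ h₂ h₃
    -- For `m = 1` the only pair of indices is the excluded `(m, m)`.
    have hm2 : 2 ≤ m := by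
      rw [Finset.mem_Icc] at hi hj
      lia
    exact (h.stateCorrect_procedure hm2).C_eq i j ⟨hi, hj, h₁, h₂, h₃⟩
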